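/- \textbf{Setting.} Let $\omega=e^{i\pi/4}$. On $n$ qubits write Pauli operators as $i^sX^xZ^z$ with $x,z\in\mathbb F_2^n$. A unitary is \emph{phase-CSS} if it is a product of gates $S_j$, $CZ_{jk}$, $CX_{ct}$ ($c$ control, $t$ target; two-qubit gates on distinct qubits); it is stored by its binary-symplectic representation, i.e. by the Paulis $UX_jU^\dagger$, $UZ_jU^\dagger$ (every phase-CSS unitary has one). Let $\tilde H=\omega H$, and for a set $J$ of qubits let $U_H$ be the tensor product of $\tilde H$ on $J$ and $I$ elsewhere. A \emph{phased Bruhat decomposition} of $C$ is $C=\omega^mU_{ph}U_HPV_{ph}$ with $m\in\mathbb Z/8$, $U_{ph},V_{ph}$ phase-CSS and $P$ a Pauli operator. \textbf{CSS orbit.} Fix an arbitrary enumeration of the qubits; whenever an index (or a second index) with a given property is chosen below, it is the first (resp. second) such index in this enumeration. Write $\Lambda(P_1,P_2)=\frac{I+P_1}2+\frac{I-P_1}2P_2$. For a Pauli $i^lX^xZ^z$ let $\mathcal C$ be the following circuit of controlled Paulis (first factor applied first): empty if $x=z=0$; $\Lambda(X_j,Z^{z+e_j})$ with $z_j=1$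 if $x=0\ne z$; $\Lambda(Z_j,X^{x+e_j})$ with $x_j=1$ if $x\neq0=z$; if $x,z\ne0$ and $\langle x,z\rangle=1$: $\Lambda(Z_j,X^{x+e_j}),\Lambda(X_j,Z^{z+e_j})$ with $x_j=z_j=1$; if $x,z\neq 0$, $\langle x,z\rangle=0$ and the supports of $x,z$ meet: $\Lambda(Z_j,X^{x+e_j}),\Lambda(X_k,Z^{z+e_k})$ with $j\ne k$ in both supports; if the supports are disjoint: $\Lambda(Z_j,X^{x+e_j+e_k}),\Lambda(X_k,Z^{z+e_k})$ with $x_j=1$, $z_k=1$. \textbf{Algorithm.} Input: a phased Bruhat decomposition $(m,U_{ph},J,P,V_{ph})$ of $C$ and a Hermitian Pauli $Q$. (1) If $Q=\pm Z^z$: replace $m\leftarrow m\pm1$ and $U_{ph}\leftarrow \omega^{\mp1}e^{i\frac\pi4Q}U_{ph}$, and stop. (2) Otherwise let $\tilde Q=U_{ph}^\dagger QU_{ph}=\tilde Q_I\tilde Q_H$ with $\tilde Q_H$ supported in $J$ and $\tilde Q_I$ in its complement, both Hermitian. Let $\mathcal C_I,\mathcal C_H$ be the CSS-orbit circuits of $\tilde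 Q_I,\tilde Q_H$, let $Q'_I,Q'_H$ be the images of $\tilde Q_I,\tilde Q_H$ under them, $Q'=Q'_HQ'_I$, and let $\mathcal C_H^\#$ be $\mathcal C_H$ with controls and targets of all $CX$ exchanged. Replace $U_{ph}\leftarrow U_{ph}\mathcal C_I^{-1}\mathcal C_H^{-1}$, $P\leftarrow(\mathcal C_I\mathcal C_H^\#)P(\mathcal C_I\mathcal C_H^\#)^{-1}$, $V_{ph}\leftarrow\mathcal C_I\mathcal C_H^\#V_{ph}$. (3) Let $U'$ be $\tilde H$ on $J\cap\operatorname{supp}Q'$ and $Q''=U'^\dagger Q'U'$, so that $e^{i\frac\pi4Q'}U'=U'e^{i\frac\pi4Q''}$. Look up the decomposition $U'e^{i\frac\pi4Q''}=\omega^{m'}U'_{ph}U'_HP'V'_{ph}$ in the table below, where the qubits of $\operatorname{supp}Q''$ outside $J$ are labelled $0,1$ and those in $J$ are labelled $2,3$, in the order of the enumeration. Replace $m\leftarrow m+m'$, $U_{ph}\leftarrow U_{ph}U'_{ph}$, $U_H\leftarrow$ ($U_H$ with its factor $U'$ replaced by $U'_H$), $P\leftarrow P'\,(V'_{ph}PV_{ph}'^{\dagger})$,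 $V_{ph}\leftarrow V'_{ph}V_{ph}$. \textbf{Table.} Each row lists $Q''$, $m'$, $U'_{ph}$, the set of qubits carrying $\tilde H$ in $U'_H$, $P'$, $V'_{ph}$; circuits list the gate applied first at the left, and $-$ is the empty circuit. $$\begin{array}{llllll} Q''&m'&U'_{ph}&U'_H&P'&V'_{ph}\\ X_2 & 1 & S_2 & \{2\} & X_2 & - \\ Y_2 & 1 & - & \{\} & X_2 & - \\ Z_2 & 1 & - & \{2\} & Z_2 & S_2 \\ Y_2 Y_3 & 7 & S_2\,CX_{32}\,CX_{23}\,CX_{32}\,CX_{23} & \{2,3\} & I & CX_{23}\,S_3 \\ X_0 & 7 & S_0 & \{0\} & I & S_0 \\ X_0 X_2 & 7 & S_0\,CX_{20}\,S_2 & \{0,2\} & X_2 & S_0 \\ X_0 Y_2 & 7 & CZ_{20}\,CX_{20}\,CX_{02}\,CX_{20}\,CX_{20} & \{0,2\} & Z_0 X_2 & CZ_{20} \\ X_0 Z_2 & 7 & S_0 & \{0,2\} & Z_2 & CX_{20}\,S_2\,S_0 \\ X_0 Y_2 Y_3 & 5 & CZ_{30}\,CX_{23}\,S_0 & \{0,2,3\}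 & Y_0 & CX_{32}\,CX_{03}\,CX_{20}\,S_2\,S_0 \\ Y_0 & 7 & - & \{0\} & X_0 & - \\ Y_0 X_2 & 7 & CZ_{20}\,CX_{20} & \{0,2\} & X_0 & - \\ Y_0 Y_2 & 5 & CZ_{20}\,CX_{20}\,CX_{02}\,CX_{20}\,S_0 & \{0,2\} & Y_2 & CX_{20}\,S_2\,S_0 \\ Y_0 Z_2 & 7 & CX_{02} & \{0,2\} & X_0 & CZ_{20} \\ Y_0 Y_2 Y_3 & 7 & CZ_{30}\,CX_{23} & \{0,2,3\} & Z_0 Z_2 & CX_{32}\,CX_{03}\,CZ_{20}\,CX_{20} \\ Z_0 & 1 & - & \{\} & Z_0 & S_0 \\ Z_0 X_2 & 1 & CZ_{20}\,S_2\,S_0 & \{2\} & Z_0 X_2 & - \\ Z_0 Y_2 & 1 & - & \{\} & X_2 & CZ_{20}\,CX_{02} \\ Z_0 Z_2 & 1 & CX_{02}\,S_0 & \{2\} & Z_0 Z_2 & S_2 \\ Z_0 Y_2 Y_3 & 7 & CX_{02}\,S_2\,CX_{32}\,CX_{23}\,CX_{32}\,CX_{23}\,CX_{02} & \{2,3\}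 & I & CX_{23}\,S_3 \\ Y_0 Y_1 & 5 & CX_{10}\,S_0 & \{1\} & Z_0 Y_1 & S_0\,CX_{10} \\ Y_0 Y_1 X_2 & 5 & CZ_{21}\,CX_{21}\,CX_{10}\,S_0 & \{1,2\} & Z_0 Y_1 & S_0\,CX_{10} \\ Y_0 Y_1 Y_2 & 7 & CZ_{21}\,CX_{21}\,CX_{10}\,CX_{02} & \{1,2\} & X_1 & CZ_{20}\,CX_{10} \\ Y_0 Y_1 Z_2 & 5 & CX_{10}\,CX_{02}\,S_0 & \{1,2\} & Z_0 Y_1 & S_0\,CZ_{20}\,CX_{10} \\ Y_0 Y_1 Y_2 Y_3 & 7 & CX_{10}\,CX_{03}\,CZ_{20}\,CX_{32}\,S_0 & \{1,2,3\} & Z_0 & CX_{23}\,CX_{02}\,S_0\,CZ_{30}\,CX_{10} \\ -X_2 & 7 & S_2 & \{2\} & I & - \\ -Y_2 & 1 & - & \{\} & Z_2 & - \\ -Z_2 & 7 & - & \{2\} & I & S_2 \\ -Y_2 Y_3 & 1 & S_2\,CX_{32}\,CX_{23}\,CX_{32}\,CX_{23} & \{2,3\} & X_2 Z_3 & CX_{23}\,S_3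 \\ -X_0 & 5 & S_0 & \{0\} & Y_0 & S_0 \\ -X_0 X_2 & 5 & S_0\,CX_{20}\,S_2 & \{0,2\} & Y_0 & S_0 \\ -X_0 Y_2 & 7 & CZ_{20}\,CX_{20}\,CX_{02}\,CX_{20}\,CX_{20} & \{0,2\} & X_0 & CZ_{20} \\ -X_0 Z_2 & 5 & S_0 & \{0,2\} & Y_0 & CX_{20}\,S_2\,S_0 \\ -X_0 Y_2 Y_3 & 7 & CZ_{30}\,CX_{23}\,S_0 & \{0,2,3\} & Z_2 & CX_{32}\,CX_{03}\,CX_{20}\,S_2\,S_0 \\ -Y_0 & 7 & - & \{0\} & Z_0 & - \\ -Y_0 X_2 & 7 & CZ_{20}\,CX_{20} & \{0,2\} & Z_0 X_2 & - \\ -Y_0 Y_2 & 7 & CZ_{20}\,CX_{20}\,CX_{02}\,CX_{20}\,S_0 & \{0,2\} & Z_0 & CX_{20}\,S_2\,S_0 \\ -Y_0 Z_2 & 7 & CX_{02} & \{0,2\} & Z_0 & CZ_{20} \\ -Y_0 Y_2 Y_3 & 7 & CZ_{30}\,CX_{23} & \{0,2,3\} & X_0 & CX_{32}\,CX_{03}\,CZ_{20}\,CX_{20}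 \\ -Z_0 & 7 & - & \{\} & I & S_0 \\ -Z_0 X_2 & 7 & CZ_{20}\,S_2\,S_0 & \{2\} & I & - \\ -Z_0 Y_2 & 1 & - & \{\} & Z_0 Z_2 & CZ_{20}\,CX_{02} \\ -Z_0 Z_2 & 7 & CX_{02}\,S_0 & \{2\} & I & S_2 \\ -Z_0 Y_2 Y_3 & 1 & CX_{02}\,S_2\,CX_{32}\,CX_{23}\,CX_{32}\,CX_{23}\,CX_{02} & \{2,3\} & Z_0 X_2 Z_3 & CX_{23}\,S_3 \\ -Y_0 Y_1 & 7 & CX_{10}\,S_0 & \{1\} & Z_0 & S_0\,CX_{10} \\ -Y_0 Y_1 X_2 & 7 & CZ_{21}\,CX_{21}\,CX_{10}\,S_0 & \{1,2\} & Z_0 X_2 & S_0\,CX_{10} \\ -Y_0 Y_1 Y_2 & 7 & CZ_{21}\,CX_{21}\,CX_{10}\,CX_{02} & \{1,2\} & Z_1 X_2 & CZ_{20}\,CX_{10} \\ -Y_0 Y_1 Z_2 & 7 & CX_{10}\,CX_{02}\,S_0 & \{1,2\} & Z_0 & S_0\,CZ_{20}\,CX_{10} \\ -Y_0 Y_1 Y_2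 Y_3 & 5 & CX_{10}\,CX_{03}\,CZ_{20}\,CX_{32}\,S_0 & \{1,2,3\} & Z_0 Y_1 & CX_{23}\,CX_{02}\,S_0\,CZ_{30}\,CX_{10} \\ \end{array}$$ \textbf{Theorem.} (a) For every row of the table, with $U'$ the product of $\tilde H$ over those of the qubits $2,3$ that lie in $\operatorname{supp}Q''$, the four-qubit identity $U'e^{i\frac\pi4Q''}=\omega^{m'}U'_{ph}U'_HP'V'_{ph}$ holds exactly. (b) For every $n\ge0$, every phased Bruhat decomposition of a unitary $C$ on $n$ qubits, every Hermitian Pauli $Q$, and every enumeration of the qubits (so for all choices of indices): if $Q\ne\pm Z^z$, then $Q'_I$, $Q'_H$ lie in $\{\pm I,\pm X_j,\pm Y_j,\pm Z_j,\pm Y_jY_k\}$ and are supported outside $J$ and in $J$ respectively, so $Q'$ has weight at most four, and the table contains the row needed in (3). In all cases the output is a phased Bruhat decomposition of $e^{i\frac\pi4Q}C$, with the exact global phase. -/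

import Mathlib

namespace PhasedClifford

/-! ### Pauli operators -/

/-- Data of the `n`-qubit Pauli unitary `i ^ s * X ^ x * Z ^ z`. -/
@[ext]
structure Pauli (n : ℕ) where
  s : ZMod 4
  x : Fin n → ZMod 2
  z : Fin n → ZMod 2
deriving DecidableEq

/-- Operators on `n` qubits; the computational basis is indexed by bit vectors. -/
abbrev Op (n : ℕ) := Matrix (Fin n → ZMod 2) (Fin n → ZMod 2) ℂ

/-- The phase `e ^ (i π / 4)`. -/
noncomputable def omega : ℂ := Complex.exp (Real.pi / 4 * Complex.I)

namespace Pauli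

variable {n : ℕ}

/-- The operator `|r⟩ ↦ i ^ s * (-1) ^ ⟨z, r⟩ |r + x⟩`. -/
noncomputable def toMatrix (P : Pauli n) : Op n := fun a r =>
  if a = r + P.x then Complex.I ^ P.s.val * ∏ j, (-1 : ℂ) ^ ((P.z j).val * (r j).val) else 0

/-- The identity operator. -/
instance : One (Pauli n) := ⟨⟨0, 0, 0⟩⟩

/-- Operator product: moving `Z ^ z` past `X ^ x'` costs the sign `(-1) ^ ⟨z, x'⟩`. -/
instance : Mul (Pauli n) :=
  ⟨fun P Q => ⟨P.s + Q.s + 2 * ∑ j, ((P.z j).val * (Q.x j).val : ℕ), P.x + Q.x, P.z + Q.z⟩⟩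

/-- Multiplication by `-1`. -/
instance : Neg (Pauli n) := ⟨fun P => ⟨P.s + 2, P.x, P.z⟩⟩

/-- Pauli `X` on qubit `j`. -/
def X (j : Fin n) : Pauli n := ⟨0, Pi.single j 1, 0⟩

/-- Pauli `Z` on qubit `j`. -/
def Z (j : Fin n) : Pauli n := ⟨0, 0, Pi.single j 1⟩

/-- Pauli `Y = i X Z` on qubit `j`. -/
def Y (j : Fin n) : Pauli n := ⟨1, Pi.single j 1, Pi.single j 1⟩

/-- The qubits on which the operator acts nontrivially. -/
def support (P : Pauli n) : Finset (Fin n) :=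
  Finset.univ.filter fun j => P.x j ≠ 0 ∨ P.z j ≠ 0

/-- `0` if the two operators commute, `1` if they anticommute. -/
def comm (P Q : Pauli n) : ZMod 2 := ∑ j, (P.x j * Q.z j + P.z j * Q.x j)

/-- The tensor factor of `P` on the qubits in `J`, with phase fixed so that it is a tensor product
of `I`, `X`, `Y`, `Z` with sign `+`. -/
def part (J : Finset (Fin n)) (P : Pauli n) : Pauli n where
  s := ∑ j ∈ J, ((P.x j).val * (P.z j).val : ℕ)
  x := fun j => if j ∈ J then P.x j else 0
  z := fun j => if j ∈ J then P.z j else 0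

/-- The complementary factor: `P = P.rest J * P.part J`; it carries the sign of `P`. -/
def rest (J : Finset (Fin n)) (P : Pauli n) : Pauli n where
  s := P.s - (P.part J).s
  x := fun j => if j ∈ J then 0 else P.x j
  z := fun j => if j ∈ J then 0 else P.z j

/-- Conjugation by Hadamard gates on the qubits in `J`: exchanges `X` and `Z`, negates `Y`. -/
def hadamardConj (J : Finset (Fin n)) (P : Pauli n) : Pauli n where
  s := P.s + 2 * ∑ j ∈ J, ((P.x j).val * (P.z j).val : ℕ)
  x := fun j => if j ∈ J then P.z j else P.x j
  z := fun j => if j ∈ J then P.x j else P.z j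

/-- The orbit representatives `±I, ±X_j, ±Y_j, ±Z_j, ±Y_j Y_k` (`j ≠ k`). -/
def IsOrbitRep (P : Pauli n) : Prop :=
  ∃ R : Pauli n, (P = R ∨ P = -R) ∧
    (R = 1 ∨ (∃ j, R = X j ∨ R = Y j ∨ R = Z j) ∨ ∃ j k, j ≠ k ∧ R = Y j * Y k)

end Pauli

/-- The Pauli exponent `e ^ (i π / 4 * Q)`. -/
noncomputable def pauliExp {n : ℕ} (Q : Pauli n) : Op n :=
  NormedSpace.exp ((Real.pi / 4 * Complex.I : ℂ) • Q.toMatrix)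

/-! ### Phase-CSS gates and circuits -/

/-- Phase gate on `j`; controlled-`Z` on `j, k`; controlled-`X` with control `c` and target `t`. -/
inductive Gate (n : ℕ) where
  | s (j : Fin n)
  | cz (j k : Fin n)
  | cx (c t : Fin n)

namespace Gate

variable {n : ℕ}

/-- Two-qubit gates act on two different qubits. -/
def WellFormed : Gate n → Prop
  | s _ => True
  | cz j k => j ≠ k
  | cx c t => c ≠ t

/-- `S_j |r⟩ = i ^ r_j |r⟩`, `CZ_jk |r⟩ = (-1) ^ (r_j r_k) |r⟩`, `CX_ct |r⟩ = |r + r_c e_t⟩`. -/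
noncomputable def toMatrix : Gate n → Op n
  | s j => Matrix.diagonal fun r => Complex.I ^ (r j).val
  | cz j k => Matrix.diagonal fun r => (-1 : ℂ) ^ ((r j).val * (r k).val)
  | cx c t => fun a r => if a = Function.update r t (r t + r c) then 1 else 0

/-- `g.conj P = g P g†`. -/
def conj : Gate n → Pauli n → Pauli n
  | s j, P => ⟨P.s + ((P.x j).val : ℕ), P.x, Function.update P.z j (P.z j + P.x j)⟩
  | cz j k, P => ⟨P.s + 2 * ((P.x j).val * (P.x k).val : ℕ), P.x,
      P.z + Pi.single j (P.x k) + Pi.single k (P.x j)⟩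
  | cx c t, P => ⟨P.s, Function.update P.x t (P.x t + P.x c),
      Function.update P.z c (P.z c + P.z t)⟩

/-- Rename qubits. -/
def relabel {k : ℕ} (f : Fin k → Fin n) : Gate k → Gate n
  | s j => s (f j)
  | cz i j => cz (f i) (f j)
  | cx c t => cx (f c) (f t)

end Gate

/-- Phase-CSS unitaries: products of `S`, controlled-`Z` and controlled-`X`. All of them fix the
state `|0…0⟩`, so there is no freedom of a global phase. -/
def phaseCSS (n : ℕ) : Submonoid (Op n) :=
  Submonoid.closure {M | ∃ g : Gate n, g.WellFormed ∧ g.toMatrix = M}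

/-- A sequence of gates; the first gate of the list is applied first. -/
abbrev Circuit (n : ℕ) := List (Gate n)

namespace Circuit

variable {n : ℕ}

noncomputable def toMatrix : Circuit n → Op n
  | [] => 1
  | g :: w => toMatrix w * g.toMatrix

/-- `conj w P = w P w†`. -/
def conj (w : Circuit n) (P : Pauli n) : Pauli n := w.foldl (fun R g => g.conj R) P

def relabel {k : ℕ} (f : Fin k → Fin n) (w : Circuit k) : Circuit n := w.map (Gate.relabel f)

end Circuit

/-- A circuit of controlled-`X` gates: a list of pairs (control, target). -/
abbrev CSSCircuit (n : ℕ) := List (Fin n × Fin n)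

namespace CSSCircuit

variable {n : ℕ}

def toCircuit (w : CSSCircuit n) : Circuit n := w.map fun p => Gate.cx p.1 p.2

/-- The inverse circuit. -/
def inv (w : CSSCircuit n) : CSSCircuit n := w.reverse

/-- The Hadamard-conjugated circuit: controls and targets are exchanged. -/
def dual (w : CSSCircuit n) : CSSCircuit n := w.map Prod.swap

/-- The controlled Pauli `Λ(X_j, Z^w)` for `w j = 0`. -/
def ctrlXZ (j : Fin n) (w : Fin n → ZMod 2) : CSSCircuit n :=
  ((List.finRange n).filter fun k => w k = 1).map fun k => (k, j)

/-- The controlled Pauli `Λ(Z_j, X^w)` for `w j = 0`. -/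
def ctrlZX (j : Fin n) (w : Fin n → ZMod 2) : CSSCircuit n :=
  ((List.finRange n).filter fun k => w k = 1).map fun k => (j, k)

end CSSCircuit

open CSSCircuit in
/-- A CSS circuit (a sequence of at most two controlled Paulis `Λ(X^a, Z^b)`) mapping `P` to one of
`±I, ±X_j, ±Y_j, ±Z_j, ±Y_j Y_k`. The list `qs` enumerates the qubits; whenever an index with some
property has to be chosen, it is the first such index in `qs`. -/
def cssOrbit {n : ℕ} (qs : List (Fin n)) (P : Pauli n) : CSSCircuit n :=
  let e : Fin n → Fin n → ZMod 2 := fun j => Pi.single j 1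
  let xs := qs.filter fun j => P.x j = 1
  let zs := qs.filter fun j => P.z j = 1
  let both := qs.filter fun j => P.x j = 1 ∧ P.z j = 1
  match xs, zs with
  | [], [] => []
  | [], j :: _ => ctrlXZ j (P.z + e j)
  | j :: _, [] => ctrlZX j (P.x + e j)
  | a :: _, b :: _ =>
    match both with
    | [] => ctrlZX a (P.x + e a + e b) ++ ctrlXZ b (P.z + e b)
    | j :: l =>
      if ∑ i, P.z i * P.x i = 1 then ctrlZX j (P.x + e j) ++ ctrlXZ j (P.z + e j)
      else match l with
        | [] => []
        | k :: _ => ctrlZX j (P.x + e j) ++ ctrlXZ k (P.z + e k)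

/-! ### Binary-symplectic representation of Clifford unitaries -/

/-- The images `U X_j U†` and `U Z_j U†` of the Pauli generators under a Clifford unitary `U`. -/
structure Tableau (n : ℕ) where
  imX : Fin n → Pauli n
  imZ : Fin n → Pauli n

namespace Tableau

variable {n : ℕ}

/-- `T` is the tableau of `U`. -/
def Represents (T : Tableau n) (U : Op n) : Prop :=
  ∀ j, U * (Pauli.X j).toMatrix * U.conjTranspose = (T.imX j).toMatrix ∧
    U * (Pauli.Z j).toMatrix * U.conjTranspose = (T.imZ j).toMatrix

/-- The image `U P U†`. -/
def image (T : Tableau n) (P : Pauli n) : Pauli n :=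
  ⟨P.s, 0, 0⟩ * ((List.finRange n).map fun j => if P.x j = 1 then T.imX j else 1).prod *
    ((List.finRange n).map fun j => if P.z j = 1 then T.imZ j else 1).prod

/-- The preimage `U† Q U`: its bits are read off from commutators, then its phase is matched. -/
def preimage (T : Tableau n) (Q : Pauli n) : Pauli n :=
  let x : Fin n → ZMod 2 := fun j => Pauli.comm Q (T.imZ j)
  let z : Fin n → ZMod 2 := fun j => Pauli.comm Q (T.imX j)
  ⟨Q.s - (T.image ⟨0, x, z⟩).s, x, z⟩

/-- The tableau of `w * U`. -/
def leftMul (w : Circuit n) (T : Tableau n) : Tableau n :=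
  ⟨fun j => w.conj (T.imX j), fun j => w.conj (T.imZ j)⟩

/-- The tableau of `U * w`. -/
def rightMul (T : Tableau n) (w : Circuit n) : Tableau n :=
  ⟨fun j => T.image (w.conj (Pauli.X j)), fun j => T.image (w.conj (Pauli.Z j))⟩

end Tableau

/-! ### Phased Bruhat decompositions -/

/-- The tensor product of phase-adjusted Hadamard gates `e ^ (i π / 4) H` on the qubits in `J` and
identity gates on the other qubits. -/
noncomputable def hadamardLayer {n : ℕ} (J : Finset (Fin n)) : Op n := fun a r =>
  ∏ j, if j ∈ J then omega * ((√2 : ℝ) : ℂ)⁻¹ * (-1 : ℂ) ^ ((a j).val * (r j).val)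
    else if a j = r j then 1 else 0

/-- Data of a phased Bruhat decomposition `ω ^ m * U_ph * U_H * P * V_ph`: the exponent `m`, the
tableaux of the phase-CSS unitaries, the positions of the Hadamard gates, the Pauli operator. -/
structure Bruhat (n : ℕ) where
  m : ZMod 8
  U : Tableau n
  H : Finset (Fin n)
  P : Pauli n
  V : Tableau n

/-- `D` is a phased Bruhat decomposition of the unitary `C`. -/
def Bruhat.Represents {n : ℕ} (D : Bruhat n) (C : Op n) : Prop :=
  ∃ U ∈ phaseCSS n, ∃ V ∈ phaseCSS n, D.U.Represents U ∧ D.V.Represents V ∧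
    C = omega ^ D.m.val • (U * hadamardLayer D.H * D.P.toMatrix * V)

/-! ### The table of decompositions on at most four qubits -/

/-- The entry `(Q, m, U, H, P, V)` records a decomposition
`U' * e ^ (i π / 4 * Q) = ω ^ m * U * U_H * P * V`, where `U'` consists of the phase-adjusted
Hadamard gates on those of the qubits `2, 3` that are in the support of `Q`. -/
structure TableEntry where
  Q : Pauli 4
  m : ZMod 8
  U : Circuit 4
  H : Finset (Fin 4)
  P : Pauli 4
  V : Circuit 4

/-- The entry is a correct phased Bruhat decomposition on four qubits. -/
def TableEntry.Correct (e : TableEntry) : Prop :=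
  (∀ g ∈ e.U, g.WellFormed) ∧ (∀ g ∈ e.V, g.WellFormed) ∧
    hadamardLayer (e.Q.support ∩ {2, 3}) * pauliExp e.Q =
      omega ^ e.m.val • (e.U.toMatrix * hadamardLayer e.H * e.P.toMatrix * e.V.toMatrix)

/-- The Pauli operators with one of `I, X, Y, Z, YY` on qubits `0, 1` and one of `I, X, Y, Z, YY`
on qubits `2, 3`, not both `I`, with both signs. -/
def bruhatTable : List TableEntry :=
  [⟨Pauli.X 2, 1, [.s 2], {2}, Pauli.X 2, []⟩,
   ⟨Pauli.Y 2, 1, [], {}, Pauli.X 2, []⟩,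
   ⟨Pauli.Z 2, 1, [], {2}, Pauli.Z 2, [.s 2]⟩,
   ⟨Pauli.Y 2 * Pauli.Y 3, 7, [.s 2, .cx 3 2, .cx 2 3, .cx 3 2, .cx 2 3], {2, 3}, 1, [.cx 2 3, .s 3]⟩,
   ⟨Pauli.X 0, 7, [.s 0], {0}, 1, [.s 0]⟩,
   ⟨Pauli.X 0 * Pauli.X 2, 7, [.s 0, .cx 2 0, .s 2], {0, 2}, Pauli.X 2, [.s 0]⟩,
   ⟨Pauli.X 0 * Pauli.Y 2, 7, [.cz 2 0, .cx 2 0, .cx 0 2, .cx 2 0, .cx 2 0], {0, 2}, Pauli.Z 0 * Pauli.X 2, [.cz 2 0]⟩,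
   ⟨Pauli.X 0 * Pauli.Z 2, 7, [.s 0], {0, 2}, Pauli.Z 2, [.cx 2 0, .s 2, .s 0]⟩,
   ⟨Pauli.X 0 * Pauli.Y 2 * Pauli.Y 3, 5, [.cz 3 0, .cx 2 3, .s 0], {0, 2, 3}, Pauli.Y 0, [.cx 3 2, .cx 0 3, .cx 2 0, .s 2, .s 0]⟩,
   ⟨Pauli.Y 0, 7, [], {0}, Pauli.X 0, []⟩,
   ⟨Pauli.Y 0 * Pauli.X 2, 7, [.cz 2 0, .cx 2 0], {0, 2}, Pauli.X 0, []⟩,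
   ⟨Pauli.Y 0 * Pauli.Y 2, 5, [.cz 2 0, .cx 2 0, .cx 0 2, .cx 2 0, .s 0], {0, 2}, Pauli.Y 2, [.cx 2 0, .s 2, .s 0]⟩,
   ⟨Pauli.Y 0 * Pauli.Z 2, 7, [.cx 0 2], {0, 2}, Pauli.X 0, [.cz 2 0]⟩,
   ⟨Pauli.Y 0 * Pauli.Y 2 * Pauli.Y 3, 7, [.cz 3 0, .cx 2 3], {0, 2, 3}, Pauli.Z 0 * Pauli.Z 2, [.cx 3 2, .cx 0 3, .cz 2 0, .cx 2 0]⟩,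
   ⟨Pauli.Z 0, 1, [], {}, Pauli.Z 0, [.s 0]⟩,
   ⟨Pauli.Z 0 * Pauli.X 2, 1, [.cz 2 0, .s 2, .s 0], {2}, Pauli.Z 0 * Pauli.X 2, []⟩,
   ⟨Pauli.Z 0 * Pauli.Y 2, 1, [], {}, Pauli.X 2, [.cz 2 0, .cx 0 2]⟩,
   ⟨Pauli.Z 0 * Pauli.Z 2, 1, [.cx 0 2, .s 0], {2}, Pauli.Z 0 * Pauli.Z 2, [.s 2]⟩,
   ⟨Pauli.Z 0 * Pauli.Y 2 * Pauli.Y 3, 7, [.cx 0 2, .s 2, .cx 3 2, .cx 2 3, .cx 3 2, .cx 2 3, .cx 0 2], {2, 3}, 1, [.cx 2 3, .s 3]⟩,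
   ⟨Pauli.Y 0 * Pauli.Y 1, 5, [.cx 1 0, .s 0], {1}, Pauli.Z 0 * Pauli.Y 1, [.s 0, .cx 1 0]⟩,
   ⟨Pauli.Y 0 * Pauli.Y 1 * Pauli.X 2, 5, [.cz 2 1, .cx 2 1, .cx 1 0, .s 0], {1, 2}, Pauli.Z 0 * Pauli.Y 1, [.s 0, .cx 1 0]⟩,
   ⟨Pauli.Y 0 * Pauli.Y 1 * Pauli.Y 2, 7, [.cz 2 1, .cx 2 1, .cx 1 0, .cx 0 2], {1, 2}, Pauli.X 1, [.cz 2 0, .cx 1 0]⟩,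
   ⟨Pauli.Y 0 * Pauli.Y 1 * Pauli.Z 2, 5, [.cx 1 0, .cx 0 2, .s 0], {1, 2}, Pauli.Z 0 * Pauli.Y 1, [.s 0, .cz 2 0, .cx 1 0]⟩,
   ⟨Pauli.Y 0 * Pauli.Y 1 * Pauli.Y 2 * Pauli.Y 3, 7, [.cx 1 0, .cx 0 3, .cz 2 0, .cx 3 2, .s 0], {1, 2, 3}, Pauli.Z 0, [.cx 2 3, .cx 0 2, .s 0, .cz 3 0, .cx 1 0]⟩,
   ⟨-(Pauli.X 2), 7, [.s 2], {2}, 1, []⟩,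
   ⟨-(Pauli.Y 2), 1, [], {}, Pauli.Z 2, []⟩,
   ⟨-(Pauli.Z 2), 7, [], {2}, 1, [.s 2]⟩,
   ⟨-(Pauli.Y 2 * Pauli.Y 3), 1, [.s 2, .cx 3 2, .cx 2 3, .cx 3 2, .cx 2 3], {2, 3}, Pauli.X 2 * Pauli.Z 3, [.cx 2 3, .s 3]⟩,
   ⟨-(Pauli.X 0), 5, [.s 0], {0}, Pauli.Y 0, [.s 0]⟩,
   ⟨-(Pauli.X 0 * Pauli.X 2), 5, [.s 0, .cx 2 0, .s 2], {0, 2}, Pauli.Y 0, [.s 0]⟩,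
   ⟨-(Pauli.X 0 * Pauli.Y 2), 7, [.cz 2 0, .cx 2 0, .cx 0 2, .cx 2 0, .cx 2 0], {0, 2}, Pauli.X 0, [.cz 2 0]⟩,
   ⟨-(Pauli.X 0 * Pauli.Z 2), 5, [.s 0], {0, 2}, Pauli.Y 0, [.cx 2 0, .s 2, .s 0]⟩,
   ⟨-(Pauli.X 0 * Pauli.Y 2 * Pauli.Y 3), 7, [.cz 3 0, .cx 2 3, .s 0], {0, 2, 3}, Pauli.Z 2, [.cx 3 2, .cx 0 3, .cx 2 0, .s 2, .s 0]⟩,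
   ⟨-(Pauli.Y 0), 7, [], {0}, Pauli.Z 0, []⟩,
   ⟨-(Pauli.Y 0 * Pauli.X 2), 7, [.cz 2 0, .cx 2 0], {0, 2}, Pauli.Z 0 * Pauli.X 2, []⟩,
   ⟨-(Pauli.Y 0 * Pauli.Y 2), 7, [.cz 2 0, .cx 2 0, .cx 0 2, .cx 2 0, .s 0], {0, 2}, Pauli.Z 0, [.cx 2 0, .s 2, .s 0]⟩,
   ⟨-(Pauli.Y 0 * Pauli.Z 2), 7, [.cx 0 2], {0, 2}, Pauli.Z 0, [.cz 2 0]⟩,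
   ⟨-(Pauli.Y 0 * Pauli.Y 2 * Pauli.Y 3), 7, [.cz 3 0, .cx 2 3], {0, 2, 3}, Pauli.X 0, [.cx 3 2, .cx 0 3, .cz 2 0, .cx 2 0]⟩,
   ⟨-(Pauli.Z 0), 7, [], {}, 1, [.s 0]⟩,
   ⟨-(Pauli.Z 0 * Pauli.X 2), 7, [.cz 2 0, .s 2, .s 0], {2}, 1, []⟩,
   ⟨-(Pauli.Z 0 * Pauli.Y 2), 1, [], {}, Pauli.Z 0 * Pauli.Z 2, [.cz 2 0, .cx 0 2]⟩,
   ⟨-(Pauli.Z 0 * Pauli.Z 2), 7, [.cx 0 2, .s 0], {2}, 1, [.s 2]⟩,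
   ⟨-(Pauli.Z 0 * Pauli.Y 2 * Pauli.Y 3), 1, [.cx 0 2, .s 2, .cx 3 2, .cx 2 3, .cx 3 2, .cx 2 3, .cx 0 2], {2, 3}, Pauli.Z 0 * Pauli.X 2 * Pauli.Z 3, [.cx 2 3, .s 3]⟩,
   ⟨-(Pauli.Y 0 * Pauli.Y 1), 7, [.cx 1 0, .s 0], {1}, Pauli.Z 0, [.s 0, .cx 1 0]⟩,
   ⟨-(Pauli.Y 0 * Pauli.Y 1 * Pauli.X 2), 7, [.cz 2 1, .cx 2 1, .cx 1 0, .s 0], {1, 2}, Pauli.Z 0 * Pauli.X 2, [.s 0, .cx 1 0]⟩,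
   ⟨-(Pauli.Y 0 * Pauli.Y 1 * Pauli.Y 2), 7, [.cz 2 1, .cx 2 1, .cx 1 0, .cx 0 2], {1, 2}, Pauli.Z 1 * Pauli.X 2, [.cz 2 0, .cx 1 0]⟩,
   ⟨-(Pauli.Y 0 * Pauli.Y 1 * Pauli.Z 2), 7, [.cx 1 0, .cx 0 2, .s 0], {1, 2}, Pauli.Z 0, [.s 0, .cz 2 0, .cx 1 0]⟩,
   ⟨-(Pauli.Y 0 * Pauli.Y 1 * Pauli.Y 2 * Pauli.Y 3), 5, [.cx 1 0, .cx 0 3, .cz 2 0, .cx 3 2, .s 0], {1, 2, 3}, Pauli.Z 0 * Pauli.Y 1, [.cx 2 3, .cx 0 2, .s 0, .cz 3 0, .cx 1 0]⟩]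

/-! ### The algorithm -/

namespace Algorithm

variable {n : ℕ}

/-- `Q̃ = U_ph† Q U_ph`. -/
def pulled (D : Bruhat n) (Q : Pauli n) : Pauli n := D.U.preimage Q

/-- The CSS circuit for the factor of `Q̃` on the qubits without Hadamard gate. -/
def circI (qs : List (Fin n)) (D : Bruhat n) (Q : Pauli n) : CSSCircuit n :=
  cssOrbit qs ((pulled D Q).rest D.H)

/-- The CSS circuit for the factor of `Q̃` on the qubits with Hadamard gate. -/
def circH (qs : List (Fin n)) (D : Bruhat n) (Q : Pauli n) : CSSCircuit n :=
  cssOrbit qs ((pulled D Q).part D.H)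

/-- `Q'_I`, the image of the factor of `Q̃` on the qubits without Hadamard gate. -/
def reducedI (qs : List (Fin n)) (D : Bruhat n) (Q : Pauli n) : Pauli n :=
  (circI qs D Q).toCircuit.conj ((pulled D Q).rest D.H)

/-- `Q'_H`, the image of the factor of `Q̃` on the qubits with Hadamard gate. -/
def reducedH (qs : List (Fin n)) (D : Bruhat n) (Q : Pauli n) : Pauli n :=
  (circH qs D Q).toCircuit.conj ((pulled D Q).part D.H)

/-- `Q' = Q'_H Q'_I`. -/
def reduced (qs : List (Fin n)) (D : Bruhat n) (Q : Pauli n) : Pauli n :=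
  reducedH qs D Q * reducedI qs D Q

/-- `U_H† Q' U_H`, so that `e ^ (i π / 4 * Q') U_H = U_H e ^ (i π / 4 * turned)`. -/
def turned (qs : List (Fin n)) (D : Bruhat n) (Q : Pauli n) : Pauli n :=
  (reduced qs D Q).hadamardConj D.H

/-- Positions of the four qubits of the table: `0, 1` stand for qubits without Hadamard gate and
`2, 3` for qubits with Hadamard gate in the support of `Q'`. -/
def labels (qs : List (Fin n)) (D : Bruhat n) (Q : Pauli n) : Fin 4 → Option (Fin n) :=
  let S := (reduced qs D Q).support
  let a := qs.filter fun j => j ∈ S ∧ j ∉ D.H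
  let b := qs.filter fun j => j ∈ S ∧ j ∈ D.H
  ![a[0]?, a[1]?, b[0]?, b[1]?]

/-- The table entry for `turned`, restricted to its support. -/
def lookup (qs : List (Fin n)) (D : Bruhat n) (Q : Pauli n) : Option TableEntry :=
  let R := turned qs D Q
  let l := labels qs D Q
  let R' : Pauli 4 := ⟨R.s, fun i => (l i).elim 0 R.x, fun i => (l i).elim 0 R.z⟩
  bruhatTable.find? fun e => e.Q = R'

/-- For `Q = ± Z ^ z`, the circuit of the phase-CSS unitary `ω ^ (∓1) * e ^ (i π / 4 * Q)`: the
parity `⟨z, r⟩` is computed into a qubit, then `S†` or `S` is applied to it. -/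
def diagCircuit (qs : List (Fin n)) (Q : Pauli n) : Circuit n :=
  match qs.filter fun j => Q.z j = 1 with
  | [] => []
  | j :: l =>
    let fan : Circuit n := l.map fun k => Gate.cx k j
    fan ++ (if Q.s = 0 then [Gate.s j, Gate.s j, Gate.s j] else [Gate.s j]) ++ fan.reverse

/-- Left multiplication of a phased Bruhat decomposition by `e ^ (i π / 4 * Q)`. The list `qs`
enumerates the qubits and determines all choices of indices. The result is `none` if no table entry
is found. -/
def leftMul (qs : List (Fin n)) (D : Bruhat n) (Q : Pauli n) : Option (Bruhat n) :=
  if Q.x = 0 then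
    some { D with
      m := D.m + (if Q.s = 0 then 1 else -1)
      U := D.U.leftMul (diagCircuit qs Q) }
  else
    match qs, lookup qs D Q with
    | q :: _, some e =>
      let l := labels qs D Q
      let f : Fin 4 → Fin n := fun i => (l i).getD q
      let C := circI qs D Q ++ circH qs D Q
      let Cd := (circI qs D Q ++ (circH qs D Q).dual).toCircuit
      let U₁ := D.U.rightMul C.inv.toCircuit
      let P₁ := Cd.conj D.P
      let V₁ := D.V.leftMul Cd
      let P' : Pauli n :=
        ⟨e.P.s, fun j => ∑ i, if l i = some j then e.P.x i else 0,
          fun j => ∑ i, if l i = some j then e.P.z i else 0⟩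
      let w := e.V.relabel f
      some
        { m := D.m + e.m
          U := U₁.rightMul (e.U.relabel f)
          H := (D.H \ (reduced qs D Q).support) ∪ e.H.image f
          P := P' * w.conj P₁
          V := V₁.leftMul w }
    | _, _ => none

end Algorithm

end PhasedClifford

open PhasedClifford

namespace PhasedClifford

/-! Write `C = ω^m U_ph U_H P V_ph` and move `E = e^{iπQ/4}` from left to right. Conjugation by
`U_ph` turns `Q` into a Pauli operator `Q̃`, and a circuit `M` of `CX` gates turns `Q̃` into a short
`Q'`. Hence `E (U_ph M⁻¹) = (U_ph M⁻¹) e^{iπQ'/4}`, with a spare factor `M` in front of `U_H`. Since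
`M` acts separately on `J` and on its complement, it passes through `U_H` as another `CX` circuit:
outside `J` it commutes with the layer, inside `J` controls and targets are exchanged. It remains to
rewrite `e^{iπQ'/4} U_H`, which concerns at most four qubits and is read off from the table.
`Algorithm.conj_exchange` assembles these relations.

Short orbit representatives (`cssOrbit_spec`): a `CX` circuit leaves the exponent `s` alone and
preserves the parity of `⟨x, z⟩`. One controlled Pauli sweeps `x` into one or two qubits, a second
one sweeps `z`; if both `x` and `z` are nonzero, the parity decides between `Y_j` and `Y_j Y_k`.

The table (`TableEntry.correct_of_check`, `bruhatTable_check`): a Hermitian Pauli squares to `1`, so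
`e^{iπQ/4} = (1 + iQ)/√2` by `pauliExp_eq`, and circuits are monomial matrices with phases in the
powers of `i`. Every matrix entry of a row is therefore a relation between three terms, each zero or
a power of `ω` divided by a power of `√2`. With basis states coded as natural numbers, these
relations are evaluated by the kernel. A second finite check, `exists_mem_bruhatTable`, shows that
no needed row is missing.

From four qubits to `n` (`TableEntry.Correct.transport`): a row may use fewer than four qubits, and
`n` itself may be smaller than four. Both the row and the desired identity are therefore embedded in
`n + 4` qubits, unused table qubits going to the extra positions, and compared there; embedding is
injective.

The global phase is exact because no unitary is ever reconstructed from a tableau: the new phase-CSS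
factors are explicit products of the old ones with circuits, the equation is one between matrices,
and the tableaux are shown to follow.

If `Q = ±Z^z`, a fan-in of `CX` gates reduces `Q` to `±Z_j`, where the exponential is `ω^{±1}` times
`S†` or `S` (`Algorithm.diagCircuit_spec`). -/

theorem zmod_two_eq_zero_or_one : ∀ c : ZMod 2, c = 0 ∨ c = 1 := by decide

/-! ### Monomial matrices -/

section Monomial

variable {n : ℕ}

/-- The matrix `|r⟩ ↦ φ r |π r⟩`. -/
def monomial (π : (Fin n → ZMod 2) → Fin n → ZMod 2) (φ : (Fin n → ZMod 2) → ℂ) : Op n :=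
  fun a r => if a = π r then φ r else 0

theorem mul_monomial_apply (M : Op n) (π : (Fin n → ZMod 2) → Fin n → ZMod 2)
    (φ : (Fin n → ZMod 2) → ℂ) (a r : Fin n → ZMod 2) :
    (M * monomial π φ) a r = M a (π r) * φ r := by
  simp [Matrix.mul_apply, monomial]

/-- Addressing the row as `π c` makes the sum collapse without an inverse of `π`; users of this
lemma first write their row index in this form. -/
theorem monomial_mul_apply {π : (Fin n → ZMod 2) → Fin n → ZMod 2} (hπ : Function.Injective π)
    (φ : (Fin n → ZMod 2) → ℂ) (M : Op n) (c r : Fin n → ZMod 2) :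
    (monomial π φ * M) (π c) r = φ c * M c r := by
  simp [Matrix.mul_apply, monomial, hπ.eq_iff]

theorem monomial_mul_monomial (π π' : (Fin n → ZMod 2) → Fin n → ZMod 2)
    (φ φ' : (Fin n → ZMod 2) → ℂ) :
    (monomial π φ * monomial π' φ' : Op n) = monomial (π ∘ π') fun r => φ (π' r) * φ' r := by
  ext a r
  rw [mul_monomial_apply]
  simp [monomial]

theorem monomial_id : (monomial id fun _ => 1 : Op n) = 1 := by
  ext a r
  simp [monomial, Matrix.one_apply]

theorem smul_monomial (c : ℂ) (π : (Fin n → ZMod 2) → Fin n → ZMod 2)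
    (φ : (Fin n → ZMod 2) → ℂ) : (c • monomial π φ : Op n) = monomial π fun r => c * φ r := by
  ext a r
  simp [monomial]

theorem monomial_mem_unitaryGroup {π : (Fin n → ZMod 2) → Fin n → ZMod 2}
    {φ : (Fin n → ZMod 2) → ℂ} (hπ : Function.Injective π) (hφ : ∀ r, star (φ r) * φ r = 1) :
    monomial π φ ∈ Matrix.unitaryGroup (Fin n → ZMod 2) ℂ := by
  rw [Matrix.mem_unitaryGroup_iff']
  ext a r
  rw [mul_monomial_apply, Matrix.star_apply, Matrix.one_apply]
  rcases eq_or_ne a r with rfl | h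
  · simpa [monomial] using hφ a
  · have : π r ≠ π a := fun e => h (hπ e).symm
    simp [monomial, this, h]

end Monomial

/-! ### Signs and phases -/

theorem I_pow_val_natCast (k : ℕ) : Complex.I ^ (k : ZMod 4).val = Complex.I ^ k := by
  rw [ZMod.val_natCast, ← Complex.I_pow_eq_pow_mod]

theorem I_pow_val_add (a b : ZMod 4) :
    Complex.I ^ (a + b).val = Complex.I ^ a.val * Complex.I ^ b.val := by
  rw [← pow_add, ← I_pow_val_natCast (a.val + b.val)]
  simp

theorem I_pow_val_two_mul (k : ℕ) : Complex.I ^ (2 * (k : ZMod 4)).val = (-1 : ℂ) ^ k := by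
  have := I_pow_val_natCast (2 * k)
  rw [pow_mul, Complex.I_sq] at this
  simpa using this

/-- `val` is additive only modulo 2, which is all that a sign sees. -/
theorem neg_one_pow_mul_val_add (m : ℕ) (b c : ZMod 2) :
    (-1 : ℂ) ^ (m * (b + c).val) = (-1) ^ (m * b.val) * (-1) ^ (m * c.val) := by
  rw [← pow_add, ← mul_add, mul_comm, mul_comm m, pow_mul, pow_mul]
  congr 1
  revert b c
  have h : ∀ b c : ZMod 2, (b + c).val % 2 = (b.val + c.val) % 2 := by decide
  intro b c
  rw [neg_one_pow_eq_pow_mod_two, h, ← neg_one_pow_eq_pow_mod_two]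

theorem neg_one_pow_val_add_mul (m : ℕ) (b c : ZMod 2) :
    (-1 : ℂ) ^ ((b + c).val * m) = (-1) ^ (b.val * m) * (-1) ^ (c.val * m) := by
  simpa only [mul_comm m] using neg_one_pow_mul_val_add m b c

/-- The sign `(-1) ^ ⟨z, r⟩`. -/
noncomputable def sgn {n : ℕ} (z r : Fin n → ZMod 2) : ℂ := ∏ j, (-1 : ℂ) ^ ((z j).val * (r j).val)

section Sgn

variable {n : ℕ}

theorem sgn_add_left (z z' r : Fin n → ZMod 2) : sgn (z + z') r = sgn z r * sgn z' r := by
  simp only [sgn, Pi.add_apply, neg_one_pow_val_add_mul, Finset.prod_mul_distrib]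

theorem sgn_add_right (z r r' : Fin n → ZMod 2) : sgn z (r + r') = sgn z r * sgn z r' := by
  simp only [sgn, Pi.add_apply, neg_one_pow_mul_val_add, Finset.prod_mul_distrib]

theorem sgn_comm (z r : Fin n → ZMod 2) : sgn z r = sgn r z := by
  simp only [sgn, mul_comm]

@[simp]
theorem sgn_zero_left (r : Fin n → ZMod 2) : sgn 0 r = 1 := by simp [sgn]

@[simp]
theorem sgn_zero_right (r : Fin n → ZMod 2) : sgn r 0 = 1 := by simp [sgn]

theorem sgn_single_left (j : Fin n) (a : ZMod 2) (r : Fin n → ZMod 2) :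
    sgn (Pi.single j a) r = (-1) ^ (a.val * (r j).val) := by
  rw [sgn, Finset.prod_eq_single j]
  · simp
  · intro i _ h
    simp [h]
  · simp

theorem sgn_single_right (j : Fin n) (a : ZMod 2) (r : Fin n → ZMod 2) :
    sgn r (Pi.single j a) = (-1) ^ ((r j).val * a.val) := by
  rw [sgn_comm, sgn_single_left, mul_comm]

theorem sgn_eq_pow (z r : Fin n → ZMod 2) : sgn z r = (-1) ^ (∑ j, z j * r j : ZMod 2).val := by
  have h : ∀ s : Finset (Fin n), ∏ j ∈ s, (-1 : ℂ) ^ ((z j).val * (r j).val) =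
      (-1) ^ (∑ j ∈ s, z j * r j : ZMod 2).val := by
    intro s
    induction s using Finset.induction_on with
    | empty => simp
    | insert a s ha ih =>
      rw [Finset.prod_insert ha, Finset.sum_insert ha, ih]
      have := neg_one_pow_mul_val_add 1 (z a * r a) (∑ j ∈ s, z j * r j)
      rw [one_mul, one_mul, one_mul] at this
      rw [this, ZMod.val_mul, ← neg_one_pow_eq_pow_mod_two]
  exact h Finset.univ

theorem sgn_sq (z r : Fin n → ZMod 2) : sgn z r * sgn z r = 1 := by
  rw [sgn_eq_pow, ← mul_pow]
  simp

@[simp]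
theorem star_sgn (z r : Fin n → ZMod 2) : star (sgn z r) = sgn z r := by
  simp [sgn_eq_pow]

end Sgn

/-! ### The Pauli group -/

theorem bits_add_self {n : ℕ} (x : Fin n → ZMod 2) : x + x = 0 :=
  funext fun _ => CharTwo.add_self_eq_zero _

namespace Pauli

variable {n : ℕ}

@[simp] theorem one_s : (1 : Pauli n).s = 0 := rfl
@[simp] theorem one_x : (1 : Pauli n).x = 0 := rfl
@[simp] theorem one_z : (1 : Pauli n).z = 0 := rfl
@[simp] theorem mul_x (P Q : Pauli n) : (P * Q).x = P.x + Q.x := rfl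
@[simp] theorem mul_z (P Q : Pauli n) : (P * Q).z = P.z + Q.z := rfl
theorem mul_s (P Q : Pauli n) :
    (P * Q).s = P.s + Q.s + 2 * ∑ j, ((P.z j).val * (Q.x j).val : ℕ) := rfl
@[simp] theorem neg_s (P : Pauli n) : (-P).s = P.s + 2 := rfl
@[simp] theorem neg_x (P : Pauli n) : (-P).x = P.x := rfl
@[simp] theorem neg_z (P : Pauli n) : (-P).z = P.z := rfl

theorem toMatrix_eq_monomial (P : Pauli n) :
    P.toMatrix = monomial (fun r => r + P.x) fun r => Complex.I ^ P.s.val * sgn P.z r := rfl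

theorem toMatrix_mul (P Q : Pauli n) : (P * Q).toMatrix = P.toMatrix * Q.toMatrix := by
  have h : (P * Q).s = P.s + Q.s + 2 * ((∑ j, (P.z j).val * (Q.x j).val : ℕ) : ZMod 4) := by
    rfl
  simp only [toMatrix_eq_monomial, monomial_mul_monomial, h, I_pow_val_add, I_pow_val_two_mul,
    mul_x, mul_z, sgn_add_left, sgn_add_right]
  congr 1
  · funext r
    simp only [Function.comp]
    abel
  · funext r
    rw [← Finset.prod_pow_eq_pow_sum]
    simp only [sgn]
    ring

theorem toMatrix_one : (1 : Pauli n).toMatrix = 1 := by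
  rw [toMatrix_eq_monomial, ← monomial_id]
  congr 1
  · funext r
    simp
  · simp

theorem toMatrix_smul (s : ZMod 4) (x z : Fin n → ZMod 2) :
    (⟨s, x, z⟩ : Pauli n).toMatrix = Complex.I ^ s.val • (⟨0, x, z⟩ : Pauli n).toMatrix := by
  simp [toMatrix_eq_monomial, smul_monomial]

theorem toMatrix_neg (P : Pauli n) : (-P).toMatrix = -P.toMatrix := by
  have h : Complex.I ^ (P.s + 2).val = -Complex.I ^ P.s.val := by
    have : Complex.I ^ (2 : ZMod 4).val = -1 := by
      simpa using I_pow_val_two_mul 1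
    rw [I_pow_val_add, this]
    simp
  rw [toMatrix_eq_monomial, toMatrix_eq_monomial, ← neg_one_smul ℂ, smul_monomial]
  simp [h]

theorem star_I_pow_mul (k : ℕ) : star (Complex.I ^ k) * Complex.I ^ k = 1 := by
  rw [star_pow, ← mul_pow]
  simp

theorem toMatrix_mem_unitaryGroup (P : Pauli n) :
    P.toMatrix ∈ Matrix.unitaryGroup (Fin n → ZMod 2) ℂ := by
  refine monomial_mem_unitaryGroup (add_left_injective _) fun r => ?_
  rw [star_mul', ← sgn, star_sgn, mul_mul_mul_comm, star_I_pow_mul, sgn_sq, one_mul]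

theorem I_pow_val_injective : Function.Injective fun s : ZMod 4 => Complex.I ^ s.val := by
  intro a b h
  have h' : (Complex.I ^ a.val).re = (Complex.I ^ b.val).re ∧
      (Complex.I ^ a.val).im = (Complex.I ^ b.val).im := by
    simp only at h
    simp [h]
  have key : ∀ c : ZMod 4, c = 0 ∨ c = 1 ∨ c = 2 ∨ c = 3 := by decide
  have v2 : (2 : ZMod 4).val = 2 := rfl
  have v3 : (3 : ZMod 4).val = 3 := rfl
  have v1 : (1 : ZMod 4).val = 1 := rfl
  rcases key a with rfl | rfl | rfl | rfl <;> rcases key b with rfl | rfl | rfl | rfl <;>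
    first
    | rfl
    | (exfalso; norm_num [v1, v2, v3, Complex.I_pow_three] at h')

/-- Column `0` shows the shift `x` and the phase `i^s`, and column `e_j` then shows `z j`.
Faithfulness lets identities in the Pauli group, associativity included, be checked on matrices. -/
theorem toMatrix_injective : Function.Injective (toMatrix : Pauli n → Op n) := by
  rintro ⟨s, x, z⟩ ⟨s', x', z'⟩ h
  have e (a r) := congrFun (congrFun h a) r
  simp only [toMatrix_eq_monomial, monomial] at e
  have hx : x = x' := by
    by_contra hx
    have := e x 0
    simp [hx] at this
  subst hx
  have hs : s = s' := by
    have := e x 0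
    simp only [zero_add, if_true, sgn_zero_right, mul_one] at this
    exact I_pow_val_injective this
  subst hs
  have hz : z = z' := by
    funext j
    have := e (Pi.single j 1 + x) (Pi.single j 1)
    simp only [if_true, sgn_single_right] at this
    have h1 := mul_left_cancel₀ (pow_ne_zero _ Complex.I_ne_zero) this
    have v1 : (1 : ZMod 2).val = 1 := rfl
    rcases zmod_two_eq_zero_or_one (z j) with h0 | h0 <;>
      rcases zmod_two_eq_zero_or_one (z' j) with h0' | h0' <;>
      rw [h0, h0'] at h1 ⊢ <;> norm_num [v1] at h1
  rw [hz]

instance : Monoid (Pauli n) where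
  mul_assoc P Q R := toMatrix_injective (by simp only [toMatrix_mul, mul_assoc])
  one_mul P := toMatrix_injective (by rw [toMatrix_mul, toMatrix_one, one_mul])
  mul_one P := toMatrix_injective (by rw [toMatrix_mul, toMatrix_one, mul_one])

/-- `toMatrix` as a homomorphism of monoids. -/
noncomputable def toMatrixHom : Pauli n →* Op n where
  toFun := toMatrix
  map_one' := toMatrix_one
  map_mul' := toMatrix_mul

/-- A unitary is Hermitian exactly when it is its own inverse. All later arguments use Hermiticity
in the form `P * P = 1`. -/
theorem isHermitian_iff (P : Pauli n) : P.toMatrix.IsHermitian ↔ P * P = 1 := by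
  have hu := P.toMatrix_mem_unitaryGroup
  rw [← toMatrix_injective.eq_iff, toMatrix_mul, toMatrix_one, Matrix.IsHermitian]
  constructor
  · intro h
    have h1 := Matrix.mem_unitaryGroup_iff.1 hu
    rwa [Matrix.star_eq_conjTranspose, h] at h1
  · intro h
    have h1 := Matrix.mem_unitaryGroup_iff'.1 hu
    rw [Matrix.star_eq_conjTranspose] at h1
    calc P.toMatrix.conjTranspose = P.toMatrix.conjTranspose * (P.toMatrix * P.toMatrix) := by
          rw [h, mul_one]
      _ = P.toMatrix := by rw [← mul_assoc, h1, one_mul]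

/-- The square of `i^s X^x Z^z` is `i^{2s} (-1)^{x·z}`. -/
theorem mul_self_eq_one_iff (P : Pauli n) :
    P * P = 1 ↔ 2 * P.s = 2 * ∑ j, ((P.x j).val * (P.z j).val : ℕ) := by
  have key : ∀ a b : ZMod 4, a + a + 2 * b = 0 ↔ 2 * a = 2 * b := by decide
  rw [Pauli.ext_iff]
  simp only [mul_s, mul_x, mul_z, one_s, one_x, one_z, bits_add_self, and_true, key]
  simp only [mul_comm (P.z _).val]

/-- Two self-inverse Pauli operators with the same bits are equal up to sign. -/
theorem eq_or_eq_neg {P R : Pauli n} (hP : P * P = 1) (hR : R * R = 1) (hx : P.x = R.x)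
    (hz : P.z = R.z) : P = R ∨ P = -R := by
  rw [mul_self_eq_one_iff] at hP hR
  rw [hx, hz, ← hR] at hP
  have key : ∀ a b : ZMod 4, 2 * a = 2 * b → a = b ∨ a = b + 2 := by decide
  rcases key _ _ hP with h | h
  · exact Or.inl (Pauli.ext h hx hz)
  · exact Or.inr (Pauli.ext h hx hz)

theorem toMatrix_mul_comm (P Q : Pauli n) :
    P.toMatrix * Q.toMatrix = (-1 : ℂ) ^ (comm P Q).val • (Q.toMatrix * P.toMatrix) := by
  simp only [toMatrix_eq_monomial, monomial_mul_monomial, smul_monomial, sgn_add_right]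
  congr 1
  · funext r
    simp only [Function.comp]
    abel
  · funext r
    have h : (-1 : ℂ) ^ (comm P Q).val = sgn Q.z P.x * sgn P.z Q.x := by
      have h1 := neg_one_pow_mul_val_add 1 (∑ j, P.x j * Q.z j) (∑ j, P.z j * Q.x j)
      simp only [one_mul] at h1
      rw [comm, Finset.sum_add_distrib, h1, sgn_comm Q.z, sgn_eq_pow, sgn_eq_pow]
    rw [h]
    linear_combination (-1 : ℂ) * (Complex.I ^ P.s.val * Complex.I ^ Q.s.val * sgn P.z r *
      sgn Q.z r * sgn P.z Q.x) * (sgn_sq Q.z P.x)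

/-- A product of Pauli matrices is nonzero, so the sign in the commutation relation is determined by
the matrices. This makes `comm` invariant under conjugation. -/
theorem comm_eq_of_toMatrix {P Q : Pauli n} {P' Q' : Pauli n}
    (h : ∀ c : ℂ, P.toMatrix * Q.toMatrix = c • (Q.toMatrix * P.toMatrix) →
      P'.toMatrix * Q'.toMatrix = c • (Q'.toMatrix * P'.toMatrix)) : comm P Q = comm P' Q' := by
  have h1 := h _ (toMatrix_mul_comm P Q)
  rw [toMatrix_mul_comm P' Q'] at h1
  have hu : (Q' * P').toMatrix ≠ 0 := by
    intro h0
    have := Matrix.mem_unitaryGroup_iff.1 (Q' * P').toMatrix_mem_unitaryGroup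
    rw [h0, zero_mul] at this
    exact zero_ne_one this
  rw [← toMatrix_mul] at h1
  have h2 := smul_left_injective ℂ hu h1
  have v1 : (1 : ZMod 2).val = 1 := rfl
  rcases zmod_two_eq_zero_or_one (comm P Q) with h0 | h0 <;>
    rcases zmod_two_eq_zero_or_one (comm P' Q') with h0' | h0' <;>
    rw [h0, h0'] at h2 ⊢ <;> norm_num [v1] at h2

end Pauli

/-! ### Gates and circuits -/

theorem update_add_eq {n : ℕ} (r : Fin n → ZMod 2) (t : Fin n) (a : ZMod 2) :
    Function.update r t (r t + a) = r + Pi.single t a := by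
  funext i
  rcases eq_or_ne i t with rfl | h
  · simp
  · simp [h]

namespace Gate

variable {n : ℕ}

/-- The action of a gate on computational basis states. -/
def perm : Gate n → (Fin n → ZMod 2) → Fin n → ZMod 2
  | s _, r => r
  | cz _ _, r => r
  | cx c t, r => r + Pi.single t (r c)

/-- The exponent of the phase, as a power of `i`, which a gate applies to a basis state. -/
def phase : Gate n → (Fin n → ZMod 2) → ℕ
  | s j, r => (r j).val
  | cz j k, r => 2 * ((r j).val * (r k).val)
  | cx _ _, _ => 0

theorem toMatrix_eq_monomial (g : Gate n) :
    g.toMatrix = monomial g.perm fun r => Complex.I ^ g.phase r := by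
  cases g with
  | s j =>
    ext a r
    by_cases h : a = r <;> simp [toMatrix, monomial, perm, phase, h]
  | cz j k =>
    ext a r
    by_cases h : a = r <;> simp [toMatrix, monomial, perm, phase, h, pow_mul]
  | cx c t =>
    ext a r
    simp [toMatrix, monomial, perm, phase, update_add_eq]

theorem perm_injective {g : Gate n} (hg : g.WellFormed) : Function.Injective g.perm := by
  cases g with
  | s j => exact fun _ _ h => h
  | cz j k => exact fun _ _ h => h
  | cx c t =>
    have hi : Function.Involutive (cx c t).perm := by
      intro r
      have hct : c ≠ t := hg
      simp only [perm]
      rw [add_assoc, ← Pi.single_add]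
      simp [hct, CharTwo.add_self_eq_zero]
    exact hi.injective

theorem toMatrix_mem_unitaryGroup {g : Gate n} (hg : g.WellFormed) :
    g.toMatrix ∈ Matrix.unitaryGroup (Fin n → ZMod 2) ℂ := by
  rw [toMatrix_eq_monomial]
  exact monomial_mem_unitaryGroup (perm_injective hg) fun r => Pauli.star_I_pow_mul _

theorem cx_mul_self {c t : Fin n} (hct : c ≠ t) :
    (cx c t : Gate n).toMatrix * (cx c t).toMatrix = 1 := by
  rw [toMatrix_eq_monomial, monomial_mul_monomial, ← monomial_id]
  congr 1
  · funext r
    simp only [Function.comp, perm]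
    rw [add_assoc, ← Pi.single_add]
    simp [hct, CharTwo.add_self_eq_zero]
  · funext r
    simp [phase]

/-- As an intertwining relation the statement needs no inverse and composes along a circuit. The
proof compares permutation and phase of two monomial matrices. -/
theorem conj_spec {g : Gate n} (hg : g.WellFormed) (P : Pauli n) :
    g.toMatrix * P.toMatrix = (g.conj P).toMatrix * g.toMatrix := by
  simp only [toMatrix_eq_monomial, Pauli.toMatrix_eq_monomial, monomial_mul_monomial]
  cases g with
  | s j =>
    congr 1
    funext r
    -- Adding two bits modulo 2 drops the carry, which costs `i^{-2ab} = (-1)^{ab}`.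
    have h1 : Complex.I ^ (r j + P.x j).val =
        Complex.I ^ (r j).val * Complex.I ^ (P.x j).val * (-1) ^ ((P.x j).val * (r j).val) := by
      generalize r j = a
      generalize P.x j = b
      have v1 : (1 : ZMod 2).val = 1 := rfl
      have v2 : (1 + 1 : ZMod 2) = 0 := rfl
      rcases zmod_two_eq_zero_or_one a with rfl | rfl <;>
        rcases zmod_two_eq_zero_or_one b with rfl | rfl <;> simp [v1, v2]
    simp only [phase, conj, perm, update_add_eq, sgn_add_left, sgn_single_left, Pi.add_apply, h1,
      I_pow_val_add, I_pow_val_natCast]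
    ring
  | cz j k =>
    congr 1
    funext r
    simp only [phase, conj, perm, sgn_add_left, sgn_single_left, Pi.add_apply, I_pow_val_add,
      I_pow_val_two_mul, pow_mul Complex.I 2, Complex.I_sq, neg_one_pow_mul_val_add,
      neg_one_pow_val_add_mul]
    rw [mul_comm (P.x j).val (r k).val]
    ring
  | cx c t =>
    have hct : c ≠ t := hg
    congr 1
    · funext r
      simp only [Function.comp, perm, conj, update_add_eq, Pi.add_apply, Pi.single_add]
      abel
    · funext r
      have h1 : ((-1 : ℂ) ^ ((P.z t).val * (r c).val)) * (-1) ^ ((P.z t).val * (r c).val) = 1 := by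
        rw [← mul_pow]
        simp
      simp only [phase, perm, conj, update_add_eq, sgn_add_left, sgn_add_right, sgn_single_left,
        sgn_single_right, Pi.add_apply, Pi.single_eq_of_ne hct.symm]
      simp only [add_zero, pow_zero, one_mul, mul_one]
      linear_combination (-Complex.I ^ P.s.val * sgn P.z r) * h1

end Gate

namespace Circuit

variable {n : ℕ}

theorem toMatrix_append (v w : Circuit n) : (v ++ w).toMatrix = w.toMatrix * v.toMatrix := by
  induction v with
  | nil => simp [toMatrix]
  | cons g v ih =>
    rw [List.cons_append, toMatrix, toMatrix, ih, mul_assoc]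

theorem conj_append (v w : Circuit n) (P : Pauli n) : (v ++ w).conj P = w.conj (v.conj P) :=
  List.foldl_append

theorem conj_cons (g : Gate n) (w : Circuit n) (P : Pauli n) :
    conj (g :: w) P = w.conj (g.conj P) := rfl

theorem conj_spec {w : Circuit n} (hw : ∀ g ∈ w, g.WellFormed) (P : Pauli n) :
    w.toMatrix * P.toMatrix = (w.conj P).toMatrix * w.toMatrix := by
  induction w generalizing P with
  | nil => simp [toMatrix, conj]
  | cons g w ih =>
    rw [List.forall_mem_cons] at hw
    rw [toMatrix, conj_cons, mul_assoc, Gate.conj_spec hw.1, ← mul_assoc, ih hw.2, mul_assoc]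

theorem toMatrix_mem_phaseCSS {w : Circuit n} (hw : ∀ g ∈ w, g.WellFormed) :
    w.toMatrix ∈ phaseCSS n := by
  induction w with
  | nil => exact one_mem _
  | cons g w ih =>
    rw [List.forall_mem_cons] at hw
    exact mul_mem (ih hw.2) (Submonoid.subset_closure ⟨g, hw.1, rfl⟩)

end Circuit

theorem exists_circuit_of_mem_phaseCSS {n : ℕ} {U : Op n} (hU : U ∈ phaseCSS n) :
    ∃ w : Circuit n, (∀ g ∈ w, g.WellFormed) ∧ w.toMatrix = U := by
  induction hU using Submonoid.closure_induction with
  | mem M hM =>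
    obtain ⟨g, hg, rfl⟩ := hM
    exact ⟨[g], by simpa using hg, by simp [Circuit.toMatrix]⟩
  | one => exact ⟨[], by simp, rfl⟩
  | mul M N _ _ hM hN =>
    obtain ⟨v, hv, rfl⟩ := hM
    obtain ⟨w, hw, rfl⟩ := hN
    refine ⟨w ++ v, fun g hg => ?_, Circuit.toMatrix_append w v⟩
    rcases List.mem_append.1 hg with h | h
    exacts [hw g h, hv g h]

theorem phaseCSS_le_unitaryGroup (n : ℕ) :
    phaseCSS n ≤ Matrix.unitaryGroup (Fin n → ZMod 2) ℂ := by
  refine Submonoid.closure_le.2 ?_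
  rintro M ⟨g, hg, rfl⟩
  exact Gate.toMatrix_mem_unitaryGroup hg

section Unitary

variable {n : ℕ} {U : Op n}

theorem conjTranspose_mul_of_mem (hU : U ∈ phaseCSS n) : U.conjTranspose * U = 1 :=
  Matrix.mem_unitaryGroup_iff'.1 (phaseCSS_le_unitaryGroup n hU)

theorem mul_conjTranspose_of_mem (hU : U ∈ phaseCSS n) : U * U.conjTranspose = 1 :=
  Matrix.mem_unitaryGroup_iff.1 (phaseCSS_le_unitaryGroup n hU)

theorem exists_pauli_conj (hU : U ∈ phaseCSS n) (P : Pauli n) :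
    ∃ R : Pauli n, U * P.toMatrix * U.conjTranspose = R.toMatrix := by
  obtain ⟨w, hw, rfl⟩ := exists_circuit_of_mem_phaseCSS hU
  refine ⟨w.conj P, ?_⟩
  rw [Circuit.conj_spec hw, mul_assoc, mul_conjTranspose_of_mem hU, mul_one]

/-- `phaseCSS` is defined as a mere submonoid. Each gate has order dividing 4, so its adjoint is its
cube. -/
theorem Gate.conjTranspose_toMatrix_mem_phaseCSS {g : Gate n} (hg : g.WellFormed) :
    g.toMatrix.conjTranspose ∈ phaseCSS n := by
  have hm : g.toMatrix ∈ phaseCSS n := Submonoid.subset_closure ⟨g, hg, rfl⟩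
  have h4 : g.toMatrix ^ 4 = 1 := by
    have hc : ∀ m : ℕ, (Complex.I ^ m) ^ 4 = 1 := fun m => by
      rw [← pow_mul, mul_comm, pow_mul, Complex.I_pow_four, one_pow]
    cases g with
    | s j =>
      rw [toMatrix, Matrix.diagonal_pow, ← Matrix.diagonal_one]
      congr 1
      funext r
      exact hc _
    | cz j k =>
      rw [toMatrix, Matrix.diagonal_pow, ← Matrix.diagonal_one]
      congr 1
      funext r
      rw [Pi.pow_apply, ← pow_mul, mul_comm, pow_mul]
      norm_num
    | cx c t =>
      rw [show 4 = 2 * 2 from rfl, pow_mul, pow_two (cx c t : Gate n).toMatrix,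
        cx_mul_self hg, one_pow]
  have : g.toMatrix.conjTranspose = g.toMatrix ^ 3 := by
    calc g.toMatrix.conjTranspose = g.toMatrix.conjTranspose * g.toMatrix ^ 4 := by
          rw [h4, mul_one]
      _ = g.toMatrix ^ 3 := by
          rw [pow_succ' _ 3, ← mul_assoc, conjTranspose_mul_of_mem hm, one_mul]
  rw [this]
  exact pow_mem hm 3

theorem conjTranspose_mem_phaseCSS (hU : U ∈ phaseCSS n) : U.conjTranspose ∈ phaseCSS n := by
  induction hU using Submonoid.closure_induction with
  | mem M hM =>
    obtain ⟨g, hg, rfl⟩ := hM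
    exact Gate.conjTranspose_toMatrix_mem_phaseCSS hg
  | one => simp
  | mul M N _ _ hM hN =>
    rw [Matrix.conjTranspose_mul]
    exact mul_mem hN hM

end Unitary

/-! ### Tableaux -/

namespace Pauli

variable {n : ℕ}

theorem listProd_X_eq (x : Fin n → ZMod 2) :
    ((List.finRange n).map fun j => if x j = 1 then X j else 1).prod = ⟨0, x, 0⟩ := by
  have h : ∀ L : List (Fin n), (L.map fun j => if x j = 1 then X j else (1 : Pauli n)).prod =
      ⟨0, (L.map fun j => (Pi.single j (x j) : Fin n → ZMod 2)).sum, 0⟩ := by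
    intro L
    induction L with
    | nil => rfl
    | cons a L ih =>
      rw [List.map_cons, List.prod_cons, ih, List.map_cons, List.sum_cons]
      rcases zmod_two_eq_zero_or_one (x a) with h0 | h0 <;> rw [h0]
      · simp
      · rw [if_pos rfl]
        ext <;> simp [X, mul_s]
  rw [h, ← List.ofFn_eq_map, List.sum_ofFn]
  congr 1
  exact Finset.univ_sum_single x

theorem listProd_Z_eq (z : Fin n → ZMod 2) :
    ((List.finRange n).map fun j => if z j = 1 then Z j else 1).prod = ⟨0, 0, z⟩ := by
  have h : ∀ L : List (Fin n), (L.map fun j => if z j = 1 then Z j else (1 : Pauli n)).prod =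
      ⟨0, 0, (L.map fun j => (Pi.single j (z j) : Fin n → ZMod 2)).sum⟩ := by
    intro L
    induction L with
    | nil => rfl
    | cons a L ih =>
      rw [List.map_cons, List.prod_cons, ih, List.map_cons, List.sum_cons]
      rcases zmod_two_eq_zero_or_one (z a) with h0 | h0 <;> rw [h0]
      · simp
      · rw [if_pos rfl]
        ext <;> simp [Z, mul_s]
  rw [h, ← List.ofFn_eq_map, List.sum_ofFn]
  congr 1
  exact Finset.univ_sum_single z

theorem eq_mul_mul (P : Pauli n) : P = ⟨P.s, 0, 0⟩ * ⟨0, P.x, 0⟩ * ⟨0, 0, P.z⟩ := by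
  ext <;> simp [mul_s]

end Pauli

namespace Tableau

variable {n : ℕ} {T : Tableau n} {U : Op n}

theorem image_s (T : Tableau n) (s : ZMod 4) (x z : Fin n → ZMod 2) :
    T.image ⟨s, x, z⟩ = ⟨s, 0, 0⟩ * T.image ⟨0, x, z⟩ := by
  have : (⟨0, 0, 0⟩ : Pauli n) = 1 := rfl
  simp only [image, this, one_mul, mul_assoc]

/-- Conjugation by `U` as a homomorphism. -/
noncomputable def conjHom (hU : U ∈ phaseCSS n) : Op n →* Op n where
  toFun M := U * M * U.conjTranspose
  map_one' := by rw [mul_one, mul_conjTranspose_of_mem hU]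
  map_mul' M N := by
    calc U * (M * N) * U.conjTranspose
        = U * M * (U.conjTranspose * U) * N * U.conjTranspose := by
          rw [conjTranspose_mul_of_mem hU]
          simp only [mul_assoc, one_mul]
      _ = _ := by simp only [mul_assoc]

/-- Conjugation by `U` is multiplicative and fixes scalars, so it carries the ordered product of
`i^s`, the `X_j` and the `Z_j` to the same product of their images. -/
theorem Represents.image (hT : T.Represents U) (hU : U ∈ phaseCSS n) (P : Pauli n) :
    U * P.toMatrix * U.conjTranspose = (T.image P).toMatrix := by
  have hl : ∀ (v : Fin n → ZMod 2) (A B : Fin n → Pauli n),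
      (∀ j, conjHom hU (A j).toMatrix = (B j).toMatrix) →
      conjHom hU (((List.finRange n).map fun j => if v j = 1 then A j else 1).prod).toMatrix =
        (((List.finRange n).map fun j => if v j = 1 then B j else 1).prod).toMatrix := by
    intro v A B hAB
    change conjHom hU (Pauli.toMatrixHom _) = Pauli.toMatrixHom _
    rw [map_list_prod, map_list_prod, map_list_prod, List.map_map, List.map_map, List.map_map]
    congr 2
    funext j
    simp only [Function.comp]
    split_ifs
    · exact hAB j
    · simp
  have hs : conjHom hU (⟨P.s, 0, 0⟩ : Pauli n).toMatrix = (⟨P.s, 0, 0⟩ : Pauli n).toMatrix := by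
    have : (⟨0, 0, 0⟩ : Pauli n) = 1 := rfl
    rw [Pauli.toMatrix_smul, this, Pauli.toMatrix_one]
    change U * _ * _ = _
    rw [mul_smul_comm, smul_mul_assoc, mul_one, mul_conjTranspose_of_mem hU]
  change conjHom hU P.toMatrix = _
  rw [Pauli.eq_mul_mul P, Pauli.toMatrix_mul, Pauli.toMatrix_mul, map_mul, map_mul, hs,
    ← Pauli.listProd_X_eq, ← Pauli.listProd_Z_eq, hl _ _ T.imX fun j => (hT j).1,
    hl _ _ T.imZ fun j => (hT j).2, ← Pauli.toMatrix_mul, ← Pauli.toMatrix_mul, Tableau.image]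
  simp [Pauli.listProd_X_eq, Pauli.listProd_Z_eq, Pauli.mul_s]

theorem Represents.mul_toMatrix (hT : T.Represents U) (hU : U ∈ phaseCSS n) (P : Pauli n) :
    U * P.toMatrix = (T.image P).toMatrix * U := by
  rw [← hT.image hU, mul_assoc, conjTranspose_mul_of_mem hU, mul_one]

theorem comm_X (P : Pauli n) (j : Fin n) : P.comm (Pauli.X j) = P.z j := by
  simp only [Pauli.comm, Pauli.X, Pi.zero_apply, mul_zero, zero_add]
  rw [Finset.sum_eq_single j] <;> simp +contextual

theorem comm_Z (P : Pauli n) (j : Fin n) : P.comm (Pauli.Z j) = P.x j := by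
  simp only [Pauli.comm, Pauli.Z, Pi.zero_apply, mul_zero, add_zero]
  rw [Finset.sum_eq_single j] <;> simp +contextual

/-- By closure under adjoints, `U† Q U` is some Pauli `R`. Conjugation preserves commutators, and
the commutators of `R` with `Z_j` and `X_j` are its bits `x j` and `z j`. So `T.preimage Q` has the
bits of `R`, and comparing the phases of the images gives the phase of `R`. -/
theorem Represents.image_preimage (hT : T.Represents U) (hU : U ∈ phaseCSS n) (Q : Pauli n) :
    T.image (T.preimage Q) = Q := by
  obtain ⟨R, hR⟩ := exists_pauli_conj (conjTranspose_mem_phaseCSS hU) Q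
  rw [Matrix.conjTranspose_conjTranspose] at hR
  have hQ : Q = T.image R := by
    apply Pauli.toMatrix_injective
    rw [← hT.image hU, ← hR]
    calc Q.toMatrix = U * U.conjTranspose * Q.toMatrix * (U * U.conjTranspose) := by
          rw [mul_conjTranspose_of_mem hU, one_mul, mul_one]
      _ = _ := by simp only [mul_assoc]
  have hc : ∀ A B, Pauli.comm (T.image A) (T.image B) = Pauli.comm A B := by
    intro A B
    refine (Pauli.comm_eq_of_toMatrix fun c h => ?_).symm
    rw [← hT.image hU, ← hT.image hU]
    change conjHom hU _ * conjHom hU _ = c • (conjHom hU _ * conjHom hU _)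
    rw [← map_mul, ← map_mul, h]
    change U * _ * _ = c • (U * _ * _)
    rw [mul_smul_comm, smul_mul_assoc]
  have hX : ∀ j, T.imX j = T.image (Pauli.X j) := fun j =>
    Pauli.toMatrix_injective (by rw [← hT.image hU, (hT j).1])
  have hZ : ∀ j, T.imZ j = T.image (Pauli.Z j) := fun j =>
    Pauli.toMatrix_injective (by rw [← hT.image hU, (hT j).2])
  have hs : (T.image R).s - (T.image ⟨0, R.x, R.z⟩).s = R.s := by
    rw [show R = ⟨R.s, R.x, R.z⟩ from rfl, image_s, Pauli.mul_s]
    simp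
  have : T.preimage Q = R := by
    rw [hQ, preimage]
    simp only [hX, hZ, hc, comm_X, comm_Z, hs]
  rw [this, hQ]

theorem Represents.leftMul (hT : T.Represents U) {w : Circuit n} (hw : ∀ g ∈ w, g.WellFormed) :
    (T.leftMul w).Represents (w.toMatrix * U) := by
  have h1 := mul_conjTranspose_of_mem (Circuit.toMatrix_mem_phaseCSS hw)
  have h2 (P R : Pauli n) (h : U * P.toMatrix * U.conjTranspose = R.toMatrix) :
      w.toMatrix * U * P.toMatrix * (w.toMatrix * U).conjTranspose = (w.conj R).toMatrix := by
    rw [Matrix.conjTranspose_mul]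
    calc _ = w.toMatrix * (U * P.toMatrix * U.conjTranspose) * w.toMatrix.conjTranspose := by
          simp only [mul_assoc]
      _ = _ := by rw [h, Circuit.conj_spec hw, mul_assoc, h1, mul_one]
  exact fun j => ⟨h2 _ _ (hT j).1, h2 _ _ (hT j).2⟩

theorem Represents.rightMul (hT : T.Represents U) (hU : U ∈ phaseCSS n) {w : Circuit n}
    (hw : ∀ g ∈ w, g.WellFormed) : (T.rightMul w).Represents (U * w.toMatrix) := by
  have h1 := mul_conjTranspose_of_mem (Circuit.toMatrix_mem_phaseCSS hw)
  have h2 (P : Pauli n) :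
      U * w.toMatrix * P.toMatrix * (U * w.toMatrix).conjTranspose =
        (T.image (w.conj P)).toMatrix := by
    rw [Matrix.conjTranspose_mul]
    calc _ = U * (w.toMatrix * P.toMatrix * w.toMatrix.conjTranspose) * U.conjTranspose := by
          simp only [mul_assoc]
      _ = _ := by rw [Circuit.conj_spec hw, mul_assoc _ w.toMatrix, h1, mul_one, hT.image hU]
  exact fun j => ⟨h2 _, h2 _⟩

end Tableau

theorem exists_tableau {n : ℕ} {U : Op n} (hU : U ∈ phaseCSS n) :
    ∃ T : Tableau n, T.Represents U := by
  choose f hf using exists_pauli_conj hU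
  exact ⟨⟨fun j => f (Pauli.X j), fun j => f (Pauli.Z j)⟩, fun j => ⟨hf _, hf _⟩⟩

/-! ### Pauli exponentials -/

theorem sqrt_two_sq : ((√2 : ℝ) : ℂ) ^ 2 = 2 := by
  rw [← Complex.ofReal_pow, Real.sq_sqrt (by norm_num)]
  norm_num

theorem sqrt_two_ne_zero : ((√2 : ℝ) : ℂ) ≠ 0 := by
  intro h
  have := sqrt_two_sq
  rw [h] at this
  norm_num at this

theorem omega_eq : omega = ((√2 : ℝ) : ℂ)⁻¹ * (1 + Complex.I) := by
  have h0 := sqrt_two_ne_zero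
  have h : (Real.pi / 4 : ℂ) = ((Real.pi / 4 : ℝ) : ℂ) := by norm_num
  rw [omega, h, Complex.exp_mul_I, ← Complex.ofReal_cos, ← Complex.ofReal_sin,
    Real.cos_pi_div_four, Real.sin_pi_div_four]
  field_simp
  push_cast
  linear_combination (1 + Complex.I) / 2 * sqrt_two_sq

theorem omega_sq : omega ^ 2 = Complex.I := by
  rw [omega_eq, mul_pow, inv_pow, sqrt_two_sq]
  linear_combination (1 / 2 : ℂ) * Complex.I_sq

theorem omega_pow_four : omega ^ 4 = -1 := by
  rw [show 4 = 2 * 2 from rfl, pow_mul, omega_sq, Complex.I_sq]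

theorem omega_pow_val_add (a b : ZMod 8) :
    omega ^ (a + b).val = omega ^ a.val * omega ^ b.val := by
  have h8 : omega ^ 8 = 1 := by
    rw [show 8 = 4 * 2 from rfl, pow_mul, omega_pow_four]
    norm_num
  rw [← pow_add, ZMod.val_add, ← pow_eq_pow_mod _ h8]

section PauliExp

variable {n : ℕ}

/-- With `M² = 1`, the operators `(1 ± M)/2` are the spectral projections of `M`. The exponential
series splits into the scalar series of `e^{iπ/4}` and `e^{-iπ/4}` on them. -/
theorem pauliExp_eq {Q : Pauli n} (hQ : Q * Q = 1) :
    pauliExp Q = ((√2 : ℝ) : ℂ)⁻¹ • (1 + Complex.I • Q.toMatrix) := by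
  set M := Q.toMatrix with hM
  have hM2 : M * M = 1 := by rw [hM, ← Pauli.toMatrix_mul, hQ, Pauli.toMatrix_one]
  set c : ℂ := Real.pi / 4 * Complex.I with hc
  have hp : ∀ k : ℕ, M ^ k = (1 / 2 : ℂ) • (1 + M) + (-1 : ℂ) ^ k • ((1 / 2 : ℂ) • (1 - M)) := by
    intro k
    induction k with
    | zero =>
      rw [pow_zero, pow_zero]
      module
    | succ k ih =>
      rw [pow_succ, ih, pow_succ]
      simp only [add_mul, smul_mul_assoc, sub_mul, one_mul, hM2]
      module
  have hsum : ∀ d : ℂ, HasSum (fun k : ℕ => ((k.factorial : ℂ)⁻¹) • d ^ k) (Complex.exp d) := by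
    intro d
    rw [Complex.exp_eq_exp_ℂ]
    exact NormedSpace.exp_series_hasSum_exp' (𝕂 := ℂ) d
  have h1 := ((hsum c).smul_const ((1 / 2 : ℂ) • (1 + M))).add
    ((hsum (-c)).smul_const ((1 / 2 : ℂ) • (1 - M)))
  have h2 : HasSum (fun k : ℕ => ((k.factorial : ℂ)⁻¹) • (c • M) ^ k) (Complex.exp c •
      ((1 / 2 : ℂ) • (1 + M)) + Complex.exp (-c) • ((1 / 2 : ℂ) • (1 - M))) := by
    convert h1 using 2 with k
    rw [smul_pow, hp, neg_pow c]
    simp only [smul_eq_mul]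
    module
  have hc1 : Complex.exp c = omega := rfl
  have hc2 : Complex.exp (-c) = ((√2 : ℝ) : ℂ)⁻¹ * (1 - Complex.I) := by
    rw [Complex.exp_neg, hc1]
    refine inv_eq_of_mul_eq_one_left ?_
    rw [omega_eq]
    have := sqrt_two_sq
    have h0 := sqrt_two_ne_zero
    field_simp
    linear_combination (-1 : ℂ) * Complex.I_sq - this
  rw [pauliExp, NormedSpace.exp_eq_tsum ℂ]
  refine h2.tsum_eq.trans ?_
  rw [hc1, hc2, omega_eq]
  module

theorem mul_pauliExp {U : Op n} {Q R : Pauli n} (hQ : Q * Q = 1) (hR : R * R = 1)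
    (h : U * Q.toMatrix = R.toMatrix * U) : U * pauliExp Q = pauliExp R * U := by
  rw [pauliExp_eq hQ, pauliExp_eq hR]
  simp only [mul_smul_comm, mul_add, mul_one, smul_mul_assoc, add_mul, one_mul, h]

end PauliExp

/-! ### Gates as combinations of Pauli operators -/

theorem one_eq_monomial (n : ℕ) : (1 : Op n) = monomial id fun _ => 1 := monomial_id.symm

namespace Gate

variable {n : ℕ}

/-- Gates are polynomials in `X` and `Z`. Facts about Pauli operators that survive sums and
products, such as commuting with a Hadamard layer or the effect of an embedding, thereby extend to
gates. -/
theorem toMatrix_s (j : Fin n) : (s j).toMatrix =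
    ((1 + Complex.I) / 2) • (1 : Op n) + ((1 - Complex.I) / 2) • (Pauli.Z j).toMatrix := by
  ext a r
  have v1 : (1 : ZMod 2).val = 1 := rfl
  rw [toMatrix_eq_monomial, Pauli.toMatrix_eq_monomial, one_eq_monomial]
  simp only [monomial, perm, phase, Pauli.Z, sgn_single_left, Matrix.add_apply, Matrix.smul_apply,
    id, add_zero, smul_eq_mul]
  rcases eq_or_ne a r with rfl | h0
  · rcases zmod_two_eq_zero_or_one (a j) with h | h <;> simp [h, v1] <;> ring
  · simp [h0]

theorem toMatrix_cz (j k : Fin n) : (cz j k).toMatrix =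
    (1 / 2 : ℂ) • (1 + (Pauli.Z j).toMatrix + (Pauli.Z k).toMatrix -
      (Pauli.Z j).toMatrix * (Pauli.Z k).toMatrix) := by
  ext a r
  have v1 : (1 : ZMod 2).val = 1 := rfl
  rw [toMatrix_eq_monomial, Pauli.toMatrix_eq_monomial, Pauli.toMatrix_eq_monomial, one_eq_monomial,
    monomial_mul_monomial]
  simp only [monomial, perm, phase, Pauli.Z, sgn_single_left, Matrix.add_apply, Matrix.smul_apply,
    Matrix.sub_apply, id, add_zero, smul_eq_mul, Function.comp]
  rcases eq_or_ne a r with rfl | h0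
  · rcases zmod_two_eq_zero_or_one (a j) with h | h <;>
      rcases zmod_two_eq_zero_or_one (a k) with h' | h' <;>
      simp [h, h', v1] <;> norm_num
  · simp [h0]

theorem toMatrix_cx (c t : Fin n) : (cx c t).toMatrix =
    (1 / 2 : ℂ) • (1 + (Pauli.Z c).toMatrix + (Pauli.X t).toMatrix -
      (Pauli.X t).toMatrix * (Pauli.Z c).toMatrix) := by
  ext a r
  have v1 : (1 : ZMod 2).val = 1 := rfl
  rw [toMatrix_eq_monomial, Pauli.toMatrix_eq_monomial, Pauli.toMatrix_eq_monomial, one_eq_monomial,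
    monomial_mul_monomial]
  simp only [monomial, perm, phase, Pauli.Z, Pauli.X, sgn_single_left, Matrix.add_apply,
    Matrix.smul_apply, Matrix.sub_apply, id, add_zero, smul_eq_mul, Function.comp]
  rcases zmod_two_eq_zero_or_one (r c) with h | h <;> simp [h, v1] <;> split_ifs <;> norm_num

end Gate

/-! ### Hadamard layers -/

section Hadamard

variable {n : ℕ}

/-- Both entries factor over the qubits. On `J` the kernel `(-1)^{ar}` is bilinear, so a shift of
one index becomes a sign in the other. -/
theorem hadamardLayer_mul_toMatrix (J : Finset (Fin n)) (P : Pauli n) :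
    hadamardLayer J * P.toMatrix = (P.hadamardConj J).toMatrix * hadamardLayer J := by
  ext a r
  -- Bit vectors are their own negatives, so every row lies in the image of the shift.
  obtain ⟨c, rfl⟩ : ∃ c, a = c + (P.hadamardConj J).x :=
    ⟨a + (P.hadamardConj J).x, by rw [add_assoc, bits_add_self, add_zero]⟩
  have hs : Complex.I ^ (P.hadamardConj J).s.val =
      Complex.I ^ P.s.val * ∏ j, if j ∈ J then (-1 : ℂ) ^ ((P.x j).val * (P.z j).val) else 1 := by
    rw [show (P.hadamardConj J).s = P.s + 2 * ((∑ j ∈ J, (P.x j).val * (P.z j).val : ℕ) : ZMod 4)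
      from rfl, I_pow_val_add, I_pow_val_two_mul, Finset.prod_ite_mem, Finset.univ_inter,
      Finset.prod_pow_eq_pow_sum]
  rw [Pauli.toMatrix_eq_monomial, Pauli.toMatrix_eq_monomial, mul_monomial_apply,
    monomial_mul_apply (add_left_injective _), hs]
  simp only [hadamardLayer, sgn]
  rw [mul_left_comm, ← Finset.prod_mul_distrib, mul_assoc, mul_assoc, ← Finset.prod_mul_distrib,
    ← Finset.prod_mul_distrib]
  congr 1
  refine Finset.prod_congr rfl fun j _ => ?_
  have hsq : ∀ k : ℕ, (-1 : ℂ) ^ k * (-1) ^ k = 1 := fun k => by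
    rw [← mul_pow]
    simp
  by_cases hj : j ∈ J
  · simp only [hj, if_true, Pauli.hadamardConj, Pi.add_apply, neg_one_pow_mul_val_add,
      neg_one_pow_val_add_mul]
    have h1 := hsq ((P.z j).val * (r j).val)
    rw [mul_comm (P.z j).val (P.x j).val, mul_comm (c j).val (P.x j).val]
    linear_combination (omega * ((√2 : ℝ) : ℂ)⁻¹ * (-1) ^ ((c j).val * (r j).val) *
      (-1) ^ ((P.x j).val * (c j).val) * (-1) ^ ((P.x j).val * (P.z j).val)) * h1
  · simp only [hj, if_false, Pauli.hadamardConj, Pi.add_apply, add_left_inj]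
    split_ifs with h
    · rw [h]
      ring
    · simp

/-- The sum over bit vectors factors into sums over single bits, and at each qubit at least one of
the two layers is the identity. -/
theorem hadamardLayer_mul_of_disjoint {J K : Finset (Fin n)} (h : Disjoint J K) :
    hadamardLayer J * hadamardLayer K = hadamardLayer (J ∪ K) := by
  ext a r
  simp only [Matrix.mul_apply, hadamardLayer, ← Finset.prod_mul_distrib]
  rw [← Fintype.piFinset_univ, ← Finset.prod_univ_sum (fun _ => Finset.univ)
    fun j b => (if j ∈ J then omega * ((√2 : ℝ) : ℂ)⁻¹ * (-1 : ℂ) ^ ((a j).val * b.val)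
      else if a j = b then 1 else 0) * (if j ∈ K then
        omega * ((√2 : ℝ) : ℂ)⁻¹ * (-1 : ℂ) ^ (b.val * (r j).val) else if b = r j then 1 else 0)]
  refine Finset.prod_congr rfl fun j _ => ?_
  by_cases hJ : j ∈ J
  · have hK : j ∉ K := Finset.disjoint_left.1 h hJ
    simp [hJ, hK]
  · by_cases hK : j ∈ K <;> simp [hJ, hK]

theorem hadamardConj_of_disjoint {J : Finset (Fin n)} {P : Pauli n} (h : Disjoint P.support J) :
    P.hadamardConj J = P := by
  have h0 : ∀ j ∈ J, P.x j = 0 ∧ P.z j = 0 := by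
    intro j hj
    have := Finset.disjoint_right.1 h hj
    simpa [Pauli.support] using this
  have hs : ∑ j ∈ J, (P.x j).val * (P.z j).val = 0 :=
    Finset.sum_eq_zero fun j hj => by simp [h0 j hj]
  ext j
  · simp [Pauli.hadamardConj, hs]
  · simp only [Pauli.hadamardConj]
    split_ifs with hj
    · rw [(h0 j hj).1, (h0 j hj).2]
    · rfl
  · simp only [Pauli.hadamardConj]
    split_ifs with hj
    · rw [(h0 j hj).1, (h0 j hj).2]
    · rfl

theorem support_X (j : Fin n) : (Pauli.X j).support = {j} := by
  ext i
  simp [Pauli.support, Pauli.X, Pi.single_apply]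

theorem support_Z (j : Fin n) : (Pauli.Z j).support = {j} := by
  ext i
  simp [Pauli.support, Pauli.Z, Pi.single_apply]

theorem hadamardLayer_commute_pauli {J : Finset (Fin n)} {P : Pauli n}
    (h : Disjoint P.support J) : Commute (hadamardLayer J) P.toMatrix := by
  rw [Commute, SemiconjBy, hadamardLayer_mul_toMatrix, hadamardConj_of_disjoint h]

theorem hadamardLayer_commute_X {J : Finset (Fin n)} {j : Fin n} (h : j ∉ J) :
    Commute (hadamardLayer J) (Pauli.X j).toMatrix :=
  hadamardLayer_commute_pauli (by simpa [support_X] using h)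

theorem hadamardLayer_commute_Z {J : Finset (Fin n)} {j : Fin n} (h : j ∉ J) :
    Commute (hadamardLayer J) (Pauli.Z j).toMatrix :=
  hadamardLayer_commute_pauli (by simpa [support_Z] using h)

/-- The qubits on which a gate acts. -/
def Gate.qubits : Gate n → List (Fin n)
  | s j => [j]
  | cz j k => [j, k]
  | cx c t => [c, t]

theorem hadamardLayer_commute_gate {J : Finset (Fin n)} {g : Gate n} (h : ∀ j ∈ g.qubits, j ∉ J) :
    Commute (hadamardLayer J) g.toMatrix := by
  cases g with
  | s j =>
    simp only [Gate.qubits, List.forall_mem_cons] at h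
    rw [Gate.toMatrix_s]
    exact ((Commute.one_right _).smul_right _).add_right
      ((hadamardLayer_commute_Z h.1).smul_right _)
  | cz j k =>
    simp only [Gate.qubits, List.forall_mem_cons] at h
    have h1 := hadamardLayer_commute_Z h.1
    have h2 := hadamardLayer_commute_Z h.2.1
    rw [Gate.toMatrix_cz]
    exact ((((Commute.one_right _).add_right h1).add_right h2).sub_right
      (h1.mul_right h2)).smul_right _
  | cx c t =>
    simp only [Gate.qubits, List.forall_mem_cons] at h
    have h1 := hadamardLayer_commute_Z h.1
    have h2 := hadamardLayer_commute_X h.2.1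
    rw [Gate.toMatrix_cx]
    exact ((((Commute.one_right _).add_right h1).add_right h2).sub_right
      (h2.mul_right h1)).smul_right _

theorem hadamardLayer_commute_circuit {J : Finset (Fin n)} {w : Circuit n}
    (h : ∀ g ∈ w, ∀ j ∈ g.qubits, j ∉ J) : Commute (hadamardLayer J) w.toMatrix := by
  induction w with
  | nil => exact Commute.one_right _
  | cons g w ih =>
    rw [List.forall_mem_cons] at h
    exact (ih h.2).mul_right (hadamardLayer_commute_gate h.1)

theorem hadamardConj_X {J : Finset (Fin n)} {j : Fin n} (h : j ∈ J) :
    (Pauli.X j).hadamardConj J = Pauli.Z j := by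
  have hs : ∀ i ∉ J, i ≠ j := fun i hi e => hi (e ▸ h)
  ext i
  · simp [Pauli.hadamardConj, Pauli.X, Pauli.Z]
  all_goals by_cases hi : i ∈ J <;> simp +contextual [Pauli.hadamardConj, Pauli.X, Pauli.Z, hi, hs]

theorem hadamardConj_Z {J : Finset (Fin n)} {j : Fin n} (h : j ∈ J) :
    (Pauli.Z j).hadamardConj J = Pauli.X j := by
  have hs : ∀ i ∉ J, i ≠ j := fun i hi e => hi (e ▸ h)
  ext i
  · simp [Pauli.hadamardConj, Pauli.X, Pauli.Z]
  all_goals by_cases hi : i ∈ J <;> simp +contextual [Pauli.hadamardConj, Pauli.X, Pauli.Z, hi, hs]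

theorem commute_X_Z {c t : Fin n} (h : c ≠ t) :
    Commute (Pauli.X c).toMatrix (Pauli.Z t).toMatrix := by
  rw [Commute, SemiconjBy, Pauli.toMatrix_mul_comm, Tableau.comm_Z]
  simp [Pauli.X, h.symm]

/-- `CX = (1 + Z_c + X_t - X_t Z_c)/2` is turned into the `CX` with exchanged roles by swapping `X`
and `Z`. -/
theorem hadamardLayer_mul_cx {J : Finset (Fin n)} {c t : Fin n} (hc : c ∈ J) (ht : t ∈ J)
    (hct : c ≠ t) :
    hadamardLayer J * (Gate.cx c t).toMatrix = (Gate.cx t c).toMatrix * hadamardLayer J := by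
  rw [Gate.toMatrix_cx, Gate.toMatrix_cx]
  have hX := hadamardLayer_mul_toMatrix J (Pauli.X t)
  have hZ := hadamardLayer_mul_toMatrix J (Pauli.Z c)
  rw [hadamardConj_X ht] at hX
  rw [hadamardConj_Z hc] at hZ
  simp only [mul_smul_comm, smul_mul_assoc, mul_add, mul_sub, add_mul, sub_mul, mul_one, one_mul,
    ← mul_assoc, hX]
  simp only [mul_assoc, hZ]
  rw [← mul_assoc, ← mul_assoc, ← (commute_X_Z hct).eq, add_right_comm]

end Hadamard

/-! ### Orbits of Pauli operators under circuits of controlled-`X` gates -/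

theorem zmod_two_ne_zero_iff {c : ZMod 2} : c ≠ 0 ↔ c = 1 := by
  revert c
  decide

theorem zmod_two_ne_one_iff {c : ZMod 2} : c ≠ 1 ↔ c = 0 := by
  revert c
  decide

theorem Circuit.conj_mul_self {n : ℕ} {w : Circuit n} (hw : ∀ g ∈ w, g.WellFormed) {P : Pauli n}
    (hP : P * P = 1) : w.conj P * w.conj P = 1 := by
  apply Pauli.toMatrix_injective
  have hm := Circuit.toMatrix_mem_phaseCSS hw
  have h1 := mul_conjTranspose_of_mem hm
  have h2 : (w.conj P).toMatrix = Tableau.conjHom hm P.toMatrix := by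
    change _ = w.toMatrix * P.toMatrix * w.toMatrix.conjTranspose
    rw [conj_spec hw, mul_assoc, h1, mul_one]
  rw [Pauli.toMatrix_mul, h2, ← map_mul, ← Pauli.toMatrix_mul, hP, Pauli.toMatrix_one, map_one]

namespace CSSCircuit

variable {n : ℕ}

/-- The common control `j` is never a target, so its bit `x j` and the `z` bits of the targets stay
constant along the circuit. The contributions just add up. -/
theorem conj_fanOut {j : Fin n} {L : List (Fin n)} (hj : j ∉ L) (P : Pauli n) :
    (toCircuit (L.map fun k => (j, k))).conj P =
      ⟨P.s, P.x + (L.map fun k => (Pi.single k (P.x j) : Fin n → ZMod 2)).sum,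
        P.z + Pi.single j (L.map P.z).sum⟩ := by
  induction L generalizing P with
  | nil => simp [toCircuit, Circuit.conj]
  | cons k L ih =>
    rw [List.mem_cons, not_or] at hj
    change (toCircuit (L.map fun k => (j, k))).conj ((Gate.cx j k).conj P) = _
    rw [ih hj.2]
    have hz : L.map (P.z + Pi.single j (P.z k)) = L.map P.z := by
      refine List.map_congr_left fun i hi => ?_
      have : i ≠ j := fun h => hj.2 (h ▸ hi)
      simp [this]
    simp only [Gate.conj, update_add_eq, hz, Pi.add_apply, Pi.single_eq_of_ne hj.1, add_zero,
      List.map_cons, List.sum_cons, Pi.single_add, add_assoc]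

theorem conj_fanIn {j : Fin n} {L : List (Fin n)} (hj : j ∉ L) (P : Pauli n) :
    (toCircuit (L.map fun k => (k, j))).conj P =
      ⟨P.s, P.x + Pi.single j (L.map P.x).sum,
        P.z + (L.map fun k => (Pi.single k (P.z j) : Fin n → ZMod 2)).sum⟩ := by
  induction L generalizing P with
  | nil => simp [toCircuit, Circuit.conj]
  | cons k L ih =>
    rw [List.mem_cons, not_or] at hj
    change (toCircuit (L.map fun k => (k, j))).conj ((Gate.cx k j).conj P) = _
    rw [ih hj.2]
    have hx : L.map (P.x + Pi.single j (P.x k)) = L.map P.x := by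
      refine List.map_congr_left fun i hi => ?_
      have : i ≠ j := fun h => hj.2 (h ▸ hi)
      simp [this]
    simp only [Gate.conj, update_add_eq, hx, Pi.add_apply, Pi.single_eq_of_ne hj.1, add_zero,
      List.map_cons, List.sum_cons, Pi.single_add, add_assoc]

theorem sum_map_filter_eq {M : Type*} [AddCommMonoid M] {L : List (Fin n)} (hL : L.Nodup)
    (hL' : ∀ j, j ∈ L) (w : Fin n → ZMod 2) (f : Fin n → M) :
    ((L.filter fun k => w k = 1).map f).sum = ∑ k, if w k = 1 then f k else 0 := by
  rw [← List.sum_toFinset _ (hL.filter _), ← Finset.sum_filter]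
  congr 1
  ext k
  simp [hL']

theorem sum_ite_single (w : Fin n → ZMod 2) (a : ZMod 2) :
    (∑ k, if w k = 1 then (Pi.single k a : Fin n → ZMod 2) else 0) = a • w := by
  conv_rhs => rw [← Finset.univ_sum_single w, Finset.smul_sum]
  refine Finset.sum_congr rfl fun k _ => ?_
  rcases zmod_two_eq_zero_or_one (w k) with h | h
  · simp [h]
  · rw [h, if_pos rfl, ← Pi.single_smul, smul_eq_mul, mul_one]

theorem sum_ite_eq (w v : Fin n → ZMod 2) : (∑ k, if w k = 1 then v k else 0) = ∑ k, w k * v k := by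
  refine Finset.sum_congr rfl fun k _ => ?_
  rcases zmod_two_eq_zero_or_one (w k) with h | h <;> simp [h]

theorem conj_ctrlZX {j : Fin n} {w : Fin n → ZMod 2} (hw : w j = 0) (P : Pauli n) :
    (ctrlZX j w).toCircuit.conj P =
      ⟨P.s, P.x + P.x j • w, P.z + Pi.single j (∑ k, w k * P.z k)⟩ := by
  rw [ctrlZX, conj_fanOut (by simp [hw]), sum_map_filter_eq (List.nodup_finRange n) (by simp),
    sum_map_filter_eq (List.nodup_finRange n) (by simp), sum_ite_single, sum_ite_eq]

theorem conj_ctrlXZ {j : Fin n} {w : Fin n → ZMod 2} (hw : w j = 0) (P : Pauli n) :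
    (ctrlXZ j w).toCircuit.conj P =
      ⟨P.s, P.x + Pi.single j (∑ k, w k * P.x k), P.z + P.z j • w⟩ := by
  rw [ctrlXZ, conj_fanIn (by simp [hw]), sum_map_filter_eq (List.nodup_finRange n) (by simp),
    sum_map_filter_eq (List.nodup_finRange n) (by simp), sum_ite_single, sum_ite_eq]

theorem toCircuit_append (v w : CSSCircuit n) : (v ++ w).toCircuit = v.toCircuit ++ w.toCircuit :=
  List.map_append

/-- All gates act on two different qubits in `S`. -/
def ActsOn (S : Finset (Fin n)) (w : CSSCircuit n) : Prop :=
  ∀ p ∈ w, p.1 ≠ p.2 ∧ p.1 ∈ S ∧ p.2 ∈ S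

theorem ActsOn.append {S : Finset (Fin n)} {v w : CSSCircuit n} (hv : v.ActsOn S)
    (hw : w.ActsOn S) : ActsOn S (v ++ w) := by
  intro p hp
  rcases List.mem_append.1 hp with h | h
  exacts [hv p h, hw p h]

theorem ActsOn.mono {S T : Finset (Fin n)} {w : CSSCircuit n} (hw : w.ActsOn S) (h : S ⊆ T) :
    w.ActsOn T :=
  fun p hp => ⟨(hw p hp).1, h (hw p hp).2.1, h (hw p hp).2.2⟩

theorem actsOn_ctrlZX {S : Finset (Fin n)} {j : Fin n} {w : Fin n → ZMod 2} (hw : w j = 0)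
    (hj : j ∈ S) (hS : ∀ k, w k = 1 → k ∈ S) : (ctrlZX j w).ActsOn S := by
  intro p hp
  simp only [ctrlZX, List.mem_map, List.mem_filter, List.mem_finRange, true_and,
    decide_eq_true_eq] at hp
  obtain ⟨k, hk, rfl⟩ := hp
  exact ⟨fun h : j = k => by simp [← h, hw] at hk, hj, hS k hk⟩

theorem actsOn_ctrlXZ {S : Finset (Fin n)} {j : Fin n} {w : Fin n → ZMod 2} (hw : w j = 0)
    (hj : j ∈ S) (hS : ∀ k, w k = 1 → k ∈ S) : (ctrlXZ j w).ActsOn S := by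
  intro p hp
  simp only [ctrlXZ, List.mem_map, List.mem_filter, List.mem_finRange, true_and,
    decide_eq_true_eq] at hp
  obtain ⟨k, hk, rfl⟩ := hp
  exact ⟨fun h : k = j => by simp [h, hw] at hk, hS k hk, hj⟩

theorem ActsOn.wellFormed {S : Finset (Fin n)} {w : CSSCircuit n} (hw : w.ActsOn S) :
    ∀ g ∈ w.toCircuit, g.WellFormed := by
  intro g hg
  obtain ⟨p, hp, rfl⟩ := List.mem_map.1 hg
  exact (hw p hp).1

theorem ActsOn.support_conj_subset {S : Finset (Fin n)} {w : CSSCircuit n} (hw : w.ActsOn S)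
    {P : Pauli n} (hP : P.support ⊆ S) : (w.toCircuit.conj P).support ⊆ S := by
  induction w generalizing P with
  | nil => exact hP
  | cons p w ih =>
    refine ih (fun q hq => hw q (List.mem_cons_of_mem _ hq)) fun i hi => ?_
    obtain ⟨-, h1, h2⟩ := hw p List.mem_cons_self
    rcases eq_or_ne i p.1 with rfl | h1'
    · exact h1
    rcases eq_or_ne i p.2 with rfl | h2'
    · exact h2
    apply hP
    simp only [Pauli.support, Finset.mem_filter, Finset.mem_univ, true_and] at hi ⊢
    simpa [Gate.conj, h1', h2'] using hi

end CSSCircuit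

section Orbit

open CSSCircuit

variable {n : ℕ}

/-- The bits `x`, `z` of one of the orbit representatives. -/
def IsRepBits (x z : Fin n → ZMod 2) : Prop :=
  (x = 0 ∧ z = 0) ∨
    (∃ j, (x = Pi.single j 1 ∧ z = 0) ∨ (x = Pi.single j 1 ∧ z = Pi.single j 1) ∨
      (x = 0 ∧ z = Pi.single j 1)) ∨
    ∃ j k, j ≠ k ∧ x = Pi.single j 1 + Pi.single k 1 ∧ z = Pi.single j 1 + Pi.single k 1

theorem Y_mul_self (j : Fin n) : Pauli.Y j * Pauli.Y j = 1 := by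
  rw [Pauli.mul_self_eq_one_iff]
  rw [Finset.sum_eq_single j]
  · simp only [Pauli.Y, Pi.single_eq_same]
    decide
  · intro i _ h
    simp [Pauli.Y, h]
  · simp

theorem X_mul_self (j : Fin n) : Pauli.X j * Pauli.X j = 1 := by
  rw [Pauli.mul_self_eq_one_iff]
  simp [Pauli.X]

theorem Z_mul_self (j : Fin n) : Pauli.Z j * Pauli.Z j = 1 := by
  rw [Pauli.mul_self_eq_one_iff]
  simp [Pauli.Z]

theorem YY_mul_self {j k : Fin n} (h : j ≠ k) :
    (Pauli.Y j * Pauli.Y k) * (Pauli.Y j * Pauli.Y k) = 1 := by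
  have hc : Pauli.Y j * Pauli.Y k = Pauli.Y k * Pauli.Y j := by
    have hx := h.symm
    ext
    · simp only [Pauli.mul_s, Pauli.Y]
      rw [Finset.sum_eq_zero, Finset.sum_eq_zero]
      · intro i _
        rcases eq_or_ne i j with rfl | h'
        · simp [h]
        · simp [h']
      · intro i _
        rcases eq_or_ne i j with rfl | h'
        · simp [h]
        · simp [h']
    · simp [add_comm]
    · simp [add_comm]
  nth_rw 2 [hc]
  rw [mul_assoc, ← mul_assoc (Pauli.Y k), Y_mul_self, one_mul, Y_mul_self]

theorem IsRepBits.isOrbitRep {P : Pauli n} (h : IsRepBits P.x P.z) (hP : P * P = 1) :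
    P.IsOrbitRep := by
  rcases h with ⟨hx, hz⟩ | ⟨j, ⟨hx, hz⟩ | ⟨hx, hz⟩ | ⟨hx, hz⟩⟩ | ⟨j, k, hjk, hx, hz⟩
  · exact ⟨1, Pauli.eq_or_eq_neg hP (one_mul 1) hx hz, Or.inl rfl⟩
  · exact ⟨_, Pauli.eq_or_eq_neg hP (X_mul_self j) hx hz, Or.inr (Or.inl ⟨j, Or.inl rfl⟩)⟩
  · exact ⟨_, Pauli.eq_or_eq_neg hP (Y_mul_self j) hx hz, Or.inr (Or.inl ⟨j, Or.inr (Or.inl rfl)⟩)⟩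
  · exact ⟨_, Pauli.eq_or_eq_neg hP (Z_mul_self j) hx hz, Or.inr (Or.inl ⟨j, Or.inr (Or.inr rfl)⟩)⟩
  · exact ⟨_, Pauli.eq_or_eq_neg hP (YY_mul_self hjk) hx hz, Or.inr (Or.inr ⟨j, k, hjk, rfl⟩)⟩

theorem sum_add_single_mul {w v : Fin n → ZMod 2} {j : Fin n} :
    ∑ k, (w + Pi.single j 1 : Fin n → ZMod 2) k * v k = ∑ k, w k * v k + v j := by
  simp only [Pi.add_apply, add_mul, Finset.sum_add_distrib]
  congr 1
  rw [Finset.sum_eq_single j] <;> simp +contextual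

theorem sum_mul_single {w : Fin n → ZMod 2} {j : Fin n} :
    ∑ k, w k * (Pi.single j 1 : Fin n → ZMod 2) k = w j := by
  rw [Finset.sum_eq_single j] <;> simp +contextual

theorem bits_add_add_self (x y : Fin n → ZMod 2) : x + (x + y) = y := by
  rw [← add_assoc, bits_add_self, zero_add]

theorem filter_eq_nil_imp {qs : List (Fin n)} (hqs : ∀ j, j ∈ qs) {p : Fin n → Prop}
    [DecidablePred p] (h : qs.filter (fun j => p j) = []) (j : Fin n) : ¬p j := by
  have := List.filter_eq_nil_iff.1 h j (hqs j)
  simpa using this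

theorem of_filter_eq_cons {qs : List (Fin n)} {p : Fin n → Prop}
    [DecidablePred p] {j : Fin n} {l : List (Fin n)} (h : qs.filter (fun j => p j) = j :: l) :
    p j := by
  have : j ∈ qs.filter (fun j => p j) := h ▸ List.mem_cons_self
  simpa using (List.mem_filter.1 this).2

/-- `Λ(Z_j, X^w)` adds `x_j w` to `x` and `⟨w, z⟩` to the bit `z_j`; `Λ(X_j, Z^w)` does the same
with `x` and `z` exchanged. Choosing `w = x + e_j` (or `x + e_j + e_k`) with `x_j = 1` sweeps `x`
into `e_j` (or `e_j + e_k`). The side effect on `z` is governed by `⟨x, z⟩` and makes the second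
sweep end in `Y_j` for odd parity and in `Y_j Y_k` for even parity. For disjoint supports the first
sweep deliberately leaves the qubit carrying `z_k = 1` in `x`, so that an overlap exists. -/
theorem cssOrbit_spec {qs : List (Fin n)} (hn : qs.Nodup) (hqs : ∀ j, j ∈ qs) (P : Pauli n) :
    (cssOrbit qs P).ActsOn P.support ∧
      IsRepBits ((cssOrbit qs P).toCircuit.conj P).x ((cssOrbit qs P).toCircuit.conj P).z := by
  have hSx : ∀ k, P.x k = 1 → k ∈ P.support := fun k hk => by simp [Pauli.support, hk]
  have hSz : ∀ k, P.z k = 1 → k ∈ P.support := fun k hk => by simp [Pauli.support, hk]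
  have h11 : (1 + 1 : ZMod 2) = 0 := rfl
  have hadd {v : Fin n → ZMod 2} {j k : Fin n} {S : Finset (Fin n)} (hS : ∀ k, v k = 1 → k ∈ S)
      (hj : j ∈ S) (hk : (v + Pi.single j 1 : Fin n → ZMod 2) k = 1) : k ∈ S := by
    rcases eq_or_ne k j with rfl | h
    · exact hj
    · exact hS k (by simpa [h] using hk)
  simp only [cssOrbit]
  split
  · rename_i hx hz
    have hx0 : P.x = 0 := funext fun j => zmod_two_ne_one_iff.1 (filter_eq_nil_imp hqs hx j)
    have hz0 : P.z = 0 := funext fun j => zmod_two_ne_one_iff.1 (filter_eq_nil_imp hqs hz j)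
    exact ⟨fun p hp => by simp at hp, Or.inl ⟨hx0, hz0⟩⟩
  · rename_i j _ hx hz
    have hx0 : P.x = 0 := funext fun j => zmod_two_ne_one_iff.1 (filter_eq_nil_imp hqs hx j)
    have hj := of_filter_eq_cons hz
    have hw : (P.z + Pi.single j 1 : Fin n → ZMod 2) j = 0 := by simp [hj, h11]
    refine ⟨actsOn_ctrlXZ hw (hSz j hj) fun k => hadd hSz (hSz j hj), ?_⟩
    rw [conj_ctrlXZ hw]
    refine Or.inr (Or.inl ⟨j, Or.inr (Or.inr ⟨?_, ?_⟩)⟩)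
    · simp [hx0]
    · simp [hj, bits_add_add_self]
  · rename_i j _ hx hz
    have hz0 : P.z = 0 := funext fun j => zmod_two_ne_one_iff.1 (filter_eq_nil_imp hqs hz j)
    have hj := of_filter_eq_cons hx
    have hw : (P.x + Pi.single j 1 : Fin n → ZMod 2) j = 0 := by simp [hj, h11]
    refine ⟨actsOn_ctrlZX hw (hSx j hj) fun k => hadd hSx (hSx j hj), ?_⟩
    rw [conj_ctrlZX hw]
    refine Or.inr (Or.inl ⟨j, Or.inl ⟨?_, ?_⟩⟩)
    · simp [hj, bits_add_add_self]
    · simp [hz0]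
  · rename_i a _ b _ hx hz
    have ha := of_filter_eq_cons hx
    have hb := of_filter_eq_cons hz
    split
    · rename_i hboth
      have hdisj : ∀ i, ¬(P.x i = 1 ∧ P.z i = 1) := filter_eq_nil_imp hqs hboth
      have hza : P.z a = 0 := zmod_two_ne_one_iff.1 fun h => hdisj a ⟨ha, h⟩
      have hxb : P.x b = 0 := zmod_two_ne_one_iff.1 fun h => hdisj b ⟨h, hb⟩
      have hab : a ≠ b := by
        rintro rfl
        exact hdisj a ⟨ha, hb⟩
      have hxz : ∑ k, P.x k * P.z k = 0 := by
        refine Finset.sum_eq_zero fun k _ => ?_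
        rcases zmod_two_eq_zero_or_one (P.x k) with h | h
        · rw [h, zero_mul]
        · rw [zmod_two_ne_one_iff.1 fun h' => hdisj k ⟨h, h'⟩, mul_zero]
      have hw1 : (P.x + Pi.single a 1 + Pi.single b 1 : Fin n → ZMod 2) a = 0 := by
        simp [ha, hab, h11]
      have hw2 : (P.z + Pi.single b 1 : Fin n → ZMod 2) b = 0 := by simp [hb, h11]
      refine ⟨(actsOn_ctrlZX hw1 (hSx a ha) fun k => hadd (fun k => hadd hSx (hSx a ha))
        (hSz b hb)).append (actsOn_ctrlXZ hw2 (hSz b hb) fun k => hadd hSz (hSz b hb)), ?_⟩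
      have hx1 : P.x + P.x a • (P.x + Pi.single a 1 + Pi.single b 1) =
          Pi.single a 1 + Pi.single b 1 := by
        rw [ha, one_smul, add_assoc, bits_add_add_self]
      have hz1 : P.z + Pi.single a (∑ k,
          (P.x + Pi.single a 1 + Pi.single b 1 : Fin n → ZMod 2) k * P.z k) =
          P.z + Pi.single a 1 := by
        rw [sum_add_single_mul, sum_add_single_mul, hxz, hza, hb, zero_add, zero_add]
      rw [toCircuit_append, Circuit.conj_append, conj_ctrlZX hw1, hx1, hz1, conj_ctrlXZ hw2]
      refine Or.inr (Or.inr ⟨a, b, hab, ?_, ?_⟩)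
      · simp only
        rw [sum_add_single_mul]
        simp only [Pi.add_apply, mul_add, Finset.sum_add_distrib, sum_mul_single]
        simp [hza, hb, hab, h11]
      · simp only
        have : (P.z + Pi.single a 1 : Fin n → ZMod 2) b = 1 := by simp [hb, hab.symm]
        rw [this, one_smul, add_right_comm, bits_add_add_self, add_comm]
    · rename_i j l hboth
      obtain ⟨hxj, hzj⟩ := of_filter_eq_cons (p := fun j => P.x j = 1 ∧ P.z j = 1) hboth
      have hw1 : (P.x + Pi.single j 1 : Fin n → ZMod 2) j = 0 := by simp [hxj, h11]
      have hx1 : P.x + P.x j • (P.x + Pi.single j 1) = Pi.single j 1 := by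
        rw [hxj, one_smul, bits_add_add_self]
      split
      · rename_i hodd
        have hodd' : ∑ k, P.x k * P.z k = 1 := by simpa only [mul_comm] using hodd
        have hw2 : (P.z + Pi.single j 1 : Fin n → ZMod 2) j = 0 := by simp [hzj, h11]
        refine ⟨(actsOn_ctrlZX hw1 (hSx j hxj) fun k => hadd hSx (hSx j hxj)).append
          (actsOn_ctrlXZ hw2 (hSx j hxj) fun k => hadd hSz (hSx j hxj)), ?_⟩
        have hz1 : P.z + Pi.single j (∑ k, (P.x + Pi.single j 1 : Fin n → ZMod 2) k * P.z k) =
            P.z := by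
          rw [sum_add_single_mul, hodd', hzj, h11, Pi.single_zero, add_zero]
        rw [toCircuit_append, Circuit.conj_append, conj_ctrlZX hw1, hx1, hz1, conj_ctrlXZ hw2]
        refine Or.inr (Or.inl ⟨j, Or.inr (Or.inl ⟨?_, ?_⟩)⟩)
        · simp only
          rw [sum_mul_single, hw2, Pi.single_zero, add_zero]
        · simp only
          rw [hzj, one_smul, bits_add_add_self]
      · rename_i heven
        have hxz : ∑ k, P.x k * P.z k = 0 := by
          simpa only [mul_comm] using zmod_two_ne_one_iff.1 heven
        split
        -- A single common index would make `⟨x, z⟩` odd, so for even parity a second one exists.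
        · exfalso
          apply heven
          rw [Finset.sum_eq_single j]
          · rw [hxj, hzj, one_mul]
          · intro i _ hi
            have : ¬(P.x i = 1 ∧ P.z i = 1) := by
              intro h
              have hm : i ∈ qs.filter fun j => P.x j = 1 ∧ P.z j = 1 :=
                List.mem_filter.2 ⟨hqs i, by simpa using h⟩
              rw [hboth] at hm
              exact hi (by simpa using hm)
            rcases zmod_two_eq_zero_or_one (P.x i) with h | h
            · rw [h, mul_zero]
            · rw [zmod_two_ne_one_iff.1 fun h' => this ⟨h, h'⟩, zero_mul]
          · simp
        · rename_i k l'
          have hjk : j ≠ k := by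
            have := hn.filter fun j => P.x j = 1 ∧ P.z j = 1
            rw [hboth] at this
            simp only [List.nodup_cons, List.mem_cons, not_or] at this
            exact this.1.1
          obtain ⟨hxk, hzk⟩ : P.x k = 1 ∧ P.z k = 1 := by
            have : k ∈ qs.filter fun j => P.x j = 1 ∧ P.z j = 1 := by
              rw [hboth]
              simp
            simpa using (List.mem_filter.1 this).2
          have hw2 : (P.z + Pi.single k 1 : Fin n → ZMod 2) k = 0 := by simp [hzk, h11]
          refine ⟨(actsOn_ctrlZX hw1 (hSx j hxj) fun k => hadd hSx (hSx j hxj)).append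
            (actsOn_ctrlXZ hw2 (hSx k hxk) fun i => hadd hSz (hSx k hxk)), ?_⟩
          have hz1 : P.z + Pi.single j (∑ k, (P.x + Pi.single j 1 : Fin n → ZMod 2) k * P.z k) =
              P.z + Pi.single j 1 := by
            rw [sum_add_single_mul, hxz, hzj, zero_add]
          rw [toCircuit_append, Circuit.conj_append, conj_ctrlZX hw1, hx1, hz1, conj_ctrlXZ hw2]
          refine Or.inr (Or.inr ⟨j, k, hjk, ?_, ?_⟩)
          · simp only
            rw [sum_mul_single]
            simp [hzj, hjk]
          · simp only
            have : (P.z + Pi.single j 1 : Fin n → ZMod 2) k = 1 := by simp [hzk, hjk.symm]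
            rw [this, one_smul, add_right_comm, bits_add_add_self, add_comm]

end Orbit

/-! ### Basis states encoded by natural numbers -/

section Code

variable {n : ℕ}

/-- The bit vector given by the binary digits of a natural number. -/
def bits (n m : ℕ) : Fin n → ZMod 2 := fun j => if m.testBit j then 1 else 0

/-- The natural number with the given binary digits. -/
def code (x : Fin n → ZMod 2) : ℕ := Nat.ofBits fun j => decide (x j = 1)

theorem code_lt (x : Fin n → ZMod 2) : code x < 2 ^ n := Nat.ofBits_lt_two_pow _

theorem testBit_code (x : Fin n → ZMod 2) (j : Fin n) : (code x).testBit j = decide (x j = 1) :=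
  Nat.testBit_ofBits_lt _ _ j.isLt

theorem bits_code (x : Fin n → ZMod 2) : bits n (code x) = x := by
  funext j
  rcases zmod_two_eq_zero_or_one (x j) with h | h <;> simp [bits, testBit_code, h]

theorem val_bits (m : ℕ) (j : Fin n) : (bits n m j).val = (m.testBit j).toNat := by
  have v1 : (1 : ZMod 2).val = 1 := rfl
  cases h : m.testBit j <;> simp [bits, h, v1]

theorem bits_xor (a b : ℕ) : bits n (a ^^^ b) = bits n a + bits n b := by
  have h11 : (1 + 1 : ZMod 2) = 0 := rfl
  funext j
  cases ha : a.testBit j <;> cases hb : b.testBit j <;> simp [bits, ha, hb, h11]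

theorem bits_two_pow (t : Fin n) : bits n (2 ^ (t : ℕ)) = Pi.single t 1 := by
  funext j
  rcases eq_or_ne j t with rfl | h
  · simp [bits]
  · have : (t : ℕ) ≠ j := fun e => h (Fin.ext e.symm)
    simp [bits, h, this]

theorem bits_eq_iff {a b : ℕ} (ha : a < 2 ^ n) (hb : b < 2 ^ n) : bits n a = bits n b ↔ a = b := by
  refine ⟨fun h => Nat.eq_of_testBit_eq fun i => ?_, fun h => h ▸ rfl⟩
  by_cases hi : i < n
  · have := congrArg ZMod.val (congrFun h ⟨i, hi⟩)
    rw [val_bits, val_bits] at this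
    revert this
    cases a.testBit i <;> cases b.testBit i <;> simp
  · have hp : 2 ^ n ≤ 2 ^ i := Nat.pow_le_pow_right (by norm_num) (not_lt.1 hi)
    rw [Nat.testBit_lt_two_pow (ha.trans_le hp), Nat.testBit_lt_two_pow (hb.trans_le hp)]

/-- The number of ones among the first `n` binary digits. -/
def popcount (n m : ℕ) : ℕ := ∑ j : Fin n, (m.testBit j).toNat

theorem sgn_bits (z r : ℕ) : sgn (bits n z) (bits n r) = (-1) ^ popcount n (z &&& r) := by
  rw [popcount, ← Finset.prod_pow_eq_pow_sum, sgn]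
  refine Finset.prod_congr rfl fun j _ => ?_
  rw [val_bits, val_bits, Nat.testBit_and]
  cases z.testBit j <;> cases r.testBit j <;> rfl

/-- Or-ing with the mask `h` of `J` erases the digits on `J`, so the condition says that row and
column agree off `J`; the remaining factors all come from `J`. -/
theorem hadamardLayer_bits {J : Finset (Fin n)} {a r h : ℕ} (ha : a < 2 ^ n) (hr : r < 2 ^ n)
    (hh : h < 2 ^ n) (hJ : ∀ j : Fin n, h.testBit j = decide (j ∈ J)) :
    hadamardLayer J (bits n a) (bits n r) = if a ||| h = r ||| h then
      (omega * ((√2 : ℝ) : ℂ)⁻¹) ^ popcount n h * (-1) ^ popcount n (a &&& r &&& h) else 0 := by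
  have hiff : a ||| h = r ||| h ↔ ∀ j : Fin n, j ∉ J → bits n a j = bits n r j := by
    rw [← bits_eq_iff (Nat.or_lt_two_pow ha hh) (Nat.or_lt_two_pow hr hh), funext_iff]
    refine forall_congr' fun j => ?_
    by_cases hj : j ∈ J
    · simp [bits, hJ, hj]
    · simp [bits, hJ, hj]
  rw [hadamardLayer]
  split_ifs with hc
  · rw [hiff] at hc
    rw [popcount, popcount, ← Finset.prod_pow_eq_pow_sum, ← Finset.prod_pow_eq_pow_sum,
      ← Finset.prod_mul_distrib]
    refine Finset.prod_congr rfl fun j _ => ?_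
    by_cases hj : j ∈ J
    · rw [if_pos hj, val_bits, val_bits, Nat.testBit_and, Nat.testBit_and, hJ]
      simp only [hj, decide_true, Bool.toNat_true, pow_one, Bool.and_true]
      cases a.testBit j <;> cases r.testBit j <;> rfl
    · rw [if_neg hj, if_pos (hc j hj), Nat.testBit_and, hJ]
      simp [hj]
  · rw [hiff] at hc
    push Not at hc
    obtain ⟨j, hj, hne⟩ := hc
    exact Finset.prod_eq_zero (Finset.mem_univ j) (by rw [if_neg hj, if_neg hne])

namespace Gate

/-- `Gate.perm` on encoded basis states. -/
def permCode : Gate n → ℕ → ℕ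
  | s _, m => m
  | cz _ _, m => m
  | cx c t, m => if m.testBit c then m ^^^ 2 ^ (t : ℕ) else m

/-- `Gate.phase` on encoded basis states. -/
def phaseCode : Gate n → ℕ → ℕ
  | s j, m => (m.testBit j).toNat
  | cz j k, m => 2 * ((m.testBit j).toNat * (m.testBit k).toNat)
  | cx _ _, _ => 0

/-- Boolean test of `Gate.WellFormed`. -/
def wellFormedCode : Gate n → Bool
  | s _ => true
  | cz j k => j != k
  | cx c t => c != t

theorem wellFormed_of_code {g : Gate n} (h : g.wellFormedCode = true) : g.WellFormed := by
  cases g with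
  | s j => trivial
  | cz j k => exact bne_iff_ne.1 h
  | cx c t => exact bne_iff_ne.1 h

theorem permCode_lt (g : Gate n) {m : ℕ} (hm : m < 2 ^ n) : g.permCode m < 2 ^ n := by
  cases g with
  | s j => exact hm
  | cz j k => exact hm
  | cx c t =>
    rw [permCode]
    split_ifs
    · exact Nat.xor_lt_two_pow hm (Nat.pow_lt_pow_right (by norm_num) t.isLt)
    · exact hm

/-- This transfers the simulation on natural numbers, which the kernel can evaluate, to the actual
action on basis states. -/
theorem bits_permCode (g : Gate n) (m : ℕ) : bits n (g.permCode m) = g.perm (bits n m) := by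
  cases g with
  | s j => rfl
  | cz j k => rfl
  | cx c t =>
    simp only [permCode, perm]
    cases h : m.testBit c
    · simp [show bits n m c = 0 by simp [bits, h]]
    · simp [show bits n m c = 1 by simp [bits, h], bits_xor, bits_two_pow]

theorem phaseCode_eq (g : Gate n) (m : ℕ) : g.phaseCode m = g.phase (bits n m) := by
  cases g <;> simp only [phaseCode, phase, val_bits]

end Gate

namespace Circuit

/-- The action of a circuit on encoded basis states. -/
def permCode : Circuit n → ℕ → ℕ
  | [], m => m
  | g :: w, m => permCode w (g.permCode m)

/-- The exponent of `i` in the phase which a circuit applies to an encoded basis state. -/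
def phaseCode : Circuit n → ℕ → ℕ
  | [], _ => 0
  | g :: w, m => phaseCode w (g.permCode m) + g.phaseCode m

theorem permCode_lt (w : Circuit n) {m : ℕ} (hm : m < 2 ^ n) : w.permCode m < 2 ^ n := by
  induction w generalizing m with
  | nil => exact hm
  | cons g w ih => exact ih (g.permCode_lt hm)

/-- A circuit is a monomial matrix, computed by `permCode` and `phaseCode`. -/
theorem exists_monomial {w : Circuit n} (hw : ∀ g ∈ w, g.WellFormed) :
    ∃ π φ, w.toMatrix = monomial π φ ∧ Function.Injective π ∧
      ∀ m, π (bits n m) = bits n (w.permCode m) ∧ φ (bits n m) = Complex.I ^ w.phaseCode m := by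
  induction w with
  | nil => exact ⟨id, fun _ => 1, monomial_id.symm, Function.injective_id, fun m => ⟨rfl, rfl⟩⟩
  | cons g w ih =>
    rw [List.forall_mem_cons] at hw
    obtain ⟨π, φ, h1, h2, h3⟩ := ih hw.2
    refine ⟨π ∘ g.perm, fun r => φ (g.perm r) * Complex.I ^ g.phase r, ?_,
      h2.comp (Gate.perm_injective hw.1), fun m => ⟨?_, ?_⟩⟩
    · rw [toMatrix, h1, Gate.toMatrix_eq_monomial, monomial_mul_monomial]
    · rw [Function.comp, ← Gate.bits_permCode, (h3 _).1, permCode]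
    · simp only
      rw [← Gate.bits_permCode, (h3 _).2, ← Gate.phaseCode_eq, ← pow_add, phaseCode]

end Circuit

end Code

/-! ### Verification of the table -/

/-- `popcount 4`. -/
def popcountFour (m : ℕ) : ℕ :=
  (m.testBit 0).toNat + (m.testBit 1).toNat + (m.testBit 2).toNat + (m.testBit 3).toNat

theorem popcount_four (m : ℕ) : popcount 4 m = popcountFour m := by
  simp [popcount, popcountFour, Fin.sum_univ_four]

/-- Test of `√2 ^ q * (b₁ ω ^ d₁ + b₂ ω ^ d₂) = √2 ^ p * b₃ ω ^ d₃`. -/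
def sumCheck (p q : ℕ) (b₁ b₂ b₃ : Bool) (d₁ d₂ d₃ : ℕ) : Bool :=
  match b₁, b₂ with
  | false, false => !b₃
  | true, false => b₃ && (d₁ % 8 == d₃ % 8 && q == p)
  | false, true => b₃ && (d₂ % 8 == d₃ % 8 && q == p)
  | true, true =>
    -- `d₂ + 7 d₁` is `d₂ - d₁` modulo 8. Difference 4 cancels, difference 0 doubles (a factor
    -- `√2²`), and differences `±2` use `1 + ω^{±2} = √2 ω^{±1}`. Odd differences are rejected.
    if (d₂ + 7 * d₁) % 8 == 4 then !b₃
    else b₃ && (if (d₂ + 7 * d₁) % 8 == 0 then d₁ % 8 == d₃ % 8 && q + 2 == p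
      else if (d₂ + 7 * d₁) % 8 == 2 then (d₁ + 1) % 8 == d₃ % 8 && q + 1 == p
      else (d₂ + 7 * d₁) % 8 == 6 && ((d₁ + 7) % 8 == d₃ % 8 && q + 1 == p))

theorem omega_pow_eight : omega ^ 8 = 1 := by
  rw [show 8 = 4 * 2 from rfl, pow_mul, omega_pow_four]
  norm_num

theorem omega_pow_congr {a b : ℕ} (h : a % 8 = b % 8) : omega ^ a = omega ^ b := by
  rw [pow_eq_pow_mod a omega_pow_eight, h, ← pow_eq_pow_mod b omega_pow_eight]

theorem one_add_omega_sq : 1 + omega ^ 2 = omega * ((√2 : ℝ) : ℂ) := by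
  rw [omega_sq, omega_eq]
  field_simp [sqrt_two_ne_zero]

theorem omega_pow_add_of_mod {d₁ d₂ k : ℕ} (h : (d₂ + 7 * d₁) % 8 = k) :
    omega ^ d₂ = omega ^ d₁ * omega ^ k := by
  rw [← pow_add]
  apply omega_pow_congr
  omega

theorem eq_of_sumCheck {p q : ℕ} {b₁ b₂ b₃ : Bool} {d₁ d₂ d₃ : ℕ}
    (h : sumCheck p q b₁ b₂ b₃ d₁ d₂ d₃ = true) :
    ((√2 : ℝ) : ℂ) ^ q * ((if b₁ then omega ^ d₁ else 0) + (if b₂ then omega ^ d₂ else 0)) =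
      ((√2 : ℝ) : ℂ) ^ p * (if b₃ then omega ^ d₃ else 0) := by
  unfold sumCheck at h
  split at h
  · simp at h
    simp [h]
  · simp only [Bool.and_eq_true, beq_iff_eq] at h
    simp [h.1, h.2.2, omega_pow_congr h.2.1]
  · simp only [Bool.and_eq_true, beq_iff_eq] at h
    simp [h.1, h.2.2, omega_pow_congr h.2.1]
  · simp only [if_true]
    split_ifs at h with h1 h2 h3
    · rw [beq_iff_eq] at h1
      rw [omega_pow_add_of_mod h1, omega_pow_four]
      simp at h
      simp [h]
    · simp only [Bool.and_eq_true, beq_iff_eq] at h h2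
      rw [omega_pow_add_of_mod h2, if_pos h.1, ← omega_pow_congr h.2.1, ← h.2.2, pow_add,
        sqrt_two_sq]
      ring
    · simp only [Bool.and_eq_true, beq_iff_eq] at h h3
      rw [omega_pow_add_of_mod h3, if_pos h.1, ← omega_pow_congr h.2.1, ← h.2.2, pow_add, pow_add]
      linear_combination ((√2 : ℝ) : ℂ) ^ q * omega ^ d₁ * one_add_omega_sq
    · simp only [Bool.and_eq_true, beq_iff_eq] at h
      rw [omega_pow_add_of_mod h.2.1, if_pos h.1, ← omega_pow_congr h.2.2.1, ← h.2.2.2, pow_add,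
        pow_add]
      linear_combination ((√2 : ℝ) : ℂ) ^ q * omega ^ d₁ * (omega ^ 6 * one_add_omega_sq -
        omega_pow_eight)

namespace TableEntry

/-- Test of one matrix entry of the decomposition; the masks `h`, `k` encode the sets of qubits with
Hadamard gates, the other masks the bits of `Q` and `P`. -/
def entryCheck (e : TableEntry) (h k xQ zQ xP zP c r : ℕ) : Bool :=
  let a := e.U.permCode c
  let r' := r ^^^ xQ
  let v := e.V.permCode r
  let b := v ^^^ xP
  -- Each Hadamard gate contributes `ω/√2`, a sign is `ω⁴` and `i` is `ω²`. The `+ 1` is the `1/√2`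
  -- in `e^{iπQ/4} = (1 + iQ)/√2`, whose two summands are the two terms on the left.
  sumCheck (popcountFour h + 1) (popcountFour k)
    (a ||| h == r ||| h) (a ||| h == r' ||| h) (c ||| k == b ||| k)
    (popcountFour h + 4 * popcountFour (a &&& r &&& h))
    (popcountFour h + 4 * popcountFour (a &&& r' &&& h) +
      2 * (1 + e.Q.s.val + 2 * popcountFour (zQ &&& r)))
    (e.m.val + popcountFour k + 4 * popcountFour (c &&& b &&& k) +
      2 * (e.U.phaseCode c + (e.P.s.val + 2 * popcountFour (zP &&& v) + e.V.phaseCode r)))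

/-- Test of a table entry. -/
def check (e : TableEntry) : Bool :=
  decide (2 * e.Q.s = 2 * ∑ j, ((e.Q.x j).val * (e.Q.z j).val : ℕ)) &&
    (e.U.all Gate.wellFormedCode && (e.V.all Gate.wellFormedCode &&
    (List.range 16).all fun c => (List.range 16).all fun r =>
      e.entryCheck (code fun j => if j ∈ e.Q.support ∩ {2, 3} then 1 else 0)
        (code fun j => if j ∈ e.H then 1 else 0) (code e.Q.x) (code e.Q.z) (code e.P.x)
        (code e.P.z) c r))

/-- All factors except the Hadamard layers and `1 + iQ` are monomial. An entry thus involves two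
entries of the layer `U'` and one of `U'_H`, times powers of `i`. -/
theorem correct_of_check {e : TableEntry} (he : e.check = true) : e.Correct := by
  simp only [check, Bool.and_eq_true, decide_eq_true_eq, List.all_eq_true, List.mem_range] at he
  obtain ⟨hQ, hU, hV, hc⟩ := he
  replace hU := fun g hg => Gate.wellFormed_of_code (hU g hg)
  replace hV := fun g hg => Gate.wellFormed_of_code (hV g hg)
  refine ⟨hU, hV, ?_⟩
  rw [← Pauli.mul_self_eq_one_iff] at hQ
  obtain ⟨π, φ, hU1, hU2, hU3⟩ := Circuit.exists_monomial hU
  obtain ⟨ρ, ψ, hV1, -, hV3⟩ := Circuit.exists_monomial hV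
  have hmask : ∀ (J : Finset (Fin 4)) (j : Fin 4),
      (code fun j => if j ∈ J then 1 else 0).testBit j = decide (j ∈ J) := by
    intro J j
    rw [testBit_code]
    by_cases hj : j ∈ J <;> simp [hj]
  set J := e.Q.support ∩ {2, 3} with hJ
  have hh := hmask J
  have hk := hmask e.H
  have hh' := code_lt fun j => if j ∈ J then 1 else 0
  have hk' := code_lt fun j => if j ∈ e.H then 1 else 0
  generalize (code fun j => if j ∈ J then 1 else 0) = h at *
  generalize (code fun j => if j ∈ e.H then 1 else 0) = k at *
  rw [pauliExp_eq hQ, hU1, hV1, mul_assoc, mul_assoc, Pauli.toMatrix_eq_monomial e.P,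
    monomial_mul_monomial, mul_smul_comm, mul_add, mul_one, mul_smul_comm,
    Pauli.toMatrix_eq_monomial e.Q]
  ext a r
  -- Indexing rows by their preimage under the permutation of `U` removes `U` from the right-hand
  -- side up to a phase.
  obtain ⟨c, rfl⟩ : ∃ c, a = π c :=
    ((Finite.injective_iff_surjective.1 hU2) a).imp fun _ h => h.symm
  have hs := hc (code c) (code_lt c) (code r) (code_lt r)
  rw [← bits_code c, ← bits_code r, (hU3 _).1]
  rw [Matrix.smul_apply, Matrix.smul_apply, Matrix.add_apply, Matrix.smul_apply, mul_monomial_apply,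
    ← (hU3 _).1, monomial_mul_apply hU2, mul_monomial_apply, (hU3 _).1, (hU3 _).2]
  simp only [Function.comp]
  rw [(hV3 _).1, (hV3 _).2, ← bits_code e.Q.x, ← bits_code e.P.x, ← bits_code e.Q.z,
    ← bits_code e.P.z, ← bits_xor, ← bits_xor, sgn_bits, sgn_bits]
  have hm := code_lt c
  have hm' := code_lt r
  have hxQ := code_lt e.Q.x
  have hxP := code_lt e.P.x
  generalize code c = c at *
  generalize code r = r at *
  rw [hadamardLayer_bits (e.U.permCode_lt hm) hm' hh' hh,
    hadamardLayer_bits (e.U.permCode_lt hm) (Nat.xor_lt_two_pow hm' hxQ) hh' hh,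
    hadamardLayer_bits hm (Nat.xor_lt_two_pow (e.V.permCode_lt hm') hxP) hk' hk]
  simp only [popcount_four]
  have key := eq_of_sumCheck hs
  simp only [beq_iff_eq, pow_add omega, pow_mul omega, omega_sq, omega_pow_four] at key
  have h2 := sqrt_two_ne_zero
  simp only [smul_eq_mul, mul_pow, inv_pow, pow_add Complex.I, pow_mul Complex.I 2, Complex.I_sq,
    pow_one] at key ⊢
  -- This power of `√2` clears the denominators of both sides.
  rw [← mul_right_inj' (pow_ne_zero (popcountFour h + 1 + popcountFour k) h2)]
  have hite (p : Prop) [Decidable p] (i : ℕ) :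
      (if p then omega ^ i else 0) = (if p then 1 else 0) * omega ^ i := (boole_mul _ _).symm
  have hA := pow_ne_zero (popcountFour h) h2
  have hB := pow_ne_zero (popcountFour k) h2
  simp only [← ite_zero_mul, hite, pow_add, pow_one] at key ⊢
  generalize ((√2 : ℝ) : ℂ) ^ popcountFour h = A at *
  generalize ((√2 : ℝ) : ℂ) ^ popcountFour k = B at *
  generalize ((√2 : ℝ) : ℂ) = D at *
  field_simp
  linear_combination key

end TableEntry

-- A kernel computation over 48 rows with 256 matrix entries each.
set_option maxRecDepth 100000 in
theorem bruhatTable_check : bruhatTable.all TableEntry.check = true := by decide +kernel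

theorem bruhatTable_correct {e : TableEntry} (he : e ∈ bruhatTable) : e.Correct :=
  TableEntry.correct_of_check (List.all_eq_true.1 bruhatTable_check e he)

/-! ### Embedding of operators on `k` qubits into operators on `n` qubits -/

section Embed

variable {k n : ℕ}

/-- The operator on `n` qubits which acts as `M` on the qubits `f 0, …, f (k - 1)`. -/
def embedFun (f : Fin k ↪ Fin n) (M : Op k) : Op n := fun a r =>
  if ∀ j, (∀ i, f i ≠ j) → a j = r j then M (a ∘ f) (r ∘ f) else 0

theorem extend_comp_embedding (f : Fin k ↪ Fin n) (c : Fin k → ZMod 2) (r : Fin n → ZMod 2) :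
    Function.extend f c r ∘ f = c :=
  funext fun i => f.injective.extend_apply c r i

theorem extend_apply_of_ne (f : Fin k ↪ Fin n) (c : Fin k → ZMod 2) (r : Fin n → ZMod 2) {j : Fin n}
    (hj : ∀ i, f i ≠ j) : Function.extend f c r j = r j :=
  Function.extend_apply' c r j fun ⟨i, hi⟩ => hj i hi

theorem eq_of_comp_eq {f : Fin k ↪ Fin n} {a b : Fin n → ZMod 2} (h : a ∘ f = b ∘ f)
    (h' : ∀ j, (∀ i, f i ≠ j) → a j = b j) : a = b := by
  funext j
  by_cases hj : ∀ i, f i ≠ j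
  · exact h' j hj
  · push Not at hj
    obtain ⟨i, rfl⟩ := hj
    exact congrFun h i

/-- Only intermediate states that agree with `r` off the image of `f` contribute; they are the
extensions by `r` of states on `k` qubits. -/
theorem embedFun_mul (f : Fin k ↪ Fin n) (M N : Op k) :
    embedFun f (M * N) = embedFun f M * embedFun f N := by
  ext a r
  rw [Matrix.mul_apply]
  by_cases har : ∀ j, (∀ i, f i ≠ j) → a j = r j
  · rw [embedFun, if_pos har, Matrix.mul_apply]
    refine Finset.sum_of_injOn (fun c => Function.extend f c r) ?_ (by simp) ?_ ?_
    · intro c _ d _ h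
      have h' := congrArg (fun v => v ∘ f) h
      simpa only [extend_comp_embedding] using h'
    · intro b _ hb
      by_cases hbr : ∀ j, (∀ i, f i ≠ j) → b j = r j
      · exfalso
        refine hb ⟨b ∘ f, by simp, eq_of_comp_eq (extend_comp_embedding f _ r) fun j hj => ?_⟩
        exact (extend_apply_of_ne f _ _ hj).trans (hbr j hj).symm
      · rw [embedFun, embedFun, if_neg hbr, mul_zero]
    · intro c _
      have h1 : ∀ j, (∀ i, f i ≠ j) → a j = Function.extend f c r j := fun j hj => by
        rw [extend_apply_of_ne f _ _ hj, har j hj]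
      have h2 : ∀ j, (∀ i, f i ≠ j) → Function.extend f c r j = r j := fun j hj =>
        extend_apply_of_ne f _ _ hj
      simp only [embedFun]
      rw [if_pos h1, if_pos h2, extend_comp_embedding]
  · rw [embedFun, if_neg har]
    refine (Finset.sum_eq_zero fun b _ => ?_).symm
    by_cases hab : ∀ j, (∀ i, f i ≠ j) → a j = b j
    · have hbr : ¬∀ j, (∀ i, f i ≠ j) → b j = r j := fun h =>
        har fun j hj => (hab j hj).trans (h j hj)
      rw [embedFun, embedFun, if_neg hbr, mul_zero]
    · rw [embedFun, if_neg hab, zero_mul]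

theorem embedFun_one (f : Fin k ↪ Fin n) : embedFun f 1 = 1 := by
  ext a r
  rw [embedFun, Matrix.one_apply, Matrix.one_apply]
  rcases eq_or_ne a r with rfl | h
  · simp
  · rw [if_neg h]
    split_ifs with h1 h2
    · exact absurd (eq_of_comp_eq h2 h1) h
    · rfl
    · rfl

/-- `embedFun` as a homomorphism of algebras. -/
def embed (f : Fin k ↪ Fin n) : Op k →ₐ[ℂ] Op n :=
  AlgHom.ofLinearMap
    { toFun := embedFun f
      map_add' := fun M N => by
        ext a r
        simp only [embedFun, Matrix.add_apply]
        split_ifs <;> simp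
      map_smul' := fun c M => by
        ext a r
        simp [embedFun] }
    (embedFun_one f) (embedFun_mul f)

theorem embed_apply (f : Fin k ↪ Fin n) (M : Op k) (a r : Fin n → ZMod 2) :
    embed f M a r = if ∀ j, (∀ i, f i ≠ j) → a j = r j then M (a ∘ f) (r ∘ f) else 0 := rfl

theorem embed_injective (f : Fin k ↪ Fin n) : Function.Injective (embed f) := by
  intro M N h
  ext a r
  have := congrFun (congrFun h (Function.extend f a 0)) (Function.extend f r 0)
  have h1 : ∀ j, (∀ i, f i ≠ j) → Function.extend f a 0 j = Function.extend f r 0 j := by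
    intro j hj
    rw [extend_apply_of_ne f _ _ hj, extend_apply_of_ne f _ _ hj]
  rwa [embed_apply, embed_apply, if_pos h1, if_pos h1, extend_comp_embedding,
    extend_comp_embedding] at this

/-- Rename qubits. -/
noncomputable def Pauli.relabel (f : Fin k ↪ Fin n) (P : Pauli k) : Pauli n :=
  ⟨P.s, Function.extend f P.x 0, Function.extend f P.z 0⟩

theorem embed_pauli (f : Fin k ↪ Fin n) (P : Pauli k) :
    embed f P.toMatrix = (P.relabel f).toMatrix := by
  ext a r
  rw [embed_apply, Pauli.toMatrix_eq_monomial, Pauli.toMatrix_eq_monomial]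
  have hs : sgn (Function.extend f P.z 0) r = sgn P.z (r ∘ f) := by
    refine (Finset.prod_of_injOn f f.injective.injOn (by simp) (fun j _ hj => ?_)
      fun i _ => ?_).symm
    · rw [extend_apply_of_ne f _ _ fun i hi => hj ⟨i, by simp, hi⟩]
      simp
    · rw [f.injective.extend_apply]
      rfl
  simp only [monomial, Pauli.relabel, hs]
  have hiff : a = r + Function.extend f P.x 0 ↔
      (∀ j, (∀ i, f i ≠ j) → a j = r j) ∧ a ∘ f = r ∘ f + P.x := by
    constructor
    · rintro rfl
      refine ⟨fun j hj => ?_, ?_⟩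
      · rw [Pi.add_apply, extend_apply_of_ne f _ _ hj, Pi.zero_apply, add_zero]
      · conv_rhs => rw [← extend_comp_embedding f P.x 0]
        rfl
    · rintro ⟨h1, h2⟩
      refine eq_of_comp_eq (f := f) ?_ fun j hj => ?_
      · rw [h2]
        conv_lhs => rw [← extend_comp_embedding f P.x 0]
        rfl
      · rw [h1 j hj, Pi.add_apply, extend_apply_of_ne f _ _ hj, Pi.zero_apply, add_zero]
  by_cases h1 : ∀ j, (∀ i, f i ≠ j) → a j = r j
  · rw [if_pos h1]
    by_cases h2 : a ∘ f = r ∘ f + P.x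
    · rw [if_pos h2, if_pos (hiff.2 ⟨h1, h2⟩)]
    · rw [if_neg h2, if_neg fun h => h2 (hiff.1 h).2]
  · rw [if_neg h1, if_neg fun h => h1 (hiff.1 h).1]

theorem extend_single (f : Fin k ↪ Fin n) (j : Fin k) (c : ZMod 2) :
    Function.extend f (Pi.single j c) (0 : Fin n → ZMod 2) = Pi.single (f j) c := by
  refine eq_of_comp_eq (f := f) ?_ fun i hi => ?_
  · rw [extend_comp_embedding]
    funext i
    simp [Pi.single_apply]
  · rw [extend_apply_of_ne f _ _ hi, Pi.zero_apply, Pi.single_eq_of_ne (hi j).symm]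

theorem extend_zero_zero (f : Fin k ↪ Fin n) :
    Function.extend f (0 : Fin k → ZMod 2) (0 : Fin n → ZMod 2) = 0 := by
  refine eq_of_comp_eq (f := f) (extend_comp_embedding f 0 0) fun i hi => ?_
  rw [extend_apply_of_ne f _ _ hi]

theorem relabel_X (f : Fin k ↪ Fin n) (j : Fin k) : (Pauli.X j).relabel f = Pauli.X (f j) := by
  simp only [Pauli.relabel, Pauli.X, extend_single, extend_zero_zero]

theorem relabel_Z (f : Fin k ↪ Fin n) (j : Fin k) : (Pauli.Z j).relabel f = Pauli.Z (f j) := by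
  simp only [Pauli.relabel, Pauli.Z, extend_single, extend_zero_zero]

/-- `embed` is an algebra homomorphism, so it suffices to know its effect on the `X` and `Z` of
which gates are polynomials. -/
theorem embed_gate (f : Fin k ↪ Fin n) (g : Gate k) :
    embed f g.toMatrix = (g.relabel f).toMatrix := by
  cases g <;> simp only [Gate.relabel, Gate.toMatrix_s, Gate.toMatrix_cz, Gate.toMatrix_cx,
    map_add, map_sub, map_smul, map_mul, map_one, embed_pauli, relabel_X, relabel_Z]

theorem embed_circuit (f : Fin k ↪ Fin n) (w : Circuit k) :
    embed f w.toMatrix = (w.relabel f).toMatrix := by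
  induction w with
  | nil => exact map_one _
  | cons g w ih =>
    rw [Circuit.toMatrix, map_mul, ih, embed_gate]
    rfl

theorem relabel_mul_self (f : Fin k ↪ Fin n) (P : Pauli k) :
    P.relabel f * P.relabel f = 1 ↔ P * P = 1 := by
  rw [← Pauli.toMatrix_injective.eq_iff, Pauli.toMatrix_mul, Pauli.toMatrix_one, ← embed_pauli,
    ← map_mul, ← map_one (embed f), (embed_injective f).eq_iff, ← Pauli.toMatrix_mul,
    ← Pauli.toMatrix_one, Pauli.toMatrix_injective.eq_iff]

theorem embed_pauliExp (f : Fin k ↪ Fin n) {Q : Pauli k} (hQ : Q * Q = 1) :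
    embed f (pauliExp Q) = pauliExp (Q.relabel f) := by
  rw [pauliExp_eq hQ, pauliExp_eq ((relabel_mul_self f Q).2 hQ), map_smul, map_add, map_one,
    map_smul, embed_pauli]

theorem embed_hadamardLayer (f : Fin k ↪ Fin n) (J : Finset (Fin k)) :
    embed f (hadamardLayer J) = hadamardLayer (J.map f) := by
  ext a r
  rw [embed_apply]
  simp only [hadamardLayer]
  rw [← Finset.prod_mul_prod_compl (Finset.univ.map f), Finset.prod_map]
  have h1 : ∏ j ∈ (Finset.univ.map f)ᶜ, (if j ∈ J.map f then
      omega * ((√2 : ℝ) : ℂ)⁻¹ * (-1 : ℂ) ^ ((a j).val * (r j).val)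
        else if a j = r j then 1 else 0) =
      if ∀ j, (∀ i, f i ≠ j) → a j = r j then 1 else 0 := by
    have : ∀ j ∈ (Finset.univ.map f)ᶜ, (if j ∈ J.map f then
        omega * ((√2 : ℝ) : ℂ)⁻¹ * (-1 : ℂ) ^ ((a j).val * (r j).val)
          else if a j = r j then 1 else 0) = if a j = r j then 1 else 0 := by
      intro j hj
      have hj' : ∀ i, f i ≠ j := by simpa using hj
      have : j ∉ J.map f := by
        simp only [Finset.mem_map, not_exists, not_and]
        exact fun i _ => hj' i
      rw [if_neg this]
    rw [Finset.prod_congr rfl this, Finset.prod_ite_zero, Finset.prod_const_one]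
    simp
  rw [h1, mul_ite, mul_one, mul_zero]
  simp only [Finset.mem_map', Function.comp]

end Embed

/-! ### Transport of a table entry to other qubits -/

section Transport

variable {k n : ℕ}

theorem Gate.relabel_relabel (f : Fin k → Fin n) {m : ℕ} (h : Fin n → Fin m) (g : Gate k) :
    (g.relabel f).relabel h = g.relabel (h ∘ f) := by
  cases g <;> rfl

theorem Circuit.relabel_relabel (f : Fin k → Fin n) {m : ℕ} (h : Fin n → Fin m) (w : Circuit k) :
    (w.relabel f).relabel h = w.relabel (h ∘ f) := by
  simp only [Circuit.relabel, List.map_map]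
  refine List.map_congr_left fun g _ => ?_
  exact Gate.relabel_relabel f h g

theorem Gate.relabel_congr {f f' : Fin k → Fin n} {g : Gate k}
    (h : ∀ i ∈ g.qubits, f i = f' i) : g.relabel f = g.relabel f' := by
  cases g <;> simp only [Gate.qubits, List.forall_mem_cons] at h <;> simp [Gate.relabel, h]

theorem Circuit.relabel_congr {f f' : Fin k → Fin n} {w : Circuit k}
    (h : ∀ g ∈ w, ∀ i ∈ g.qubits, f i = f' i) : w.relabel f = w.relabel f' :=
  List.map_congr_left fun g hg => Gate.relabel_congr (h g hg)

theorem Gate.qubits_relabel (f : Fin k → Fin n) (g : Gate k) :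
    (g.relabel f).qubits = g.qubits.map f := by
  cases g <;> rfl

theorem Gate.wellFormed_relabel {f : Fin k → Fin n} {g : Gate k} (hg : g.WellFormed)
    {S : Finset (Fin k)} (hf : Set.InjOn f S) (hS : ∀ i ∈ g.qubits, i ∈ S) :
    (g.relabel f).WellFormed := by
  cases g with
  | s j => trivial
  | cz i j =>
    simp only [Gate.qubits, List.forall_mem_cons] at hS
    exact fun h => hg (hf hS.1 hS.2.1 h)
  | cx i j =>
    simp only [Gate.qubits, List.forall_mem_cons] at hS
    exact fun h => hg (hf hS.1 hS.2.1 h)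

namespace TableEntry

/-- All parts of the entry are supported in the support of `Q`. -/
def Supported (e : TableEntry) : Prop :=
  (∀ g ∈ e.U, ∀ i ∈ g.qubits, i ∈ e.Q.support) ∧ (∀ g ∈ e.V, ∀ i ∈ g.qubits, i ∈ e.Q.support) ∧
    e.H ⊆ e.Q.support ∧ e.P.support ⊆ e.Q.support

instance (e : TableEntry) : Decidable e.Supported := by
  unfold Supported
  infer_instance

theorem supported_of_mem {e : TableEntry} (he : e ∈ bruhatTable) : e.Supported := by
  have : ∀ e ∈ bruhatTable, e.Supported := by decide +kernel
  exact this e he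

theorem map_eq_map_image {S T : Finset (Fin k)} {f : Fin k → Fin n} {m : ℕ} {ι : Fin n ↪ Fin m}
    {f' : Fin k ↪ Fin m} (hf : ∀ i ∈ S, f' i = ι (f i)) (hT : T ⊆ S) :
    T.map f' = (T.image f).map ι := by
  rw [Finset.map_eq_image, Finset.map_eq_image, Finset.image_image]
  exact Finset.image_congr fun i hi => hf i (hT hi)

/-- The labelling `f` need not be an embedding: absent table qubits carry a default label. It agrees
with the genuine embedding `f'` on the support of `e.Q`, where the whole row lives. So the row
embedded by `f'` equals the claim embedded by `ι`, and injectivity of `embed ι` removes `ι`. -/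
theorem Correct.transport {e : TableEntry} (he : e.Correct) (hs : e.Supported) (hQ : e.Q * e.Q = 1)
    {m : ℕ} {f : Fin 4 → Fin n} {ι : Fin n ↪ Fin m} {f' : Fin 4 ↪ Fin m}
    (hf : ∀ i ∈ e.Q.support, f' i = ι (f i)) {Q P : Pauli n} (hQ' : Q.relabel ι = e.Q.relabel f')
    (hP : P.relabel ι = e.P.relabel f') :
    hadamardLayer ((e.Q.support ∩ {2, 3}).image f) * pauliExp Q =
      omega ^ e.m.val • ((e.U.relabel f).toMatrix * hadamardLayer (e.H.image f) * P.toMatrix *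
        (e.V.relabel f).toMatrix) := by
  have hQ2 : Q * Q = 1 := by
    rw [← relabel_mul_self ι, hQ', relabel_mul_self, hQ]
  have hw (w : Circuit 4) (hw : ∀ g ∈ w, ∀ i ∈ g.qubits, i ∈ e.Q.support) :
      (w.relabel f).relabel ι = w.relabel f' := by
    rw [Circuit.relabel_relabel]
    exact Circuit.relabel_congr fun g hg i hi => (hf i (hw g hg i hi)).symm
  apply embed_injective ι
  have key := congrArg (embed f') he.2.2
  simp only [map_mul, map_smul, embed_hadamardLayer, embed_circuit, embed_pauli,
    embed_pauliExp _ hQ] at key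
  simp only [map_mul, map_smul, embed_hadamardLayer, embed_circuit, embed_pauli,
    embed_pauliExp _ hQ2, hQ', hP, hw _ hs.1, hw _ hs.2.1]
  rw [← map_eq_map_image hf Finset.inter_subset_left, ← map_eq_map_image hf hs.2.2.1, key]

end TableEntry

end Transport

/-! ### Tensor factors of Pauli operators -/

section Factors

variable {n : ℕ}

theorem mem_support {P : Pauli n} {j : Fin n} : j ∈ P.support ↔ P.x j ≠ 0 ∨ P.z j ≠ 0 := by
  simp [Pauli.support]

theorem bits_of_notMem_support {P : Pauli n} {j : Fin n} (h : j ∉ P.support) :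
    P.x j = 0 ∧ P.z j = 0 := by
  simpa [mem_support] using h

theorem mul_comm_of_disjoint {P Q : Pauli n} (h : Disjoint P.support Q.support) :
    P * Q = Q * P := by
  apply Pauli.toMatrix_injective
  have hc : Pauli.comm P Q = 0 := by
    refine Finset.sum_eq_zero fun j _ => ?_
    by_cases hj : j ∈ P.support
    · have := bits_of_notMem_support (Finset.disjoint_left.1 h hj)
      simp [this]
    · have := bits_of_notMem_support hj
      simp [this]
  rw [Pauli.toMatrix_mul, Pauli.toMatrix_mul, Pauli.toMatrix_mul_comm, hc]
  simp

theorem support_mul_of_disjoint {P Q : Pauli n} (h : Disjoint P.support Q.support) :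
    (P * Q).support = P.support ∪ Q.support := by
  ext j
  rw [Finset.mem_union]
  by_cases hj : j ∈ P.support
  · have := bits_of_notMem_support (Finset.disjoint_left.1 h hj)
    simp [mem_support, this]
  · have := bits_of_notMem_support hj
    simp [mem_support, this]

theorem mul_mul_self_of_disjoint {P Q : Pauli n} (h : Disjoint P.support Q.support)
    (hP : P * P = 1) (hQ : Q * Q = 1) : (P * Q) * (P * Q) = 1 := by
  nth_rw 2 [mul_comm_of_disjoint h]
  rw [mul_assoc, ← mul_assoc Q, hQ, one_mul, hP]

theorem support_part_subset (J : Finset (Fin n)) (P : Pauli n) : (P.part J).support ⊆ J := by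
  intro j hj
  by_contra h
  simp [mem_support, Pauli.part, h] at hj

theorem disjoint_support_rest (J : Finset (Fin n)) (P : Pauli n) :
    Disjoint (P.rest J).support J := by
  refine Finset.disjoint_left.2 fun j hj h => ?_
  simp [mem_support, Pauli.rest, h] at hj

theorem part_mul_self (J : Finset (Fin n)) (P : Pauli n) : P.part J * P.part J = 1 := by
  rw [Pauli.mul_self_eq_one_iff]
  simp only [Pauli.part]
  have h : ∀ j, ((if j ∈ J then P.x j else 0).val * (if j ∈ J then P.z j else 0).val) =
      if j ∈ J then (P.x j).val * (P.z j).val else 0 := fun j => by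
    split_ifs <;> simp
  simp only [h, Finset.sum_ite_mem, Finset.univ_inter, Nat.cast_sum]

theorem rest_mul_part (J : Finset (Fin n)) (P : Pauli n) : P.rest J * P.part J = P := by
  ext j
  · rw [Pauli.mul_s, Finset.sum_eq_zero]
    · simp [Pauli.rest]
    · intro j _
      by_cases hj : j ∈ J <;> simp [Pauli.rest, Pauli.part, hj]
  · by_cases hj : j ∈ J <;> simp [Pauli.rest, Pauli.part, hj]
  · by_cases hj : j ∈ J <;> simp [Pauli.rest, Pauli.part, hj]

theorem disjoint_rest_part (J : Finset (Fin n)) (P : Pauli n) :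
    Disjoint (P.rest J).support (P.part J).support :=
  (disjoint_support_rest J P).mono_right (support_part_subset J P)

theorem rest_mul_self (J : Finset (Fin n)) {P : Pauli n} (hP : P * P = 1) :
    P.rest J * P.rest J = 1 := by
  rw [← rest_mul_part J P] at hP
  nth_rw 2 [mul_comm_of_disjoint (disjoint_rest_part J P)] at hP
  rwa [mul_assoc, ← mul_assoc (P.part J), part_mul_self, one_mul] at hP

theorem support_hadamardConj (J : Finset (Fin n)) (P : Pauli n) :
    (P.hadamardConj J).support = P.support := by
  ext j
  by_cases hj : j ∈ J
  · simp [mem_support, Pauli.hadamardConj, hj, or_comm]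
  · simp [mem_support, Pauli.hadamardConj, hj]

theorem hadamardConj_mul_self (J : Finset (Fin n)) {P : Pauli n} (hP : P * P = 1) :
    P.hadamardConj J * P.hadamardConj J = 1 := by
  rw [Pauli.mul_self_eq_one_iff] at hP ⊢
  have key : ∀ a b : ZMod 4, 2 * (a + 2 * b) = 2 * a := by decide
  have hs : ∀ j, ((P.hadamardConj J).x j).val * ((P.hadamardConj J).z j).val =
      (P.x j).val * (P.z j).val := by
    intro j
    by_cases hj : j ∈ J
    · simp [Pauli.hadamardConj, hj, mul_comm]
    · simp [Pauli.hadamardConj, hj]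
  simp only [hs, ← hP]
  exact key _ _

/-- Hadamard conjugation is an involution, and off the support it does nothing. Hence the gates on
`J ∩ supp Q'` alone turn `Q''` back into `Q'`. -/
theorem hadamardConj_inter_support (J : Finset (Fin n)) (P : Pauli n) :
    (P.hadamardConj J).hadamardConj (J ∩ P.support) = P := by
  have key : ∀ a b : ZMod 4, a + 2 * b + 2 * b = a := by decide
  ext j
  · have h : ∑ j ∈ J ∩ P.support, ((P.hadamardConj J).x j).val * ((P.hadamardConj J).z j).val =
        ∑ j ∈ J, (P.x j).val * (P.z j).val := by
      refine Finset.sum_subset_zero_on_sdiff Finset.inter_subset_left (fun j hj => ?_)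
        fun j hj => ?_
      · rw [Finset.mem_sdiff, Finset.mem_inter, not_and] at hj
        simp [bits_of_notMem_support (hj.2 hj.1)]
      · simp [Pauli.hadamardConj, (Finset.mem_inter.1 hj).1, mul_comm]
    change P.s + 2 * ((∑ j ∈ J, (P.x j).val * (P.z j).val : ℕ) : ZMod 4) + 2 *
      ((∑ j ∈ J ∩ P.support, ((P.hadamardConj J).x j).val *
        ((P.hadamardConj J).z j).val : ℕ) : ZMod 4) = P.s
    rw [h, key]
  · by_cases hj : j ∈ J <;> by_cases hs : j ∈ P.support <;>
      simp [Pauli.hadamardConj, hj, hs]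
    have := bits_of_notMem_support hs
    rw [this.1, this.2]
  · by_cases hj : j ∈ J <;> by_cases hs : j ∈ P.support <;>
      simp [Pauli.hadamardConj, hj, hs]
    have := bits_of_notMem_support hs
    rw [this.1, this.2]

end Factors

/-! ### Controlled-`X` circuits and Hadamard layers -/

namespace CSSCircuit

variable {n : ℕ}

theorem ActsOn.conj_of_disjoint {S : Finset (Fin n)} {w : CSSCircuit n} (hw : w.ActsOn S)
    {P : Pauli n} (hP : Disjoint P.support S) : w.toCircuit.conj P = P := by
  induction w with
  | nil => rfl
  | cons p w ih =>
    obtain ⟨-, h1, h2⟩ := hw p List.mem_cons_self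
    have h1' := bits_of_notMem_support (Finset.disjoint_right.1 hP h1)
    have h2' := bits_of_notMem_support (Finset.disjoint_right.1 hP h2)
    have : (Gate.cx p.1 p.2).conj P = P := by
      ext1
      · rfl
      · simp [Gate.conj, h1'.1]
      · simp [Gate.conj, h2'.2]
    change (toCircuit w).conj ((Gate.cx p.1 p.2).conj P) = P
    rw [this]
    exact ih fun q hq => hw q (List.mem_cons_of_mem _ hq)

theorem ActsOn.dual {S : Finset (Fin n)} {w : CSSCircuit n} (hw : w.ActsOn S) :
    w.dual.ActsOn S := by
  intro p hp
  obtain ⟨q, hq, rfl⟩ := List.mem_map.1 hp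
  exact ⟨(hw q hq).1.symm, (hw q hq).2.2, (hw q hq).2.1⟩

theorem ActsOn.inv {S : Finset (Fin n)} {w : CSSCircuit n} (hw : w.ActsOn S) :
    w.inv.ActsOn S :=
  fun p hp => hw p (List.mem_reverse.1 hp)

theorem ActsOn.mul_hadamardLayer {J : Finset (Fin n)} {w : CSSCircuit n} (hw : w.ActsOn J) :
    w.toCircuit.toMatrix * hadamardLayer J = hadamardLayer J * w.dual.toCircuit.toMatrix := by
  induction w with
  | nil => exact (Commute.one_left _).eq
  | cons p w ih =>
    obtain ⟨h0, h1, h2⟩ := hw p List.mem_cons_self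
    change (toCircuit w).toMatrix * (Gate.cx p.1 p.2).toMatrix * hadamardLayer J =
      hadamardLayer J * ((CSSCircuit.dual w).toCircuit.toMatrix * (Gate.cx p.2 p.1).toMatrix)
    rw [mul_assoc, ← hadamardLayer_mul_cx h2 h1 h0.symm, ← mul_assoc, ← mul_assoc,
      ih fun q hq => hw q (List.mem_cons_of_mem _ hq)]

theorem ActsOn.commute_hadamardLayer {S J : Finset (Fin n)} {w : CSSCircuit n} (hw : w.ActsOn S)
    (h : Disjoint S J) : Commute (hadamardLayer J) w.toCircuit.toMatrix := by
  refine hadamardLayer_commute_circuit fun g hg j hj => ?_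
  obtain ⟨p, hp, rfl⟩ := List.mem_map.1 hg
  obtain ⟨-, h1, h2⟩ := hw p hp
  simp only [Gate.qubits, List.mem_cons, List.not_mem_nil, or_false] at hj
  rcases hj with rfl | rfl
  exacts [Finset.disjoint_left.1 h h1, Finset.disjoint_left.1 h h2]

theorem ActsOn.inv_mul {S : Finset (Fin n)} {w : CSSCircuit n} (hw : w.ActsOn S) :
    w.inv.toCircuit.toMatrix * w.toCircuit.toMatrix = 1 := by
  induction w with
  | nil => exact one_mul 1
  | cons p w ih =>
    have hi : CSSCircuit.inv (p :: w) = CSSCircuit.inv w ++ [p] := List.reverse_cons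
    have h1 : toCircuit [p] = [Gate.cx p.1 p.2] := rfl
    rw [hi, toCircuit_append, Circuit.toMatrix_append, h1]
    change 1 * (Gate.cx p.1 p.2).toMatrix * (CSSCircuit.inv w).toCircuit.toMatrix *
      ((toCircuit w).toMatrix * (Gate.cx p.1 p.2).toMatrix) = 1
    rw [one_mul, mul_assoc, ← mul_assoc _ (toCircuit w).toMatrix,
      ih fun q hq => hw q (List.mem_cons_of_mem _ hq), one_mul,
      Gate.cx_mul_self (hw p List.mem_cons_self).1]

end CSSCircuit

/-! ### The reduction to a table entry -/

set_option synthInstance.maxHeartbeats 200000 in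
set_option synthInstance.maxSize 4096 in
/-- Every admissible choice of Pauli factors on the four labelled qubits occurs in the table. -/
theorem exists_mem_bruhatTable : ∀ x0 z0 x1 z1 : ZMod 2,
    ((x1 = 0 ∧ z1 = 0) ∨ (x0 = 1 ∧ z0 = 1 ∧ x1 = 1 ∧ z1 = 1)) → ∀ x2 z2 x3 z3 : ZMod 2,
    ((x3 = 0 ∧ z3 = 0) ∨ (x2 = 1 ∧ z2 = 1 ∧ x3 = 1 ∧ z3 = 1)) →
    ¬(x0 = 0 ∧ z0 = 0 ∧ x2 = 0 ∧ z2 = 0) → ∀ s : ZMod 4,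
    2 * s = 2 * ((x0.val * z0.val + x1.val * z1.val + x2.val * z2.val + x3.val * z3.val : ℕ) :
      ZMod 4) →
    (bruhatTable.any fun e => decide (e.Q.s = s) && (decide (e.Q.x = ![x0, x1, x2, x3]) &&
      decide (e.Q.z = ![z0, z1, z2, z3]))) = true := by
  decide +kernel

section Labels

variable {n : ℕ}

/-- This lists the support in the search order, which fixes the labels. When two qubits occur, the
operator is `YY`, so all four bits are known regardless of that order. -/
theorem IsRepBits.filter_support {P : Pauli n} (h : IsRepBits P.x P.z) {qs : List (Fin n)}
    (hn : qs.Nodup) (hqs : ∀ j, j ∈ qs) :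
    qs.filter (fun j => j ∈ P.support) = [] ∨ (∃ j, qs.filter (fun j => j ∈ P.support) = [j]) ∨
      ∃ j k, qs.filter (fun j => j ∈ P.support) = [j, k] ∧
        (P.x j = 1 ∧ P.z j = 1) ∧ P.x k = 1 ∧ P.z k = 1 := by
  have hl : (qs.filter fun j => j ∈ P.support).length = P.support.card := by
    rw [← List.toFinset_card_of_nodup (hn.filter _)]
    congr 1
    ext j
    simp [hqs]
  have hone (j : Fin n) (hj : P.support ⊆ {j}) :
      qs.filter (fun j => j ∈ P.support) = [] ∨ ∃ j, qs.filter (fun j => j ∈ P.support) = [j] := by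
    have := Finset.card_le_card hj
    rw [← hl, Finset.card_singleton] at this
    rcases Nat.le_one_iff_eq_zero_or_eq_one.1 this with h0 | h1
    · exact Or.inl (List.length_eq_zero_iff.1 h0)
    · exact Or.inr (List.length_eq_one_iff.1 h1)
  rcases h with ⟨hx, hz⟩ | ⟨j, h⟩ | ⟨j, k, hjk, hx, hz⟩
  · refine Or.inl (List.length_eq_zero_iff.1 ?_)
    rw [hl, Finset.card_eq_zero]
    ext j
    simp [mem_support, hx, hz]
  · rw [← or_assoc]
    refine Or.inl (hone j fun i hi => ?_)
    rw [Finset.mem_singleton]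
    by_contra hij
    rcases h with ⟨hx, hz⟩ | ⟨hx, hz⟩ | ⟨hx, hz⟩ <;> simp [mem_support, hx, hz, hij] at hi
  · have hS : P.support = {j, k} := by
      ext i
      rw [mem_support, hx, hz, or_self, Finset.mem_insert, Finset.mem_singleton]
      rcases eq_or_ne i j with rfl | hj
      · simp [hjk]
      · rcases eq_or_ne i k with rfl | hk
        · simp [hjk.symm]
        · simp [hj, hk]
    rw [hS, Finset.card_pair hjk] at hl
    obtain ⟨a, b, hab⟩ := List.length_eq_two.1 hl
    have hone : ∀ i ∈ P.support, P.x i = 1 ∧ P.z i = 1 := by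
      intro i hi
      rw [mem_support, hz, hx, or_self, zmod_two_ne_zero_iff] at hi
      rw [hx, hz]
      exact ⟨hi, hi⟩
    have hmem : ∀ i ∈ qs.filter (fun j => j ∈ P.support), i ∈ P.support := fun i hi => by
      simpa using (List.mem_filter.1 hi).2
    rw [hS] at hmem
    rw [hab] at hmem
    rw [← hS] at hmem
    rw [hS]
    exact Or.inr (Or.inr ⟨a, b, hab, hone a (hmem a (by simp)), hone b (hmem b (by simp))⟩)

end Labels

/-! ### The algorithm for `Q` not diagonal -/

namespace Algorithm

open CSSCircuit

variable {n : ℕ} {qs : List (Fin n)} {D : Bruhat n} {Q : Pauli n}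

/-! ### Reduction of `Q` to the representative `Q'` -/

section Reduction

theorem circI_actsOn (hn : qs.Nodup) (hqs : ∀ j, j ∈ qs) : (circI qs D Q).ActsOn D.Hᶜ := by
  refine (cssOrbit_spec hn hqs _).1.mono fun j hj => ?_
  rw [Finset.mem_compl]
  exact Finset.disjoint_left.1 (disjoint_support_rest D.H (pulled D Q)) hj

theorem circH_actsOn (hn : qs.Nodup) (hqs : ∀ j, j ∈ qs) : (circH qs D Q).ActsOn D.H :=
  (cssOrbit_spec hn hqs _).1.mono (support_part_subset D.H (pulled D Q))

theorem disjoint_support_reducedI (hn : qs.Nodup) (hqs : ∀ j, j ∈ qs) :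
    Disjoint (reducedI qs D Q).support D.H := by
  refine Finset.disjoint_left.2 fun j hj => Finset.mem_compl.1 ?_
  refine (circI_actsOn hn hqs).support_conj_subset (fun i hi => Finset.mem_compl.2 ?_) hj
  exact Finset.disjoint_left.1 (disjoint_support_rest D.H (pulled D Q)) hi

theorem support_reducedH_subset (hn : qs.Nodup) (hqs : ∀ j, j ∈ qs) :
    (reducedH qs D Q).support ⊆ D.H :=
  (circH_actsOn hn hqs).support_conj_subset (support_part_subset D.H (pulled D Q))

theorem disjoint_reducedH_reducedI (hn : qs.Nodup) (hqs : ∀ j, j ∈ qs) :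
    Disjoint (reducedH qs D Q).support (reducedI qs D Q).support :=
  ((disjoint_support_reducedI hn hqs).mono_right (support_reducedH_subset hn hqs)).symm

theorem support_reduced (hn : qs.Nodup) (hqs : ∀ j, j ∈ qs) :
    (reduced qs D Q).support = (reducedH qs D Q).support ∪ (reducedI qs D Q).support :=
  support_mul_of_disjoint (disjoint_reducedH_reducedI hn hqs)

theorem pulled_spec {U : Op n} (hU : U ∈ phaseCSS n) (hT : D.U.Represents U) :
    Q.toMatrix * U = U * (pulled D Q).toMatrix := by
  rw [hT.mul_toMatrix hU, pulled, hT.image_preimage hU]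

theorem pulled_mul_self {U : Op n} (hU : U ∈ phaseCSS n) (hT : D.U.Represents U)
    (hQ : Q * Q = 1) : pulled D Q * pulled D Q = 1 := by
  apply Pauli.toMatrix_injective
  have h1 : (pulled D Q).toMatrix = U.conjTranspose * (Q.toMatrix * U) := by
    rw [pulled_spec hU hT, ← mul_assoc, conjTranspose_mul_of_mem hU, one_mul]
  rw [Pauli.toMatrix_mul, Pauli.toMatrix_one]
  nth_rw 1 [h1]
  rw [mul_assoc, mul_assoc, ← pulled_spec hU hT, ← mul_assoc Q.toMatrix, ← Pauli.toMatrix_mul, hQ,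
    Pauli.toMatrix_one, one_mul, conjTranspose_mul_of_mem hU]

theorem reducedI_mul_self (hn : qs.Nodup) (hqs : ∀ j, j ∈ qs)
    (h : pulled D Q * pulled D Q = 1) : reducedI qs D Q * reducedI qs D Q = 1 :=
  Circuit.conj_mul_self (circI_actsOn hn hqs).wellFormed (rest_mul_self D.H h)

theorem reducedH_mul_self (hn : qs.Nodup) (hqs : ∀ j, j ∈ qs) :
    reducedH qs D Q * reducedH qs D Q = 1 :=
  Circuit.conj_mul_self (circH_actsOn hn hqs).wellFormed (part_mul_self D.H _)

theorem reduced_mul_self (hn : qs.Nodup) (hqs : ∀ j, j ∈ qs)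
    (h : pulled D Q * pulled D Q = 1) : reduced qs D Q * reduced qs D Q = 1 :=
  mul_mul_self_of_disjoint (disjoint_reducedH_reducedI hn hqs) (reducedH_mul_self hn hqs)
    (reducedI_mul_self hn hqs h)

theorem isRepBits_reducedI (hn : qs.Nodup) (hqs : ∀ j, j ∈ qs) :
    IsRepBits (reducedI qs D Q).x (reducedI qs D Q).z :=
  (cssOrbit_spec hn hqs _).2

theorem isRepBits_reducedH (hn : qs.Nodup) (hqs : ∀ j, j ∈ qs) :
    IsRepBits (reducedH qs D Q).x (reducedH qs D Q).z :=
  (cssOrbit_spec hn hqs _).2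

theorem circuit_actsOn (hn : qs.Nodup) (hqs : ∀ j, j ∈ qs) :
    ActsOn Finset.univ (circI qs D Q ++ circH qs D Q) :=
  ((circI_actsOn hn hqs).mono (Finset.subset_univ _)).append
    ((circH_actsOn hn hqs).mono (Finset.subset_univ _))

/-- Each of the two circuits acts outside the support of the other tensor factor and therefore fixes
it. -/
theorem circuit_mul_pulled (hn : qs.Nodup) (hqs : ∀ j, j ∈ qs) :
    (toCircuit (circI qs D Q ++ circH qs D Q)).toMatrix * (pulled D Q).toMatrix =
      (reduced qs D Q).toMatrix * (toCircuit (circI qs D Q ++ circH qs D Q)).toMatrix := by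
  have hI := circI_actsOn (D := D) (Q := Q) hn hqs
  have hH := circH_actsOn (D := D) (Q := Q) hn hqs
  have h1 : (toCircuit (circI qs D Q ++ circH qs D Q)).conj ((pulled D Q).rest D.H) =
      reducedI qs D Q := by
    rw [toCircuit_append, Circuit.conj_append]
    exact hH.conj_of_disjoint (disjoint_support_reducedI hn hqs)
  have h2 : (toCircuit (circI qs D Q ++ circH qs D Q)).conj ((pulled D Q).part D.H) =
      reducedH qs D Q := by
    rw [toCircuit_append, Circuit.conj_append, hI.conj_of_disjoint]
    · rfl
    · exact (disjoint_compl_right (a := D.H)).mono_left (support_part_subset D.H _)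
  have hw := (circuit_actsOn (D := D) (Q := Q) hn hqs).wellFormed
  rw [reduced, mul_comm_of_disjoint (disjoint_reducedH_reducedI hn hqs), Pauli.toMatrix_mul,
    ← rest_mul_part D.H (pulled D Q), Pauli.toMatrix_mul, ← mul_assoc, Circuit.conj_spec hw,
    mul_assoc, Circuit.conj_spec hw, h1, h2, mul_assoc]

/-- The circuit off `J` commutes with the layer, and the one on `J` is dualised. This is the source
of `𝒞_H^#`. -/
theorem circuit_mul_hadamardLayer (hn : qs.Nodup) (hqs : ∀ j, j ∈ qs) :
    (toCircuit (circI qs D Q ++ circH qs D Q)).toMatrix * hadamardLayer D.H =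
      hadamardLayer D.H * (toCircuit (circI qs D Q ++ (circH qs D Q).dual)).toMatrix := by
  have hI := (circI_actsOn (D := D) (Q := Q) hn hqs).commute_hadamardLayer
    (disjoint_compl_left (a := D.H))
  rw [toCircuit_append, toCircuit_append, Circuit.toMatrix_append, Circuit.toMatrix_append,
    mul_assoc, ← hI.eq, ← mul_assoc, (circH_actsOn hn hqs).mul_hadamardLayer, mul_assoc]

/-- Conjugation by `U_ph` followed by the inverse of the CSS circuits maps `Q'` to `Q`. -/
theorem mul_circuit_inv (hn : qs.Nodup) (hqs : ∀ j, j ∈ qs) {U : Op n} (hU : U ∈ phaseCSS n)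
    (hT : D.U.Represents U) :
    U * (CSSCircuit.inv (circI qs D Q ++ circH qs D Q)).toCircuit.toMatrix *
        (reduced qs D Q).toMatrix =
      Q.toMatrix * (U * (CSSCircuit.inv (circI qs D Q ++ circH qs D Q)).toCircuit.toMatrix) := by
  have h1 := (circuit_actsOn (D := D) (Q := Q) hn hqs).inv_mul
  have h2 := circuit_mul_pulled (D := D) (Q := Q) hn hqs
  generalize (toCircuit (circI qs D Q ++ circH qs D Q)).toMatrix = M at *
  generalize (CSSCircuit.inv (circI qs D Q ++ circH qs D Q)).toCircuit.toMatrix = N at *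
  have h3 : M * N = 1 := mul_eq_one_comm.1 h1
  calc U * N * (reduced qs D Q).toMatrix
      = U * N * ((reduced qs D Q).toMatrix * M) * N := by
        simp only [mul_assoc, h3, mul_one]
    _ = U * (pulled D Q).toMatrix * N := by
        rw [← h2, ← mul_assoc, mul_assoc U, h1, mul_one]
    _ = _ := by rw [← pulled_spec hU hT, mul_assoc]

/-- If `Q'` had empty support it would be a scalar, and its conjugate `Q` would be the same scalar,
with `x = 0`. This excludes the identity, which has no row in the table. -/
theorem exists_mem_support_reduced (hn : qs.Nodup) (hqs : ∀ j, j ∈ qs) {U : Op n}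
    (hU : U ∈ phaseCSS n) (hT : D.U.Represents U) (hx : Q.x ≠ 0) :
    ∃ j, j ∈ (reduced qs D Q).support := by
  by_contra! h0
  apply hx
  have hR : reduced qs D Q = ⟨(reduced qs D Q).s, 0, 0⟩ := by
    ext j
    · rfl
    · exact (bits_of_notMem_support (h0 j)).1
    · exact (bits_of_notMem_support (h0 j)).2
  have hone : (⟨0, 0, 0⟩ : Pauli n) = 1 := rfl
  have h1 := mul_circuit_inv (Q := Q) hn hqs hU hT
  have hm : U * (CSSCircuit.inv (circI qs D Q ++ circH qs D Q)).toCircuit.toMatrix ∈ phaseCSS n :=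
    mul_mem hU (Circuit.toMatrix_mem_phaseCSS (circuit_actsOn hn hqs).inv.wellFormed)
  have h2 := mul_conjTranspose_of_mem hm
  generalize U * (CSSCircuit.inv (circI qs D Q ++ circH qs D Q)).toCircuit.toMatrix = W at *
  have h3 : Q.toMatrix = (⟨(reduced qs D Q).s, 0, 0⟩ : Pauli n).toMatrix := by
    calc Q.toMatrix = Q.toMatrix * W * W.conjTranspose := by rw [mul_assoc, h2, mul_one]
      _ = _ := by
        rw [← h1, hR, Pauli.toMatrix_smul, hone, Pauli.toMatrix_one, mul_smul_comm, mul_one,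
          smul_mul_assoc, h2]
  rw [Pauli.toMatrix_injective h3]

end Reduction

/-! ### Labelled qubits and the table lookup -/

section Labels

theorem labels_eq (hn : qs.Nodup) (hqs : ∀ j, j ∈ qs) :
    labels qs D Q = ![(qs.filter fun j => j ∈ (reducedI qs D Q).support)[0]?,
      (qs.filter fun j => j ∈ (reducedI qs D Q).support)[1]?,
      (qs.filter fun j => j ∈ (reducedH qs D Q).support)[0]?,
      (qs.filter fun j => j ∈ (reducedH qs D Q).support)[1]?] := by
  have hI : ∀ j, (j ∈ (reduced qs D Q).support ∧ j ∉ D.H) ↔ j ∈ (reducedI qs D Q).support := by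
    intro j
    rw [support_reduced hn hqs, Finset.mem_union]
    have h1 := @support_reducedH_subset n qs D Q hn hqs j
    have h2 : j ∈ (reducedI qs D Q).support → j ∉ D.H := fun h =>
      Finset.disjoint_left.1 (disjoint_support_reducedI hn hqs) h
    tauto
  have hH : ∀ j, (j ∈ (reduced qs D Q).support ∧ j ∈ D.H) ↔ j ∈ (reducedH qs D Q).support := by
    intro j
    rw [support_reduced hn hqs, Finset.mem_union]
    have h1 := @support_reducedH_subset n qs D Q hn hqs j
    have h2 : j ∈ (reducedI qs D Q).support → j ∉ D.H := fun h =>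
      Finset.disjoint_left.1 (disjoint_support_reducedI hn hqs) h
    tauto
  simp only [labels, hI, hH]

theorem mem_of_labels (hn : qs.Nodup) (hqs : ∀ j, j ∈ qs) {i : Fin 4} {j : Fin n}
    (h : labels qs D Q i = some j) :
    j ∈ (reduced qs D Q).support ∧ (i ∈ ({2, 3} : Finset (Fin 4)) ↔ j ∈ D.H) := by
  rw [labels_eq hn hqs] at h
  rw [support_reduced hn hqs, Finset.mem_union]
  have h1 := @support_reducedH_subset n qs D Q hn hqs j
  have h2 : j ∈ (reducedI qs D Q).support → j ∉ D.H := fun h =>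
    Finset.disjoint_left.1 (disjoint_support_reducedI hn hqs) h
  have hf (S : Finset (Fin n)) (k : ℕ) (hk : (qs.filter fun j => j ∈ S)[k]? = some j) : j ∈ S := by
    simpa using (List.mem_filter.1 (List.mem_of_getElem? hk)).2
  fin_cases i
  · have := hf _ 0 h
    simp [this, h2 this]
  · have := hf _ 1 h
    simp [this, h2 this]
  · have := hf _ 0 h
    simp [this, h1 this]
  · have := hf _ 1 h
    simp [this, h1 this]

theorem labels_injective (hn : qs.Nodup) (hqs : ∀ j, j ∈ qs) {i i' : Fin 4} {j : Fin n}
    (h : labels qs D Q i = some j) (h' : labels qs D Q i' = some j) : i = i' := by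
  have hm : i ∈ ({2, 3} : Finset (Fin 4)) ↔ i' ∈ ({2, 3} : Finset (Fin 4)) :=
    (mem_of_labels hn hqs h).2.trans (mem_of_labels hn hqs h').2.symm
  have hf (S : Finset (Fin n)) (h0 : (qs.filter fun j => j ∈ S)[0]? = some j)
      (h1 : (qs.filter fun j => j ∈ S)[1]? = some j) : False := by
    have := (List.getElem?_inj (List.getElem?_eq_some_iff.1 h0).1
      (hn.filter _)).1 (h0.trans h1.symm)
    exact absurd this (by norm_num)
  rw [labels_eq hn hqs] at h h'
  fin_cases i <;> fin_cases i' <;> first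
    | rfl
    | exact absurd hm (by decide)
    | exact (hf _ h h').elim
    | exact (hf _ h' h).elim

/-- Each tensor factor of `Q'` has at most two qubits, so the four labels exhaust the support. -/
theorem exists_labels (hn : qs.Nodup) (hqs : ∀ j, j ∈ qs) {j : Fin n}
    (hj : j ∈ (reduced qs D Q).support) : ∃ i, labels qs D Q i = some j := by
  rw [support_reduced hn hqs, Finset.mem_union] at hj
  rw [labels_eq hn hqs]
  have hmem (S : Finset (Fin n)) (hS : j ∈ S) : j ∈ qs.filter fun j => j ∈ S := by simp [hqs, hS]
  rcases hj with hj | hj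
  · have hm := hmem _ hj
    rcases (isRepBits_reducedH (D := D) (Q := Q) hn hqs).filter_support hn hqs with
      h | ⟨a, h⟩ | ⟨a, b, h, -⟩
    · simp [h] at hm
    · rw [h] at hm ⊢
      exact ⟨2, by rw [List.mem_singleton.1 hm]; rfl⟩
    · rw [h] at hm ⊢
      rcases List.mem_pair.1 hm with rfl | rfl
      exacts [⟨2, rfl⟩, ⟨3, rfl⟩]
  · have hm := hmem _ hj
    rcases (isRepBits_reducedI (D := D) (Q := Q) hn hqs).filter_support hn hqs with
      h | ⟨a, h⟩ | ⟨a, b, h, -⟩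
    · simp [h] at hm
    · rw [h] at hm ⊢
      exact ⟨0, by rw [List.mem_singleton.1 hm]; rfl⟩
    · rw [h] at hm ⊢
      rcases List.mem_pair.1 hm with rfl | rfl
      exacts [⟨0, rfl⟩, ⟨1, rfl⟩]

theorem turned_of_notMem (hn : qs.Nodup) (hqs : ∀ j, j ∈ qs) {j : Fin n} (hj : j ∉ D.H) :
    (turned qs D Q).x j = (reducedI qs D Q).x j ∧ (turned qs D Q).z j = (reducedI qs D Q).z j := by
  have := bits_of_notMem_support fun h =>
    hj (@support_reducedH_subset n qs D Q hn hqs j h)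
  simp [turned, Pauli.hadamardConj, hj, reduced, this]

theorem turned_of_mem (hn : qs.Nodup) (hqs : ∀ j, j ∈ qs) {j : Fin n} (hj : j ∈ D.H) :
    (turned qs D Q).x j = (reducedH qs D Q).z j ∧ (turned qs D Q).z j = (reducedH qs D Q).x j := by
  have := bits_of_notMem_support
    (Finset.disjoint_right.1 (disjoint_support_reducedI (D := D) (Q := Q) hn hqs) hj)
  simp [turned, Pauli.hadamardConj, hj, reduced, this]

theorem support_turned : (turned qs D Q).support = (reduced qs D Q).support :=
  support_hadamardConj _ _

/-- The restriction of `turned` to the labelled qubits. -/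
def window (qs : List (Fin n)) (D : Bruhat n) (Q : Pauli n) : Pauli 4 :=
  ⟨(turned qs D Q).s, fun i => (labels qs D Q i).elim 0 (turned qs D Q).x,
    fun i => (labels qs D Q i).elim 0 (turned qs D Q).z⟩

/-- The position in `n + 4` qubits of a table qubit: the labelled qubit, or an additional qubit. -/
def place (qs : List (Fin n)) (D : Bruhat n) (Q : Pauli n) (i : Fin 4) : Fin (n + 4) :=
  (labels qs D Q i).elim (Fin.natAdd n i) (Fin.castAdd 4)

theorem place_injective (hn : qs.Nodup) (hqs : ∀ j, j ∈ qs) :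
    Function.Injective (place qs D Q) := by
  intro i i' h
  simp only [place] at h
  cases hi : labels qs D Q i with
  | none =>
    cases hi' : labels qs D Q i' with
    | none => simpa [hi, hi'] using h
    | some j' =>
      rw [hi, hi', Fin.ext_iff] at h
      simp only [Option.elim, Fin.val_natAdd, Fin.val_castAdd] at h
      omega
  | some j =>
    cases hi' : labels qs D Q i' with
    | none =>
      rw [hi, hi', Fin.ext_iff] at h
      simp only [Option.elim, Fin.val_natAdd, Fin.val_castAdd] at h
      omega
    | some j' =>
      rw [hi, hi'] at h
      have : j = j' := by simpa using h
      exact labels_injective hn hqs hi (this ▸ hi')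

/-- On `n + 4` qubits, `v` padded by zeros equals `u` put at its places: labelled positions agree,
and the positions of absent labels receive `u i = 0`. -/
theorem extend_castAdd_eq (hn : qs.Nodup) (hqs : ∀ j, j ∈ qs) {v : Fin n → ZMod 2}
    {u : Fin 4 → ZMod 2} (hsome : ∀ i j, labels qs D Q i = some j → v j = u i)
    (hnone : ∀ i, labels qs D Q i = none → u i = 0)
    (hv : ∀ j, (∀ i, labels qs D Q i ≠ some j) → v j = 0) :
    Function.extend (Fin.castAddEmb 4 : Fin n ↪ Fin (n + 4)) v (0 : Fin (n + 4) → ZMod 2) =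
      Function.extend (⟨place qs D Q, place_injective hn hqs⟩ : Fin 4 ↪ Fin (n + 4)) u 0 := by
  funext j
  set f : Fin 4 ↪ Fin (n + 4) := ⟨place qs D Q, place_injective hn hqs⟩ with hf
  set ι : Fin n ↪ Fin (n + 4) := Fin.castAddEmb 4 with hι
  by_cases hj : ∀ i, f i ≠ j
  · rw [extend_apply_of_ne f _ _ hj]
    by_cases hj' : ∀ i, ι i ≠ j
    · rw [extend_apply_of_ne ι _ _ hj']
    · push Not at hj'
      obtain ⟨a, rfl⟩ := hj'
      rw [ι.injective.extend_apply]
      refine hv a fun i hi => hj i ?_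
      simp only [hf, hι, Function.Embedding.coeFn_mk, place, hi]
      rfl
  · push Not at hj
    obtain ⟨i, rfl⟩ := hj
    rw [f.injective.extend_apply]
    cases hi : labels qs D Q i with
    | none =>
      rw [hnone i hi, extend_apply_of_ne ι]
      · rfl
      · intro a ha
        simp only [hf, hι, Function.Embedding.coeFn_mk, place, hi, Option.elim, Fin.ext_iff,
          Fin.castAddEmb_apply, Fin.val_natAdd, Fin.val_castAdd] at ha
        omega
    | some a =>
      have : f i = ι a := by
        simp only [hf, hι, Function.Embedding.coeFn_mk, place, hi]
        rfl
      rw [this, ι.injective.extend_apply, hsome i a hi]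

theorem relabel_turned (hn : qs.Nodup) (hqs : ∀ j, j ∈ qs) :
    (turned qs D Q).relabel (Fin.castAddEmb 4 : Fin n ↪ Fin (n + 4)) =
      (window qs D Q).relabel ⟨place qs D Q, place_injective hn hqs⟩ := by
  have h0 : ∀ j, (∀ i, labels qs D Q i ≠ some j) →
      (turned qs D Q).x j = 0 ∧ (turned qs D Q).z j = 0 := by
    intro j hj
    refine bits_of_notMem_support fun h => ?_
    rw [support_turned] at h
    obtain ⟨i, hi⟩ := exists_labels hn hqs h
    exact hj i hi
  simp only [Pauli.relabel]
  rw [extend_castAdd_eq (Q := Q) hn hqs (u := (window qs D Q).x) (fun i j h => by simp [window, h])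
    (fun i h => by simp [window, h]) fun j hj => (h0 j hj).1,
    extend_castAdd_eq (Q := Q) hn hqs (u := (window qs D Q).z) (fun i j h => by simp [window, h])
    (fun i h => by simp [window, h]) fun j hj => (h0 j hj).2]
  rfl

theorem window_mul_self (hn : qs.Nodup) (hqs : ∀ j, j ∈ qs) (h : pulled D Q * pulled D Q = 1) :
    window qs D Q * window qs D Q = 1 := by
  rw [← relabel_mul_self ⟨place qs D Q, place_injective hn hqs⟩, ← relabel_turned hn hqs,
    relabel_mul_self]
  exact hadamardConj_mul_self _ (reduced_mul_self hn hqs h)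

theorem mem_support_window {i : Fin 4} : i ∈ (window qs D Q).support ↔
    ∃ j, labels qs D Q i = some j ∧ j ∈ (turned qs D Q).support := by
  cases h : labels qs D Q i <;> simp [mem_support, window, h]

/-- The row found may differ from the given one; later only its membership in the list and its value
of `Q` matter. -/
theorem exists_find?_eq {T : List TableEntry} {e : TableEntry} {R : Pauli 4} (he : e ∈ T)
    (hR : e.Q = R) : ∃ e ∈ T, T.find? (fun e => e.Q = R) = some e ∧ e.Q = R := by
  cases hl : T.find? fun e => e.Q = R with
  | none =>
    rw [List.find?_eq_none] at hl
    exact absurd hR (by simpa using hl e he)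
  | some e' => exact ⟨e', List.mem_of_find?_eq_some hl, rfl, by simpa using List.find?_some hl⟩

/-- The window is Hermitian and each half of it is trivial, a single Pauli or `YY`, since the
Hadamard exchange of `x` and `z` keeps the bits of `YY`. As the window is not a scalar, the finite
enumeration supplies the row. -/
theorem exists_lookup (hn : qs.Nodup) (hqs : ∀ j, j ∈ qs) {U : Op n} (hU : U ∈ phaseCSS n)
    (hT : D.U.Represents U) (hQ : Q * Q = 1) (hx : Q.x ≠ 0) :
    ∃ e ∈ bruhatTable, lookup qs D Q = some e ∧ e.Q = window qs D Q := by
  have hs := (Pauli.mul_self_eq_one_iff _).1 (window_mul_self hn hqs (pulled_mul_self hU hT hQ))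
  rw [Fin.sum_univ_four] at hs
  have hI : ((window qs D Q).x 1 = 0 ∧ (window qs D Q).z 1 = 0) ∨
      ((window qs D Q).x 0 = 1 ∧ (window qs D Q).z 0 = 1 ∧ (window qs D Q).x 1 = 1 ∧
        (window qs D Q).z 1 = 1) := by
    have hl := labels_eq (D := D) (Q := Q) hn hqs
    rcases (isRepBits_reducedI (D := D) (Q := Q) hn hqs).filter_support hn hqs with
      h | ⟨a, h⟩ | ⟨a, b, h, ha, hb⟩
    · have h1 : labels qs D Q 1 = none := by rw [hl, h]; rfl
      simp [window, h1]
    · have h1 : labels qs D Q 1 = none := by rw [hl, h]; rfl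
      simp [window, h1]
    · have h0 : labels qs D Q 0 = some a := by rw [hl, h]; rfl
      have h1 : labels qs D Q 1 = some b := by rw [hl, h]; rfl
      have ha' := turned_of_notMem (Q := Q) hn hqs
        (fun hh => absurd ((mem_of_labels hn hqs h0).2.2 hh) (by decide))
      have hb' := turned_of_notMem (Q := Q) hn hqs
        (fun hh => absurd ((mem_of_labels hn hqs h1).2.2 hh) (by decide))
      right
      simp [window, h0, h1, ha', hb', ha, hb]
  have hH : ((window qs D Q).x 3 = 0 ∧ (window qs D Q).z 3 = 0) ∨
      ((window qs D Q).x 2 = 1 ∧ (window qs D Q).z 2 = 1 ∧ (window qs D Q).x 3 = 1 ∧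
        (window qs D Q).z 3 = 1) := by
    have hl := labels_eq (D := D) (Q := Q) hn hqs
    rcases (isRepBits_reducedH (D := D) (Q := Q) hn hqs).filter_support hn hqs with
      h | ⟨a, h⟩ | ⟨a, b, h, ha, hb⟩
    · have h1 : labels qs D Q 3 = none := by rw [hl, h]; rfl
      simp [window, h1]
    · have h1 : labels qs D Q 3 = none := by rw [hl, h]; rfl
      simp [window, h1]
    · have h0 : labels qs D Q 2 = some a := by rw [hl, h]; rfl
      have h1 : labels qs D Q 3 = some b := by rw [hl, h]; rfl
      have ha' := turned_of_mem (Q := Q) hn hqs ((mem_of_labels hn hqs h0).2.1 (by decide))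
      have hb' := turned_of_mem (Q := Q) hn hqs ((mem_of_labels hn hqs h1).2.1 (by decide))
      right
      simp [window, h0, h1, ha', hb', ha, hb]
  -- If the first qubit of each half is trivial, so is the second, contradicting the nonempty
  -- support of `Q'`.
  have hne : ¬((window qs D Q).x 0 = 0 ∧ (window qs D Q).z 0 = 0 ∧ (window qs D Q).x 2 = 0 ∧
      (window qs D Q).z 2 = 0) := by
    rintro ⟨h1, h2, h3, h4⟩
    have h10 : (0 : ZMod 2) ≠ 1 := by decide
    have h5 : (window qs D Q).x 1 = 0 ∧ (window qs D Q).z 1 = 0 :=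
      hI.resolve_right fun h => h10 (h1.symm.trans h.1)
    have h6 : (window qs D Q).x 3 = 0 ∧ (window qs D Q).z 3 = 0 :=
      hH.resolve_right fun h => h10 (h3.symm.trans h.1)
    obtain ⟨j, hj⟩ := exists_mem_support_reduced (Q := Q) hn hqs hU hT hx
    obtain ⟨i, hi⟩ := exists_labels hn hqs hj
    rw [← support_turned] at hj
    have hw : i ∈ (window qs D Q).support := mem_support_window.2 ⟨j, hi, hj⟩
    rw [mem_support] at hw
    fin_cases i <;> simp [*] at hw
  have key := exists_mem_bruhatTable _ _ _ _ hI _ _ _ _ hH hne _ hs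
  rw [List.any_eq_true] at key
  obtain ⟨e, he, heQ⟩ := key
  simp only [Bool.and_eq_true, decide_eq_true_eq] at heQ
  have hvec (v : Fin 4 → ZMod 2) : ![v 0, v 1, v 2, v 3] = v := by
    funext i
    fin_cases i <;> rfl
  rw [hvec, hvec] at heQ
  have hew : e.Q = window qs D Q := Pauli.ext heQ.1 heQ.2.1 heQ.2.2
  exact exists_find?_eq he hew

end Labels

end Algorithm

namespace Algorithm

open CSSCircuit

variable {n : ℕ} {qs : List (Fin n)} {D : Bruhat n} {Q : Pauli n}

/-! ### Placing a table row on the labelled qubits -/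

section Placement

/-- The Pauli operator on `n` qubits placed on the labelled qubits. -/
def placed (qs : List (Fin n)) (D : Bruhat n) (Q : Pauli n) (P : Pauli 4) : Pauli n :=
  ⟨P.s, fun j => ∑ i, if labels qs D Q i = some j then P.x i else 0,
    fun j => ∑ i, if labels qs D Q i = some j then P.z i else 0⟩

theorem sum_labels (hn : qs.Nodup) (hqs : ∀ j, j ∈ qs) {u : Fin 4 → ZMod 2} {i : Fin 4} {j : Fin n}
    (h : labels qs D Q i = some j) : (∑ i, if labels qs D Q i = some j then u i else 0) = u i := by
  rw [Finset.sum_eq_single i]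
  · rw [if_pos h]
  · intro i' _ hne
    rw [if_neg fun h' => hne (labels_injective hn hqs h' h)]
  · simp

theorem sum_labels_eq_zero {u : Fin 4 → ZMod 2} {j : Fin n} (h : ∀ i, labels qs D Q i ≠ some j) :
    (∑ i, if labels qs D Q i = some j then u i else 0) = 0 :=
  Finset.sum_eq_zero fun i _ => if_neg (h i)

theorem labels_of_mem_support_window {i : Fin 4} (hi : i ∈ (window qs D Q).support) :
    ∃ j, labels qs D Q i = some j :=
  (mem_support_window.1 hi).imp fun _ h => h.1

theorem relabel_placed (hn : qs.Nodup) (hqs : ∀ j, j ∈ qs) {P : Pauli 4}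
    (hP : P.support ⊆ (window qs D Q).support) :
    (placed qs D Q P).relabel (Fin.castAddEmb 4 : Fin n ↪ Fin (n + 4)) =
      P.relabel ⟨place qs D Q, place_injective hn hqs⟩ := by
  have h0 : ∀ i, labels qs D Q i = none → P.x i = 0 ∧ P.z i = 0 := by
    refine fun i hi => bits_of_notMem_support fun h => ?_
    obtain ⟨j, hj⟩ := labels_of_mem_support_window (hP h)
    rw [hi] at hj
    exact absurd hj (by simp)
  simp only [Pauli.relabel, placed]
  rw [extend_castAdd_eq (D := D) (Q := Q) hn hqs (u := P.x) (fun i j h => sum_labels hn hqs h)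
    (fun i h => (h0 i h).1) fun j hj => sum_labels_eq_zero hj,
    extend_castAdd_eq (D := D) (Q := Q) hn hqs (u := P.z) (fun i j h => sum_labels hn hqs h)
    (fun i h => (h0 i h).2) fun j hj => sum_labels_eq_zero hj]

theorem support_placed_subset (hn : qs.Nodup) (hqs : ∀ j, j ∈ qs) (P : Pauli 4) :
    (placed qs D Q P).support ⊆ (reduced qs D Q).support := by
  intro j hj
  by_contra h
  have : ∀ i, labels qs D Q i ≠ some j := fun i hi => h (mem_of_labels hn hqs hi).1
  rw [mem_support] at hj
  exact hj.elim (fun hj => hj (sum_labels_eq_zero this)) fun hj => hj (sum_labels_eq_zero this)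

variable {q : Fin n}

theorem getD_mem_support (hn : qs.Nodup) (hqs : ∀ j, j ∈ qs) {i : Fin 4}
    (hi : i ∈ (window qs D Q).support) :
    (labels qs D Q i).getD q ∈ (reduced qs D Q).support := by
  obtain ⟨j, hj⟩ := labels_of_mem_support_window hi
  rw [hj]
  exact (mem_of_labels hn hqs hj).1

theorem getD_injOn (hn : qs.Nodup) (hqs : ∀ j, j ∈ qs) :
    Set.InjOn (fun i => (labels qs D Q i).getD q) (window qs D Q).support := by
  intro i hi i' hi' h
  obtain ⟨j, hj⟩ := labels_of_mem_support_window (Finset.mem_coe.1 hi)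
  obtain ⟨j', hj'⟩ := labels_of_mem_support_window (Finset.mem_coe.1 hi')
  simp only [hj, hj', Option.getD_some] at h
  exact labels_injective hn hqs hj (h ▸ hj')

/-- The labels `2, 3` are exactly those in `J`, so the `U'` of a row becomes the layer on `J ∩ supp
Q'`. -/
theorem image_getD (hn : qs.Nodup) (hqs : ∀ j, j ∈ qs) :
    ((window qs D Q).support ∩ {2, 3}).image (fun i => (labels qs D Q i).getD q) =
      D.H ∩ (reduced qs D Q).support := by
  ext j
  rw [Finset.mem_image, Finset.mem_inter]
  constructor
  · rintro ⟨i, hi, rfl⟩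
    rw [Finset.mem_inter] at hi
    obtain ⟨j, hj⟩ := labels_of_mem_support_window hi.1
    have := mem_of_labels hn hqs hj
    rw [hj]
    exact ⟨this.2.1 hi.2, this.1⟩
  · rintro ⟨hjH, hjS⟩
    obtain ⟨i, hi⟩ := exists_labels hn hqs hjS
    refine ⟨i, Finset.mem_inter.2 ⟨mem_support_window.2 ⟨j, hi, ?_⟩,
      (mem_of_labels hn hqs hi).2.2 hjH⟩, by rw [hi]; rfl⟩
    rw [support_turned]
    exact hjS

end Placement

/-- The decomposition of the exponential of the reduced Pauli operator times the Hadamard layer. -/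
theorem pauliExp_reduced_mul (hn : qs.Nodup) (hqs : ∀ j, j ∈ qs)
    (hp : pulled D Q * pulled D Q = 1) {e : TableEntry} (he : e ∈ bruhatTable)
    (heQ : e.Q = window qs D Q) (q : Fin n) :
    pauliExp (reduced qs D Q) * hadamardLayer D.H = omega ^ e.m.val •
      ((e.U.relabel fun i => (labels qs D Q i).getD q).toMatrix *
        hadamardLayer ((D.H \ (reduced qs D Q).support) ∪
          e.H.image fun i => (labels qs D Q i).getD q) *
        (placed qs D Q e.P).toMatrix *
        (e.V.relabel fun i => (labels qs D Q i).getD q).toMatrix) := by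
  have hsupp := TableEntry.supported_of_mem he
  have hf : ∀ i ∈ e.Q.support, (⟨place qs D Q, place_injective hn hqs⟩ : Fin 4 ↪ Fin (n + 4)) i =
      Fin.castAddEmb 4 ((labels qs D Q i).getD q) := by
    intro i hi
    rw [heQ] at hi
    obtain ⟨j, hj⟩ := labels_of_mem_support_window hi
    simp only [Function.Embedding.coeFn_mk, place, hj]
    rfl
  have key := (bruhatTable_correct he).transport hsupp (heQ ▸ window_mul_self hn hqs hp) hf
    (heQ ▸ relabel_turned hn hqs) (relabel_placed hn hqs (heQ ▸ hsupp.2.2.2))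
  have hr := reduced_mul_self hn hqs hp
  have ht : turned qs D Q * turned qs D Q = 1 := hadamardConj_mul_self _ hr
  have hS (i) (hi : i ∈ (window qs D Q).support) :
      (labels qs D Q i).getD q ∈ (reduced qs D Q).support := getD_mem_support hn hqs hi
  rw [heQ, image_getD hn hqs] at key
  unfold TableEntry.Supported at hsupp
  rw [heQ] at hsupp
  set S := (reduced qs D Q).support with hSdef
  set f := fun i => (labels qs D Q i).getD q with hfdef
  -- Only the Hadamard gates in the support of `Q'` enter the table identity; the others commute
  -- past `P'` and `V'` and rejoin the new layer.
  have hsplit : hadamardLayer D.H = hadamardLayer (D.H ∩ S) * hadamardLayer (D.H \ S) := by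
    rw [hadamardLayer_mul_of_disjoint (Finset.disjoint_sdiff_inter _ _).symm, Finset.union_comm,
      Finset.sdiff_union_inter]
  have hturn : hadamardLayer (D.H ∩ S) * pauliExp (turned qs D Q) =
      pauliExp (reduced qs D Q) * hadamardLayer (D.H ∩ S) := by
    refine mul_pauliExp ht hr ?_
    rw [hadamardLayer_mul_toMatrix, turned, hadamardConj_inter_support]
  have hV : Commute (hadamardLayer (D.H \ S)) (e.V.relabel f).toMatrix := by
    refine hadamardLayer_commute_circuit fun g hg j hj hmem => ?_
    obtain ⟨g', hg', rfl⟩ := List.mem_map.1 hg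
    rw [Gate.qubits_relabel] at hj
    obtain ⟨i, hi, rfl⟩ := List.mem_map.1 hj
    exact (Finset.mem_sdiff.1 hmem).2 (hS _ (hsupp.2.1 g' hg' i hi))
  have hP : Commute (hadamardLayer (D.H \ S)) (placed qs D Q e.P).toMatrix :=
    hadamardLayer_commute_pauli
      (Finset.disjoint_sdiff.mono_left (support_placed_subset hn hqs e.P))
  have hH : hadamardLayer (e.H.image f) * hadamardLayer (D.H \ S) =
      hadamardLayer ((D.H \ S) ∪ e.H.image f) := by
    rw [Finset.union_comm]
    refine hadamardLayer_mul_of_disjoint (Finset.disjoint_sdiff.mono_left fun j hj => ?_)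
    obtain ⟨i, hi, rfl⟩ := Finset.mem_image.1 hj
    exact hS _ (hsupp.2.2.1 hi)
  rw [hsplit, ← mul_assoc, ← hturn, key, smul_mul_assoc, mul_assoc _ _ (hadamardLayer (D.H \ S)),
    ← hV.eq, ← mul_assoc, mul_assoc _ _ (hadamardLayer (D.H \ S)), ← hP.eq, ← mul_assoc,
    mul_assoc _ _ (hadamardLayer (D.H \ S)), hH]

/-- Here `E`, `E'` are the exponentials of `Q`, `Q'`. `M` is the CSS circuit with inverse `N`, and
`M'` is its form behind the Hadamard layer `H`. `W`, `H'`, `P'`, `W'` come from the table, and `P₁`,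
`P₂` are the successive conjugates of `P`. Inserting `N M = 1` after `U` lets every factor pass in
turn. -/
theorem conj_exchange {A : Type*} [Ring A] [Algebra ℂ A] {c : ℂ}
    {E E' U V H H' M M' N P P₁ P₂ P' W W' : A} (hE : U * N * E' = E * (U * N))
    (hM : M * H = H * M') (hN : N * M = 1) (hP : M' * P = P₁ * M') (hP₁ : W' * P₁ = P₂ * W')
    (hH : E' * H = c • (W * H' * P' * W')) :
    E * (U * H * P * V) = c • (U * N * W * H' * (P' * P₂) * (W' * (M' * V))) :=
  calc E * (U * H * P * V) = E * (U * (N * M) * H * P * V) := by rw [hN, mul_one]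
    _ = E * (U * N) * (M * H) * P * V := by simp only [mul_assoc]
    _ = U * N * (E' * H) * (M' * P) * V := by
        rw [← hE, hM]
        simp only [mul_assoc]
    _ = c • (U * N * (W * H' * P') * (W' * P₁) * (M' * V)) := by
        rw [hH, hP]
        simp only [mul_smul_comm, smul_mul_assoc, mul_assoc]
    _ = _ := by
        rw [hP₁]
        simp only [mul_assoc]

theorem leftMul_of_x_ne_zero (hn : qs.Nodup) (hqs : ∀ j, j ∈ qs) {C : Op n} (hD : D.Represents C)
    (hQ : Q * Q = 1) (hx : Q.x ≠ 0) :
    ∃ D', leftMul qs D Q = some D' ∧ D'.Represents (pauliExp Q * C) := by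
  obtain ⟨U, hU, V, hV, hTU, hTV, rfl⟩ := hD
  obtain ⟨e, he, hl, heQ⟩ := exists_lookup hn hqs hU hTU hQ hx
  -- A nonzero bit of `Q.x` provides a qubit. The first one, `q`, is the default label of absent
  -- table qubits; it is never acted on through such a label, as a row stays inside the support of
  -- its `Q`.
  obtain ⟨q, qs', rfl⟩ : ∃ q qs', qs = q :: qs' := by
    obtain ⟨j, -⟩ := Function.ne_iff.1 hx
    exact List.exists_cons_of_ne_nil (List.ne_nil_of_mem (hqs j))
  unfold leftMul
  rw [if_neg hx, hl]
  refine ⟨_, rfl, ?_⟩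
  have hp := pulled_mul_self hU hTU hQ
  have key := pauliExp_reduced_mul hn hqs hp he heQ q
  have hsupp := TableEntry.supported_of_mem he
  have hcorr := bruhatTable_correct he
  have hinj := getD_injOn (D := D) (Q := Q) (q := q) hn hqs
  unfold TableEntry.Supported at hsupp
  rw [heQ] at hsupp
  set qs := q :: qs'
  set f : Fin 4 → Fin n := fun i => (labels qs D Q i).getD q
  have hwf (w : Circuit 4) (h1 : ∀ g ∈ w, g.WellFormed)
      (h2 : ∀ g ∈ w, ∀ i ∈ g.qubits, i ∈ (window qs D Q).support) :
      ∀ g ∈ w.relabel f, g.WellFormed := by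
    intro g hg
    obtain ⟨g', hg', rfl⟩ := List.mem_map.1 hg
    exact Gate.wellFormed_relabel (h1 g' hg') hinj (h2 g' hg')
  have hwU := hwf _ hcorr.1 hsupp.1
  have hwV := hwf _ hcorr.2.1 hsupp.2.1
  have hact := circuit_actsOn (D := D) (Q := Q) hn hqs
  have hinv := hact.inv.wellFormed
  have hd : ActsOn Finset.univ (circI qs D Q ++ (circH qs D Q).dual) :=
    ((circI_actsOn hn hqs).mono (Finset.subset_univ _)).append
      ((circH_actsOn hn hqs).dual.mono (Finset.subset_univ _))
  have hdw := hd.wellFormed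
  have hmI := mul_mem hU (Circuit.toMatrix_mem_phaseCSS hinv)
  refine ⟨_, mul_mem hmI (Circuit.toMatrix_mem_phaseCSS hwU), _,
    mul_mem (Circuit.toMatrix_mem_phaseCSS hwV) (mul_mem (Circuit.toMatrix_mem_phaseCSS hdw) hV),
    (hTU.rightMul hU hinv).rightMul hmI hwU, (hTV.leftMul hdw).leftMul hwV, ?_⟩
  have hexp := mul_pauliExp (reduced_mul_self hn hqs hp) hQ
    (mul_circuit_inv (Q := Q) hn hqs hU hTU)
  have hM := circuit_mul_hadamardLayer (D := D) (Q := Q) hn hqs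
  have hMinv := hact.inv_mul
  have hP1 := Circuit.conj_spec hdw D.P
  have hP2 := Circuit.conj_spec hwV
    ((toCircuit (circI qs D Q ++ (circH qs D Q).dual)).conj D.P)
  dsimp only
  rw [Pauli.toMatrix_mul, omega_pow_val_add, mul_smul_comm,
    conj_exchange hexp hM hMinv hP1 hP2 key, ← mul_smul]
  rfl

/-! ### The algorithm for diagonal `Q` -/

theorem toMatrix_Z (j : Fin n) :
    (Pauli.Z j).toMatrix = Matrix.diagonal fun r => (-1 : ℂ) ^ (r j).val := by
  have v1 : (1 : ZMod 2).val = 1 := rfl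
  ext a r
  rcases eq_or_ne a r with rfl | h
  · simp [Pauli.toMatrix_eq_monomial, monomial, Pauli.Z, sgn_single_left, v1]
  · simp [Pauli.toMatrix_eq_monomial, monomial, Pauli.Z, h]

theorem omega_pow_seven : omega ^ 7 = ((√2 : ℝ) : ℂ)⁻¹ * (1 - Complex.I) := by
  rw [show omega ^ 7 = omega ^ 4 * omega ^ 2 * omega by ring, omega_pow_four, omega_sq, omega_eq]
  linear_combination -((√2 : ℝ) : ℂ)⁻¹ * Complex.I_sq

/-- The diagonal entries are `ω⁻¹` and `ω`; removing `ω⁻¹` leaves `1, i`. For `+Z`, removing `ω`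
leaves `1, -i`, which is `S† = S³`. -/
theorem pauliExp_neg_Z (j : Fin n) :
    pauliExp (-Pauli.Z j) = omega ^ (-1 : ZMod 8).val • (Gate.s j).toMatrix := by
  have h7 : (-1 : ZMod 8).val = 7 := rfl
  have v1 : (1 : ZMod 2).val = 1 := rfl
  have hZ : (-Pauli.Z j) * (-Pauli.Z j) = 1 := by
    apply Pauli.toMatrix_injective
    rw [Pauli.toMatrix_mul, Pauli.toMatrix_neg, neg_mul_neg, ← Pauli.toMatrix_mul, Z_mul_self]
  rw [pauliExp_eq hZ, h7, omega_pow_seven, Pauli.toMatrix_neg, toMatrix_Z, Gate.toMatrix]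
  ext a r
  rcases eq_or_ne a r with rfl | h
  · rcases zmod_two_eq_zero_or_one (a j) with h | h
    · simp [h]
      ring
    · simp [h, v1]
      linear_combination ((√2 : ℝ) : ℂ)⁻¹ * Complex.I_sq
  · simp [h]

theorem pauliExp_Z (j : Fin n) :
    pauliExp (Pauli.Z j) = omega ^ (1 : ZMod 8).val •
      ((Gate.s j).toMatrix * (Gate.s j).toMatrix * (Gate.s j).toMatrix) := by
  have h1 : (1 : ZMod 8).val = 1 := rfl
  have v1 : (1 : ZMod 2).val = 1 := rfl
  rw [pauliExp_eq (Z_mul_self j), h1, pow_one, omega_eq, toMatrix_Z, Gate.toMatrix,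
    Matrix.diagonal_mul_diagonal, Matrix.diagonal_mul_diagonal]
  ext a r
  rcases eq_or_ne a r with rfl | h
  · rcases zmod_two_eq_zero_or_one (a j) with h | h
    · simp [h]
    · simp [h, v1]
      linear_combination ((√2 : ℝ) : ℂ)⁻¹ * Complex.I_sq
  · simp [h]

/-- The gates `CX_{kj}` add `e_k` to `z` for every other `k` in its support, leaving only `e_j`. -/
theorem fanIn_conj (hn : qs.Nodup) (hqs : ∀ j, j ∈ qs) (hx : Q.x = 0) {j : Fin n}
    {l : List (Fin n)} (h : (qs.filter fun j => Q.z j = 1) = j :: l) :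
    j ∉ l ∧ (toCircuit (l.map fun k => (k, j))).conj Q = ⟨Q.s, 0, Pi.single j 1⟩ := by
  have hj := of_filter_eq_cons h
  have hnd := hn.filter fun j => Q.z j = 1
  rw [h, List.nodup_cons] at hnd
  refine ⟨hnd.1, ?_⟩
  rw [conj_fanIn hnd.1, hj]
  have hsum := sum_map_filter_eq hn hqs Q.z fun k => (Pi.single k 1 : Fin n → ZMod 2)
  rw [sum_ite_single, one_smul, h, List.map_cons, List.sum_cons] at hsum
  ext1
  · rfl
  · have h0 : l.map (0 : Fin n → ZMod 2) = l.map fun _ => 0 := rfl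
    simp only [hx, h0]
    simp
  · rw [← hsum, add_assoc, bits_add_self, add_zero]

theorem diagCircuit_spec (hn : qs.Nodup) (hqs : ∀ j, j ∈ qs) (hQ : Q * Q = 1) (hx : Q.x = 0) :
    (∀ g ∈ diagCircuit qs Q, g.WellFormed) ∧
      pauliExp Q = omega ^ (if Q.s = 0 then 1 else -1 : ZMod 8).val •
        (diagCircuit qs Q).toMatrix := by
  have hs : Q.s = 0 ∨ Q.s = 2 := by
    have h := (Pauli.mul_self_eq_one_iff Q).1 hQ
    have key : ∀ a : ZMod 4, 2 * a = 0 → a = 0 ∨ a = 2 := by decide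
    refine key _ (h.trans ?_)
    simp [hx]
  have h20 : (2 : ZMod 4) ≠ 0 := by decide
  rw [diagCircuit]
  split
  -- Here `Q = ±1`, the exponential is the scalar `ω^{±1}`, and the circuit is empty.
  · rename_i hz
    have hz0 : Q.z = 0 := funext fun j => zmod_two_ne_one_iff.1 (filter_eq_nil_imp hqs hz j)
    refine ⟨by simp, ?_⟩
    rw [pauliExp_eq hQ]
    have h7 : omega ^ (-1 : ZMod 8).val = ((√2 : ℝ) : ℂ)⁻¹ * (1 - Complex.I) := by
      have h7 : (-1 : ZMod 8).val = 7 := rfl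
      rw [h7, omega_pow_seven]
    have h1 : omega ^ (1 : ZMod 8).val = ((√2 : ℝ) : ℂ)⁻¹ * (1 + Complex.I) := by
      have h1 : (1 : ZMod 8).val = 1 := rfl
      rw [h1, pow_one, omega_eq]
    rcases hs with h | h
    · have : Q = 1 := Pauli.ext h hx hz0
      rw [if_pos h, this, h1, Pauli.toMatrix_one, Circuit.toMatrix]
      module
    · have : Q = -1 := Pauli.ext h hx hz0
      rw [if_neg (by rw [h]; exact h20), this, h7, Pauli.toMatrix_neg, Pauli.toMatrix_one,
        Circuit.toMatrix]
      module
  · rename_i j l hz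
    obtain ⟨hjl, hconj⟩ := fanIn_conj hn hqs hx hz
    have hact : ActsOn Finset.univ (l.map fun k => (k, j)) := by
      intro p hp
      obtain ⟨k, hk, rfl⟩ := List.mem_map.1 hp
      exact ⟨fun h : k = j => hjl (h ▸ hk), Finset.mem_univ _, Finset.mem_univ _⟩
    have hfan : (l.map fun k => Gate.cx k j) = toCircuit (l.map fun k => (k, j)) := by
      simp [toCircuit]
    have hrev : (l.map fun k => Gate.cx k j).reverse =
        (CSSCircuit.inv (l.map fun k => (k, j))).toCircuit := by
      simp [toCircuit, CSSCircuit.inv]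
    simp only [hrev]
    rw [hfan]
    have hZ2 : (⟨Q.s, 0, Pi.single j 1⟩ : Pauli n) * ⟨Q.s, 0, Pi.single j 1⟩ = 1 := by
      rw [← hconj]
      exact Circuit.conj_mul_self hact.wellFormed hQ
    have hexp := mul_pauliExp hQ hZ2 (hconj ▸ Circuit.conj_spec hact.wellFormed Q)
    have hinv := hact.inv_mul
    constructor
    · intro g hg
      rw [List.mem_append, List.mem_append] at hg
      rcases hg with (hg | hg) | hg
      · exact hact.wellFormed g hg
      · split_ifs at hg <;> simp only [List.mem_cons, List.not_mem_nil, or_false, or_self] at hg <;>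
          rw [hg] <;> trivial
      · exact hact.inv.wellFormed g hg
    · have hmid : pauliExp (⟨Q.s, 0, Pi.single j 1⟩ : Pauli n) =
          omega ^ (if Q.s = 0 then 1 else -1 : ZMod 8).val •
            Circuit.toMatrix (if Q.s = 0 then [Gate.s j, Gate.s j, Gate.s j] else [Gate.s j]) := by
        rcases hs with h | h
        · rw [h, if_pos rfl, if_pos rfl]
          simp only [Circuit.toMatrix, one_mul]
          exact pauliExp_Z j
        · rw [h, if_neg h20, if_neg h20]
          simp only [Circuit.toMatrix, one_mul]
          exact pauliExp_neg_Z j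
      rw [Circuit.toMatrix_append, Circuit.toMatrix_append, ← mul_smul_comm, ← smul_mul_assoc,
        ← hmid, ← hexp, ← mul_assoc, hinv, one_mul]

/-- The exponential is itself `ω^{±1}` times a phase-CSS circuit, so it merges into `m` and `U_ph`.
-/
theorem leftMul_of_x_eq_zero (hn : qs.Nodup) (hqs : ∀ j, j ∈ qs) {C : Op n} (hD : D.Represents C)
    (hQ : Q * Q = 1) (hx : Q.x = 0) :
    ∃ D', leftMul qs D Q = some D' ∧ D'.Represents (pauliExp Q * C) := by
  obtain ⟨U, hU, V, hV, hTU, hTV, rfl⟩ := hD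
  obtain ⟨hw, hexp⟩ := diagCircuit_spec hn hqs hQ hx
  unfold leftMul
  rw [if_pos hx]
  refine ⟨_, rfl, _, mul_mem (Circuit.toMatrix_mem_phaseCSS hw) hU, V, hV, hTU.leftMul hw, hTV, ?_⟩
  rw [hexp, omega_pow_val_add, smul_mul_smul_comm, mul_comm]
  simp only [mul_assoc]

end Algorithm

end PhasedClifford

/-! ### The theorem -/

open PhasedClifford
theorem mainTheorem4 :
    -- every entry of the table is a correct phased Bruhat decomposition
    (∀ e ∈ bruhatTable, e.Correct) ∧
    -- every phase-CSS unitary has a binary-symplectic representation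
    (∀ (n : ℕ) (U : Op n), U ∈ phaseCSS n → ∃ T : Tableau n, T.Represents U) ∧
    -- the algorithm, for every search order of the qubits
    ∀ (n : ℕ) (qs : List (Fin n)), qs.Nodup → (∀ j, j ∈ qs) →
      ∀ (D : Bruhat n) (C : Op n) (Q : Pauli n), D.Represents C → Q.toMatrix.IsHermitian →
        -- reduction to a table entry, unless `Q` is a tensor product of `Z` and `I` up to sign
        (Q.x ≠ 0 →
          (Algorithm.reducedI qs D Q).IsOrbitRep ∧
          Disjoint (Algorithm.reducedI qs D Q).support D.H ∧
          (Algorithm.reducedH qs D Q).IsOrbitRep ∧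
          (Algorithm.reducedH qs D Q).support ⊆ D.H ∧
          (Algorithm.reduced qs D Q).support.card ≤ 4 ∧
          ∃ e ∈ bruhatTable, Algorithm.lookup qs D Q = some e) ∧
        -- the output is a phased Bruhat decomposition of the product
        ∃ D' : Bruhat n, Algorithm.leftMul qs D Q = some D' ∧ D'.Represents (pauliExp Q * C) := by
  refine ⟨fun e he => bruhatTable_correct he, fun n U hU => exists_tableau hU, ?_⟩
  intro n qs hn hqs D C Q hD hQ
  rw [Pauli.isHermitian_iff] at hQ
  refine ⟨fun hx => ?_, ?_⟩
  · obtain ⟨U, hU, V, hV, hTU, hTV, rfl⟩ := hD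
    have hp := Algorithm.pulled_mul_self hU hTU hQ
    obtain ⟨e, he, hl, -⟩ := Algorithm.exists_lookup hn hqs hU hTU hQ hx
    refine ⟨(Algorithm.isRepBits_reducedI hn hqs).isOrbitRep
      (Algorithm.reducedI_mul_self hn hqs hp), Algorithm.disjoint_support_reducedI hn hqs,
      (Algorithm.isRepBits_reducedH hn hqs).isOrbitRep (Algorithm.reducedH_mul_self hn hqs),
      Algorithm.support_reducedH_subset hn hqs, ?_, e, he, hl⟩
    -- Every qubit in the support of `Q'` bears one of four labels, and distinct qubits bear
    -- distinct ones; this bounds the weight.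
    choose! f hf using fun j => Algorithm.exists_labels (D := D) (Q := Q) (j := j) hn hqs
    have hinj : Set.InjOn f (Algorithm.reduced qs D Q).support := by
      intro j hj j' hj' h
      have h1 := hf j hj
      rw [h, hf j' hj'] at h1
      exact (Option.some_injective _ h1).symm
    have := Finset.card_le_card_of_injOn f (t := Finset.univ) (by simp) hinj
    simpa using this
  · by_cases hx : Q.x = 0
    · exact Algorithm.leftMul_of_x_eq_zero hn hqs hD hQ hx
    · exact Algorithm.leftMul_of_x_ne_zero hn hqs hD hQ hx
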